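/- The theory $V^0$ is the two-sorted first-order theory (number variables $x,y,\dots$; string variables $X,Y,\dots$ for finite sets of numbers) over the vocabulary $0,1,+,\cdot,=,\le,|\cdot|,\in,=_2$ that is axiomatized by 2-BASIC (B1--B12, L1, L2, SE) and the $\Sigma_0^B$-comprehension scheme $\exists X\,(|X|\le y\wedge\forall z<y\,(X(z)\leftrightarrow\varphi(z)))$, where $\varphi$ is any formula without string quantifiers, with all number quantifiers bounded, and not containing $X$. For a parameter $n$, a grid point is a pair $(x,y)$ with $0\le x,y\le n$, coded by $\langle x,y\rangle=(x+y)(x+y+1)+2y$; an (undirected) edge is a pair of grid points $p,q$ at distance $1$ that agree in one coordinate, coded by $\langle p,q\rangle$. Let $E$ be a set (string) of edges. The $E$-degree of a grid point is the number of edges of $E$ incident to it. $E$ is a curve if it is nonempty and every grid point has $E$-degree $0$ or $2$. $E$ connects $p_1$ and $p_2$ if $p_1,p_2$ have $E$-degree $1$ and all other grid points have $E$-degree $0$ or $2$. Two sets of edges intersect if some grid point has degree at least $1$ in both. Grid points $p_1,p_2$ are on different sides of $E$ if $x(p_1)=x(p_2)$, $|y(p_1)-y(p_2)|=2$, both have $E$-degree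 $0$, and the point halfway between them has $E$-degree $2$. Theorem. All these notions being expressed by formulas of the vocabulary of $V^0$, the theory $V^0$ proves that the following two sentences are equivalent: (a) For all $n$, all sets $B$, $R$ of edges and all grid points $p_1,p_2$: if $B$ is a curve, $p_1$ and $p_2$ are on different sides of $B$, and $R$ connects $p_1$ and $p_2$, then $B$ and $R$ intersect. (b) For all $n$ and all sets $B$, $R$ of edges: if $B$ connects $(0,n)$ and $(n,0)$, and $R$ connects $(0,0)$ and $(n,n)$, then $B$ and $R$ intersect. -/

import Mathlib

/-!
Two-sorted first-order logic over the vocabulary `0, 1, +, ·, =, ≤, | |, ∈, =₂`, the theory `V⁰`,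
and the formulas that express the notions about sets of grid edges.
-/

namespace TwoSorted

/-! ### Syntax -/

/-- Number terms.  Number variables and string variables are both named by natural numbers (they
are two separate stocks of variables); `len X` is the length term `|X|`. -/
inductive NumTerm : Type
  | var (x : ℕ) : NumTerm
  | zero : NumTerm
  | one : NumTerm
  | len (X : ℕ) : NumTerm
  | add (t u : NumTerm) : NumTerm
  | mul (t u : NumTerm) : NumTerm

instance : Zero NumTerm := ⟨NumTerm.zero⟩
instance : One NumTerm := ⟨NumTerm.one⟩
instance : Add NumTerm := ⟨NumTerm.add⟩
instance : Mul NumTerm := ⟨NumTerm.mul⟩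

/-- Formulas.  The only string terms are string variables. -/
inductive Formula : Type
  | numEq (t u : NumTerm) : Formula
  | strEq (X Y : ℕ) : Formula
  | le (t u : NumTerm) : Formula
  | mem (t : NumTerm) (X : ℕ) : Formula
  | neg (φ : Formula) : Formula
  | and (φ ψ : Formula) : Formula
  | or (φ ψ : Formula) : Formula
  | allNum (x : ℕ) (φ : Formula) : Formula
  | exNum (x : ℕ) (φ : Formula) : Formula
  | allStr (X : ℕ) (φ : Formula) : Formula
  | exStr (X : ℕ) (φ : Formula) : Formula

infix:62 " ≐ " => Formula.numEq
infix:62 " ≼ " => Formula.le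
prefix:max "∼" => Formula.neg
infixr:60 " ⩓ " => Formula.and
infixr:55 " ⩔ " => Formula.or

/-- `φ ⊃ ψ` -/
def Formula.imp (φ ψ : Formula) : Formula := ∼φ ⩔ ψ

infixr:50 " ⟹ " => Formula.imp

/-- `φ ↔ ψ` -/
def Formula.iff (φ ψ : Formula) : Formula := (φ ⟹ ψ) ⩓ (ψ ⟹ φ)

infix:45 " ⟺ " => Formula.iff

/-- `t < u` stands for `t ≤ u ∧ t ≠ u`. -/
def lt (t u : NumTerm) : Formula := (t ≼ u) ⩓ ∼(t ≐ u)

infix:62 " ≺ " => TwoSorted.lt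

/-- `∀ x ≤ t, φ` -/
def allLe (x : ℕ) (t : NumTerm) (φ : Formula) : Formula := .allNum x ((.var x ≼ t) ⟹ φ)

/-- `∃ x ≤ t, φ` -/
def exLe (x : ℕ) (t : NumTerm) (φ : Formula) : Formula := .exNum x ((.var x ≼ t) ⩓ φ)

/-- `∀ x < t, φ` -/
def allLt (x : ℕ) (t : NumTerm) (φ : Formula) : Formula := .allNum x ((.var x ≺ t) ⟹ φ)

/-- `∃ x < t, φ` -/
def exLt (x : ℕ) (t : NumTerm) (φ : Formula) : Formula := .exNum x ((.var x ≺ t) ⩓ φ)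

/-- `∃ X ≤ t, φ`, that is `∃ X (|X| ≤ t ∧ φ)` -/
def exStrLe (X : ℕ) (t : NumTerm) (φ : Formula) : Formula := .exStr X ((.len X ≼ t) ⩓ φ)

/-- The number variable `x` occurs in a term. -/
def NumTerm.ContainsNum (x : ℕ) : NumTerm → Prop
  | .var y => x = y
  | .zero => False
  | .one => False
  | .len _ => False
  | .add t u => t.ContainsNum x ∨ u.ContainsNum x
  | .mul t u => t.ContainsNum x ∨ u.ContainsNum x

/-- The string variable `X` occurs in a term. -/
def NumTerm.ContainsStr (X : ℕ) : NumTerm → Prop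
  | .var _ => False
  | .zero => False
  | .one => False
  | .len Y => X = Y
  | .add t u => t.ContainsStr X ∨ u.ContainsStr X
  | .mul t u => t.ContainsStr X ∨ u.ContainsStr X

/-- The string variable `X` occurs (free or bound) in a formula. -/
def Formula.ContainsStr (X : ℕ) : Formula → Prop
  | .numEq t u => t.ContainsStr X ∨ u.ContainsStr X
  | .strEq Y Z => X = Y ∨ X = Z
  | .le t u => t.ContainsStr X ∨ u.ContainsStr X
  | .mem t Y => t.ContainsStr X ∨ X = Y
  | .neg φ => φ.ContainsStr X
  | .and φ ψ => φ.ContainsStr X ∨ ψ.ContainsStr X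
  | .or φ ψ => φ.ContainsStr X ∨ ψ.ContainsStr X
  | .allNum _ φ => φ.ContainsStr X
  | .exNum _ φ => φ.ContainsStr X
  | .allStr Y φ => X = Y ∨ φ.ContainsStr X
  | .exStr Y φ => X = Y ∨ φ.ContainsStr X

/-- `Σ₀ᴮ` formulas: all number quantifiers are bounded and there are no string quantifiers. -/
inductive IsSigmaZeroB : Formula → Prop
  | numEq (t u : NumTerm) : IsSigmaZeroB (t ≐ u)
  | strEq (X Y : ℕ) : IsSigmaZeroB (.strEq X Y)
  | le (t u : NumTerm) : IsSigmaZeroB (t ≼ u)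
  | mem (t : NumTerm) (X : ℕ) : IsSigmaZeroB (.mem t X)
  | neg {φ : Formula} : IsSigmaZeroB φ → IsSigmaZeroB ∼φ
  | and {φ ψ : Formula} : IsSigmaZeroB φ → IsSigmaZeroB ψ → IsSigmaZeroB (φ ⩓ ψ)
  | or {φ ψ : Formula} : IsSigmaZeroB φ → IsSigmaZeroB ψ → IsSigmaZeroB (φ ⩔ ψ)
  | allLe {x : ℕ} {t : NumTerm} {φ : Formula} :
      ¬ t.ContainsNum x → IsSigmaZeroB φ → IsSigmaZeroB (allLe x t φ)
  | exLe {x : ℕ} {t : NumTerm} {φ : Formula} :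
      ¬ t.ContainsNum x → IsSigmaZeroB φ → IsSigmaZeroB (exLe x t φ)

/-! ### Semantics and provability -/

/-- Two-sorted structures for the vocabulary.  The two equality symbols are interpreted as true
equality; both sorts are nonempty. -/
structure Structure where
  Num : Type
  Str : Type
  zero : Num
  one : Num
  add : Num → Num → Num
  mul : Num → Num → Num
  le : Num → Num → Prop
  len : Str → Num
  mem : Num → Str → Prop
  str_nonempty : Nonempty Str

/-- The value of a term under an assignment `v` to number variables and `V` to string variables. -/
def NumTerm.val (M : Structure) (v : ℕ → M.Num) (V : ℕ → M.Str) : NumTerm → M.Num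
  | .var x => v x
  | .zero => M.zero
  | .one => M.one
  | .len X => M.len (V X)
  | .add t u => M.add (t.val M v V) (u.val M v V)
  | .mul t u => M.mul (t.val M v V) (u.val M v V)

/-- Tarski's truth definition. -/
def Formula.Holds (M : Structure) : Formula → (ℕ → M.Num) → (ℕ → M.Str) → Prop
  | .numEq t u, v, V => t.val M v V = u.val M v V
  | .strEq X Y, _, V => V X = V Y
  | .le t u, v, V => M.le (t.val M v V) (u.val M v V)
  | .mem t X, v, V => M.mem (t.val M v V) (V X)
  | .neg φ, v, V => ¬ φ.Holds M v V
  | .and φ ψ, v, V => φ.Holds M v V ∧ ψ.Holds M v V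
  | .or φ ψ, v, V => φ.Holds M v V ∨ ψ.Holds M v V
  | .allNum x φ, v, V => ∀ a : M.Num, φ.Holds M (Function.update v x a) V
  | .exNum x φ, v, V => ∃ a : M.Num, φ.Holds M (Function.update v x a) V
  | .allStr X φ, v, V => ∀ A : M.Str, φ.Holds M v (Function.update V X A)
  | .exStr X φ, v, V => ∃ A : M.Str, φ.Holds M v (Function.update V X A)

/-- `M` is a model of the universal closures of the formulas in `T`. -/
def Structure.Models (M : Structure) (T : Set Formula) : Prop :=
  ∀ φ ∈ T, ∀ v V, φ.Holds M v V

/-- `φ` is a theorem of the theory axiomatized by (the universal closures of) `T`: it is a logical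
consequence of these axioms, i.e. it holds in each of their models under every assignment.  (By
Gödel's completeness theorem this is derivability, and since the vocabulary is countable,
structures in `Type` suffice.) -/
def Proves (T : Set Formula) (φ : Formula) : Prop :=
  ∀ M : Structure, M.Models T → ∀ v V, φ.Holds M v V

/-! ### The theory `V⁰` -/

/-- The axioms 2-BASIC: B1 -- B12, L1, L2 and SE, in this order.  Here `x`, `y` are the number
variables 0, 1 and `X`, `Y` are the string variables 0, 1; in the last axiom `i` is the number
variable 0. -/
def twoBasic : Set Formula :=
  let x : NumTerm := .var 0
  let y : NumTerm := .var 1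
  { ∼(x + 1 ≐ 0),
    (x + 1 ≐ y + 1) ⟹ (x ≐ y),
    x + 0 ≐ x,
    x + (y + 1) ≐ (x + y) + 1,
    x * 0 ≐ 0,
    x * (y + 1) ≐ (x * y) + x,
    ((x ≼ y) ⩓ (y ≼ x)) ⟹ (x ≐ y),
    x ≼ x + y,
    0 ≼ x,
    (x ≼ y) ⩔ (y ≼ x),
    (x ≼ y) ⟺ (x ≺ y + 1),
    ∼(x ≐ 0) ⟹ exLe 1 x (y + 1 ≐ x),
    .mem y 0 ⟹ (y ≺ .len 0),
    (y + 1 ≐ .len 0) ⟹ .mem y 0,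
    ((.len 0 ≐ .len 1) ⩓ allLt 0 (.len 0) (.mem (.var 0) 0 ⟺ .mem (.var 0) 1)) ⟹ .strEq 0 1 }

/-- The `Σ₀ᴮ` comprehension scheme `∃ X ≤ y, ∀ z < y, (X(z) ↔ φ(z))`, for `φ` in `Σ₀ᴮ` not
containing `X` (other free variables are allowed in `φ`). -/
def sigmaZeroBComp : Set Formula :=
  { ψ | ∃ (X y z : ℕ) (φ : Formula), y ≠ z ∧ IsSigmaZeroB φ ∧ ¬ φ.ContainsStr X ∧
      ψ = exStrLe X (.var y) (allLt z (.var y) (.mem (.var z) X ⟺ φ)) }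

/-- The theory `V⁰`. -/
def VZero : Set Formula := twoBasic ∪ sigmaZeroBComp

/-! ### Grid points, edges, curves and paths as formulas

The parameter `n` bounds the coordinates.  A grid point is given by its two coordinates, and `E` is
(the name of) a string variable.  Bound number variables: the degree formulas bind variables
10 -- 15, the other formulas bind variables 30 -- 37, and the closed sentences bind variables 0 -- 4.
There is no capture: the terms `n`, `a`, `b`, `c`, `d` plugged into the former contain only
variables 0 -- 4, 36, 37, those plugged into the latter only variables 0 -- 4. -/

/-- The pairing function `⟨a, b⟩ = (a + b)(a + b + 1) + 2b`. -/
def pair (a b : NumTerm) : NumTerm := (a + b) * (a + b + 1) + (1 + 1) * b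

/-- The points `(a, b)` and `(c, d)` are adjacent: `|a - c| = 1` and `b = d`, or `a = c` and
`|b - d| = 1`. -/
def adjacent (a b c d : NumTerm) : Formula :=
  (((a + 1 ≐ c) ⩔ (c + 1 ≐ a)) ⩓ (b ≐ d)) ⩔ ((a ≐ c) ⩓ ((b + 1 ≐ d) ⩔ (d + 1 ≐ b)))

/-- The number that represents the pair of points `((a, b), (c, d))`. -/
def edgeCode (a b c d : NumTerm) : NumTerm := pair (pair a b) (pair c d)

/-- The undirected edge between `(a, b)` and `(c, d)` is in `E`; it may be represented by either of
its two codes. -/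
def hasEdge (E : ℕ) (a b c d : NumTerm) : Formula :=
  .mem (edgeCode a b c d) E ⩔ .mem (edgeCode c d a b) E

/-- `E` is a set of edges: all its elements represent edges between grid points. -/
def isEdgeSet (n : NumTerm) (E : ℕ) : Formula :=
  allLt 34 (.len E) (.mem (.var 34) E ⟹
    exLe 30 n (exLe 31 n (exLe 32 n (exLe 33 n
      (adjacent (.var 30) (.var 31) (.var 32) (.var 33) ⩓
        (.var 34 ≐ edgeCode (.var 30) (.var 31) (.var 32) (.var 33)))))))

/-- The `E`-degree of `(a, b)` is at least 1. -/
def degPos (n : NumTerm) (E : ℕ) (a b : NumTerm) : Formula :=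
  exLe 10 n (exLe 11 n (hasEdge E a b (.var 10) (.var 11)))

/-- The `E`-degree of `(a, b)` is 0. -/
def degZero (n : NumTerm) (E : ℕ) (a b : NumTerm) : Formula := ∼(degPos n E a b)

/-- The `E`-degree of `(a, b)` is 1: exactly one grid point is joined to `(a, b)` by an edge
of `E`. -/
def degOne (n : NumTerm) (E : ℕ) (a b : NumTerm) : Formula :=
  exLe 10 n (exLe 11 n (hasEdge E a b (.var 10) (.var 11) ⩓
    allLe 14 n (allLe 15 n (hasEdge E a b (.var 14) (.var 15) ⟹
      ((.var 14 ≐ .var 10) ⩓ (.var 15 ≐ .var 11))))))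

/-- The `E`-degree of `(a, b)` is 2: exactly two grid points are joined to `(a, b)` by an edge
of `E`. -/
def degTwo (n : NumTerm) (E : ℕ) (a b : NumTerm) : Formula :=
  exLe 10 n (exLe 11 n (exLe 12 n (exLe 13 n
    (∼((.var 10 ≐ .var 12) ⩓ (.var 11 ≐ .var 13)) ⩓
      hasEdge E a b (.var 10) (.var 11) ⩓ hasEdge E a b (.var 12) (.var 13) ⩓
      allLe 14 n (allLe 15 n (hasEdge E a b (.var 14) (.var 15) ⟹
        (((.var 14 ≐ .var 10) ⩓ (.var 15 ≐ .var 11)) ⩔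
          ((.var 14 ≐ .var 12) ⩓ (.var 15 ≐ .var 13)))))))))

/-- `E` is a curve: a nonempty set of edges such that every grid point has `E`-degree 0 or 2. -/
def isCurve (n : NumTerm) (E : ℕ) : Formula :=
  isEdgeSet n E ⩓ exLt 35 (.len E) (.mem (.var 35) E) ⩓
    allLe 36 n (allLe 37 n (degZero n E (.var 36) (.var 37) ⩔ degTwo n E (.var 36) (.var 37)))

/-- `E` is a set of edges that connects the grid points `(a, b)` and `(c, d)`: these two have
`E`-degree 1 and all other grid points have `E`-degree 0 or 2. -/
def connects (n : NumTerm) (E : ℕ) (a b c d : NumTerm) : Formula :=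
  isEdgeSet n E ⩓ degOne n E a b ⩓ degOne n E c d ⩓
    allLe 36 n (allLe 37 n
      ((∼((.var 36 ≐ a) ⩓ (.var 37 ≐ b)) ⩓ ∼((.var 36 ≐ c) ⩓ (.var 37 ≐ d))) ⟹
        (degZero n E (.var 36) (.var 37) ⩔ degTwo n E (.var 36) (.var 37))))

/-- The sets of edges `B` and `R` intersect: some grid point has `B`-degree and `R`-degree at
least 1. -/
def intersect (n : NumTerm) (B R : ℕ) : Formula :=
  exLe 36 n (exLe 37 n (degPos n B (.var 36) (.var 37) ⩓ degPos n R (.var 36) (.var 37)))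

/-- The points `(a, b)` and `(c, d)` are on different sides of `E`: `a = c`, `|b - d| = 2`, both
have `E`-degree 0, and the point halfway between them has `E`-degree 2. -/
def differentSides (n : NumTerm) (E : ℕ) (a b c d : NumTerm) : Formula :=
  (a ≐ c) ⩓ ((b + (1 + 1) ≐ d) ⩔ (d + (1 + 1) ≐ b)) ⩓ degZero n E a b ⩓ degZero n E c d ⩓
    exLe 36 n (((1 + 1) * .var 36 ≐ b + d) ⩓ degTwo n E a (.var 36))

/-- The discrete Jordan Curve Theorem for sets of edges, as a sentence: for all `n`, all sets `B`
and `R` of edges and all grid points `p₁ = (x₁, y₁)`, `p₂ = (x₂, y₂)`, if `B` is a curve, `p₁` and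
`p₂` are on different sides of `B`, and `R` connects `p₁` and `p₂`, then `B` and `R` intersect. -/
def jordanCurveSentence : Formula :=
  let n : NumTerm := .var 0
  let x₁ : NumTerm := .var 1
  let y₁ : NumTerm := .var 2
  let x₂ : NumTerm := .var 3
  let y₂ : NumTerm := .var 4
  let B : ℕ := 0
  let R : ℕ := 1
  .allNum 0 (.allStr 0 (.allStr 1 (allLe 1 n (allLe 2 n (allLe 3 n (allLe 4 n
    ((isCurve n B ⩓ differentSides n B x₁ y₁ x₂ y₂ ⩓ connects n R x₁ y₁ x₂ y₂) ⟹
      intersect n B R)))))))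

/-- The st-connectivity principle for sets of edges, as a sentence: for all `n` and all sets `B`
and `R` of edges, if `B` connects `(0, n)` and `(n, 0)` and `R` connects `(0, 0)` and `(n, n)`,
then `B` and `R` intersect. -/
def stConnectivitySentence : Formula :=
  let n : NumTerm := .var 0
  let B : ℕ := 0
  let R : ℕ := 1
  .allNum 0 (.allStr 0 (.allStr 1
    ((connects n B 0 n n 0 ⩓ connects n R 0 0 n n) ⟹ intersect n B R)))

end TwoSorted

/-! Provability is semantic here, so the claim is that each model `M` of V⁰ satisfies (a) if and
only if it satisfies (b). Such a model may be nonstandard, so induction is available only for what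
Σ₀ᴮ-comprehension reaches. Both directions are reductions by contraposition: from disjoint sets of
edges that violate one sentence, disjoint sets that violate the other are drawn in a larger grid.
The new sets are Σ₀ᴮ-definable from the old ones and are therefore strings of `M`
(`exists_edgeRel_shift`). Curves and paths are described by degrees alone and may have extra
components, so each construction is verified point by point; nothing is ever traversed or counted.

From (a) to (b), `frame` closes the path B outside the square, to the left and below, to a curve
through (0, -2). `prolong` extends both ends of R outside the square until they lie at (0, -1) and
(0, -3), on different sides of the frame. The additions create no intersection
(`disjoint_frame_prolong`), so (a) applies.

From (b) to (a), let (a, b) be the point of the curve B halfway between the ends (a, b + 1) and (a,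
b - 1) of R. Both edges of B at (a, b) are horizontal. The grid is cut between the columns a and a +
1, and the two half planes change places: with K = n + 1, the column a becomes column K, the column
a + 1 becomes column -K, and row b becomes row 0. An edge across the cut at height h above row 0 is
redrawn as an arc around everything, along the boundary of a square of half side 2K - h; edges below
are treated by reflection. Greater height gives a smaller square, so the arcs are nested and
disjoint.

The three crossings in rows b - 1, b, b + 1 are deleted instead of redrawn. This turns B into a path
from (K, 0) to (-K, 0), and leaves R with one end at (K, 1) or (-K, 1) and the other at (K, -1) or
(-K, -1). In the room left between the arcs, tails lead from these four ends to the four corners of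
the square of half side 2K, those of B to one diagonal and those of R to the other. Then (b) gives
an intersection, contradicting disjointness.

The direction from (b) to (a) rests on `IsDrawing` (replacing edges by paths preserves paths and
disjointness), on `isDrawing_swap` (the swap with arcs is such a drawing) and on
`exists_swapped_paths`, which assembles the picture. Coordinates live in the ring of differences of
`M`, an ordered ring that is discrete; this allows negative coordinates and linear arithmetic. -/

namespace TwoSorted

/-! ### Truth of the defined connectives -/

namespace Formula

variable {M : Structure} {v : ℕ → M.Num} {V : ℕ → M.Str} {φ ψ : Formula}

theorem holds_imp : (φ.imp ψ).Holds M v V ↔ (φ.Holds M v V → ψ.Holds M v V) :=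
  imp_iff_not_or.symm

theorem holds_iff : (φ.iff ψ).Holds M v V ↔ (φ.Holds M v V ↔ ψ.Holds M v V) := by
  exact (and_congr holds_imp holds_imp).trans iff_def.symm

end Formula

/-! ### The arithmetic of a model of `V⁰` -/

namespace Structure

variable (M : Structure)

instance : Zero M.Num := ⟨M.zero⟩
instance : One M.Num := ⟨M.one⟩
instance : Add M.Num := ⟨M.add⟩
instance : Mul M.Num := ⟨M.mul⟩
instance : LE M.Num := ⟨M.le⟩
-- Taken literally from the abbreviation `lt`, so that `Formula.holds_lt` is true by definition.
instance : LT M.Num := ⟨fun x y => x ≤ y ∧ x ≠ y⟩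
end Structure

/-- Unfolding the truth definition into the arithmetic notation of the model. -/
theorem NumTerm.val_var (M : Structure) (v : ℕ → M.Num) (V : ℕ → M.Str) (x : ℕ) :
    (NumTerm.var x).val M v V = v x := rfl
theorem NumTerm.val_zero (M : Structure) (v : ℕ → M.Num) (V : ℕ → M.Str) :
    (0 : NumTerm).val M v V = 0 := rfl
theorem NumTerm.val_one (M : Structure) (v : ℕ → M.Num) (V : ℕ → M.Str) :
    (1 : NumTerm).val M v V = 1 := rfl
theorem NumTerm.val_len (M : Structure) (v : ℕ → M.Num) (V : ℕ → M.Str) (X : ℕ) :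
    (NumTerm.len X).val M v V = M.len (V X) := rfl
theorem NumTerm.val_add (M : Structure) (v : ℕ → M.Num) (V : ℕ → M.Str) (t u : NumTerm) :
    (t + u).val M v V = t.val M v V + u.val M v V := rfl
theorem NumTerm.val_mul (M : Structure) (v : ℕ → M.Num) (V : ℕ → M.Str) (t u : NumTerm) :
    (t * u).val M v V = t.val M v V * u.val M v V := rfl

namespace Formula

variable {M : Structure} {v : ℕ → M.Num} {V : ℕ → M.Str} {φ ψ : Formula} {t u : NumTerm}

theorem holds_numEq : (t ≐ u).Holds M v V ↔ t.val M v V = u.val M v V := Iff.rfl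
theorem holds_le : (t ≼ u).Holds M v V ↔ t.val M v V ≤ u.val M v V := Iff.rfl
theorem holds_lt : (t ≺ u).Holds M v V ↔ t.val M v V < u.val M v V := Iff.rfl
theorem holds_mem {X : ℕ} : (mem t X).Holds M v V ↔ M.mem (t.val M v V) (V X) := Iff.rfl
theorem holds_neg : (∼φ).Holds M v V ↔ ¬ φ.Holds M v V := Iff.rfl
theorem holds_and : (φ ⩓ ψ).Holds M v V ↔ φ.Holds M v V ∧ ψ.Holds M v V := Iff.rfl
theorem holds_or : (φ ⩔ ψ).Holds M v V ↔ φ.Holds M v V ∨ ψ.Holds M v V := Iff.rfl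
theorem holds_allNum {x : ℕ} : (allNum x φ).Holds M v V ↔
    ∀ a : M.Num, φ.Holds M (Function.update v x a) V := Iff.rfl
theorem holds_exNum {x : ℕ} : (exNum x φ).Holds M v V ↔
    ∃ a : M.Num, φ.Holds M (Function.update v x a) V := Iff.rfl
theorem holds_allStr {X : ℕ} : (allStr X φ).Holds M v V ↔
    ∀ A : M.Str, φ.Holds M v (Function.update V X A) := Iff.rfl

end Formula

attribute [simp] Formula.holds_imp Formula.holds_iff Formula.holds_numEq
  Formula.holds_le Formula.holds_lt Formula.holds_mem Formula.holds_neg Formula.holds_and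
  Formula.holds_or Formula.holds_allNum Formula.holds_exNum Formula.holds_allStr
  NumTerm.val_var NumTerm.val_zero NumTerm.val_one NumTerm.val_len
  NumTerm.val_add NumTerm.val_mul

/-- `M` is a model of `V⁰`. -/
class VZeroModel (M : Structure) : Prop where
  models : M.Models VZero

namespace VZeroModel

variable {M : Structure} [VZeroModel M]

theorem holds_of_mem_twoBasic {φ : Formula} (h : φ ∈ twoBasic) (x y : M.Num) (X Y : M.Str) :
    φ.Holds M (fun | 0 => x | _ => y) (fun | 0 => X | _ => Y) :=
  models φ (Or.inl h) _ _

theorem succ_ne_zero (x : M.Num) : x + 1 ≠ 0 := by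
  obtain ⟨X⟩ := M.str_nonempty
  simpa using holds_of_mem_twoBasic (Or.inl rfl) x x X X

theorem succ_inj {x y : M.Num} (h : x + 1 = y + 1) : x = y := by
  obtain ⟨X⟩ := M.str_nonempty
  have := holds_of_mem_twoBasic (Or.inr <| .inl rfl) x y X X
  simp only [Formula.holds_imp] at this
  exact this h

theorem add_zero' (x : M.Num) : x + 0 = x := by
  obtain ⟨X⟩ := M.str_nonempty
  exact holds_of_mem_twoBasic (.inr <| .inr <| .inl rfl) x x X X

theorem add_succ (x y : M.Num) : x + (y + 1) = (x + y) + 1 := by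
  obtain ⟨X⟩ := M.str_nonempty
  exact holds_of_mem_twoBasic (.inr <| .inr <| .inr <| .inl rfl) x y X X

theorem mul_zero' (x : M.Num) : x * 0 = 0 := by
  obtain ⟨X⟩ := M.str_nonempty
  exact holds_of_mem_twoBasic (.inr <| .inr <| .inr <| .inr <| .inl rfl) x x X X

theorem mul_succ (x y : M.Num) : x * (y + 1) = (x * y) + x := by
  obtain ⟨X⟩ := M.str_nonempty
  exact holds_of_mem_twoBasic (.inr <| .inr <| .inr <| .inr <| .inr <| .inl rfl) x y X X

theorem le_antisymm' {x y : M.Num} (h : x ≤ y) (h' : y ≤ x) : x = y := by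
  obtain ⟨X⟩ := M.str_nonempty
  have := holds_of_mem_twoBasic (.inr <| .inr <| .inr <| .inr <| .inr <| .inr <| .inl rfl) x y X X
  simp only [Formula.holds_imp] at this
  exact this ⟨h, h'⟩

theorem le_add (x y : M.Num) : x ≤ x + y := by
  obtain ⟨X⟩ := M.str_nonempty
  exact holds_of_mem_twoBasic (.inr <| .inr <| .inr <| .inr <| .inr <| .inr <| .inr <| .inl rfl)
    x y X X

theorem zero_le' (x : M.Num) : 0 ≤ x := by
  obtain ⟨X⟩ := M.str_nonempty
  exact holds_of_mem_twoBasic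
    (.inr <| .inr <| .inr <| .inr <| .inr <| .inr <| .inr <| .inr <| .inl rfl) x x X X

theorem le_total' (x y : M.Num) : x ≤ y ∨ y ≤ x := by
  obtain ⟨X⟩ := M.str_nonempty
  exact holds_of_mem_twoBasic
    (.inr <| .inr <| .inr <| .inr <| .inr <| .inr <| .inr <| .inr <| .inr <| .inl rfl) x y X X

theorem le_iff_lt_succ (x y : M.Num) : x ≤ y ↔ x < y + 1 := by
  obtain ⟨X⟩ := M.str_nonempty
  have := holds_of_mem_twoBasic (.inr <| .inr <| .inr <| .inr <| .inr <| .inr <| .inr <| .inr <|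
    .inr <| .inr <| .inl rfl) x y X X
  simp only [Formula.holds_iff] at this
  exact this

theorem exists_succ {x : M.Num} (h : x ≠ 0) : ∃ y, y + 1 = x := by
  obtain ⟨X⟩ := M.str_nonempty
  have := holds_of_mem_twoBasic (.inr <| .inr <| .inr <| .inr <| .inr <| .inr <| .inr <| .inr <|
    .inr <| .inr <| .inr <| .inl rfl) x x X X
  simp only [Formula.holds_imp] at this
  obtain ⟨y, -, hy⟩ := this h
  exact ⟨y, hy⟩

theorem lt_len {y : M.Num} {X : M.Str} (h : M.mem y X) : y < M.len X := by
  have := holds_of_mem_twoBasic (.inr <| .inr <| .inr <| .inr <| .inr <| .inr <| .inr <| .inr <|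
    .inr <| .inr <| .inr <| .inr <| .inl rfl) y y X X
  simp only [Formula.holds_imp] at this
  exact this h

theorem mem_of_succ_eq_len {y : M.Num} {X : M.Str} (h : y + 1 = M.len X) : M.mem y X := by
  have := holds_of_mem_twoBasic (.inr <| .inr <| .inr <| .inr <| .inr <| .inr <| .inr <| .inr <|
    .inr <| .inr <| .inr <| .inr <| .inr <| .inl rfl) y y X X
  simp only [Formula.holds_imp] at this
  exact this h

theorem comprehension (φ : Formula) (hφ : IsSigmaZeroB φ) {X : ℕ} (hX : ¬ φ.ContainsStr X)
    {y z : ℕ} (hyz : y ≠ z) (v : ℕ → M.Num) (V : ℕ → M.Str) (b : M.Num) :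
    ∃ A : M.Str, M.len A ≤ b ∧ ∀ a < b, (M.mem a A ↔
      φ.Holds M (Function.update (Function.update v y b) z a) (Function.update V X A)) := by
  obtain ⟨A, hA, h⟩ := models (M := M) _ (Or.inr ⟨X, y, z, φ, hyz, hφ, hX, rfl⟩)
    (Function.update v y b) V
  refine ⟨A, by simpa using hA, fun a ha => ?_⟩
  have := h a
  simp only [Formula.holds_imp, Formula.holds_iff, Formula.holds_mem, NumTerm.val_var,
    Function.update_self, Formula.holds_lt] at this
  rw [Function.update_of_ne hyz, Function.update_self] at this
  exact this ha

/-- Discreteness of the order follows from B11, totality and antisymmetry alone. It has to come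
before `induction`, whose proof uses it. -/
theorem succ_le_iff {x y : M.Num} : x + 1 ≤ y ↔ x < y := by
  have hx : ∀ z : M.Num, z ≤ z := fun z => by simpa [add_zero'] using le_add z 0
  constructor
  · intro h
    by_contra hn
    have h1 : y ≤ x := by
      rcases le_total' y x with h | h'
      · exact h
      · by_contra hn'
        exact hn ⟨h', fun e => hn' (e ▸ hx x)⟩
    obtain ⟨h2, h3⟩ := (le_iff_lt_succ _ _).1 h1
    exact h3 (le_antisymm' h2 h)
  · intro h
    rcases le_total' (x + 1) y with h' | h'
    · exact h'
    · by_cases e : y = x + 1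
      · exact e ▸ hx y
      · exact absurd (le_antisymm' h.1 ((le_iff_lt_succ _ _).2 ⟨h', e⟩)) h.2

/-- The length function supplies a greatest element. If P fails at a, let A be the set of all c < a
with P c. By L2 the predecessor k of |A| lies in A, so P holds at k + 1; this number is either a
itself or, by L1, an element of A below |A| = k + 1. Variables 100 and 101 are the element and the
bound of the comprehension, and `hP` makes φ insensitive to them. -/
theorem induction {P : M.Num → Prop} (φ : Formula) (hφ : IsSigmaZeroB φ)
    {X : ℕ} (hX : ¬ φ.ContainsStr X) (v : ℕ → M.Num) (V : ℕ → M.Str)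
    (hP : ∀ a b c A, φ.Holds M
      (Function.update (Function.update (Function.update v 101 b) 100 c) 0 a)
        (Function.update V X A) ↔ P a)
    (h0 : P 0) (hs : ∀ a, P a → P (a + 1)) (a : M.Num) : P a := by
  by_contra ha
  -- The quantifier with the equation replaces the substitution of variable 100 for variable 0 in φ.
  obtain ⟨A, hA, h⟩ := comprehension (exLe 0 (.var 100) (φ ⩓ (.var 0 ≐ .var 100)))
    (.exLe (by simp [NumTerm.ContainsNum]) (.and hφ (.numEq _ _))) (X := X)
    (by simpa [exLe, Formula.ContainsStr, NumTerm.ContainsStr] using hX)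
    (y := 101) (z := 100) (by norm_num) v V a
  have hx : ∀ z : M.Num, z ≤ z := fun z => by simpa [add_zero'] using le_add z 0
  have key : ∀ c < a, (M.mem c A ↔ P c) := by
    intro c hc
    rw [h c hc]
    simp only [exLe, Formula.holds_exNum, Formula.holds_and, hP, Formula.holds_le,
      Formula.holds_numEq, NumTerm.val_var, Function.update_self]
    simp
    exact fun _ => hx c
  by_cases hl : M.len A = 0
  · have h0a : (0 : M.Num) < a := ⟨zero_le' _, fun e => ha (e ▸ h0)⟩
    have := lt_len ((key 0 h0a).2 h0)
    rw [hl] at this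
    exact this.2 rfl
  · obtain ⟨k, hk⟩ := exists_succ hl
    have hka : k < a := succ_le_iff.1 (hk ▸ hA)
    have hPk := hs k ((key k hka).1 (mem_of_succ_eq_len hk))
    by_cases e : k + 1 = a
    · exact ha (e ▸ hPk)
    · have := lt_len ((key (k + 1) ⟨succ_le_iff.2 hka, e⟩).2 hPk)
      exact this.2 hk

end VZeroModel

end TwoSorted

/-! ### Ordered semiring laws by Σ₀ᴮ induction -/

namespace TwoSorted

namespace VZeroModel

variable {M : Structure} [VZeroModel M]

/-- Induction for a `Σ₀ᴮ` formula in the variable `0` with number parameters `x`, `y`. -/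
theorem induction₂ {P : M.Num → Prop} (φ : Formula) (x y : M.Num) (hφ : IsSigmaZeroB φ)
    (hX : ¬ φ.ContainsStr 0)
    (hP : ∀ a b c V, φ.Holds M (Function.update (Function.update (Function.update
      (fun | 1 => x | _ => y) 101 b) 100 c) 0 a) V ↔ P a)
    (h0 : P 0) (hs : ∀ a, P a → P (a + 1)) (a : M.Num) : P a := by
  obtain ⟨X⟩ := M.str_nonempty
  exact induction φ hφ hX _ (fun _ => X) (fun a b c A => hP a b c _) h0 hs a

theorem le_refl' (x : M.Num) : x ≤ x := by simpa [add_zero'] using le_add x 0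

theorem le_succ_iff {x y : M.Num} : x ≤ y + 1 ↔ x ≤ y ∨ x = y + 1 := by
  constructor
  · intro h
    by_cases e : x = y + 1
    · exact .inr e
    · exact .inl ((le_iff_lt_succ _ _).2 ⟨h, e⟩)
  · rintro (h | rfl)
    · exact ((le_iff_lt_succ _ _).1 h).1
    · exact le_refl' _

theorem le_zero_iff {x : M.Num} : x ≤ 0 ↔ x = 0 :=
  ⟨fun h => le_antisymm' h (zero_le' _), fun h => h ▸ le_refl' _⟩

theorem le_trans' {x y z : M.Num} (h : x ≤ y) (h' : y ≤ z) : x ≤ z := by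
  revert h'
  refine induction₂ (P := fun z => y ≤ z → x ≤ z)
    ((.var 2 ≼ .var 0) ⟹ (.var 1 ≼ .var 0)) x y (.or (.neg (.le _ _)) (.le _ _))
    (by simp [Formula.imp, Formula.ContainsStr, NumTerm.ContainsStr]) (by simp) ?_ ?_ z
  · intro h'
    rw [le_zero_iff] at h'
    exact h' ▸ h
  · intro a ih h'
    rcases le_succ_iff.1 h' with h' | rfl
    · exact le_succ_iff.2 (.inl (ih h'))
    · exact h

theorem zero_add' (x : M.Num) : 0 + x = x := by
  refine induction₂ (P := fun x => 0 + x = x) (0 + .var 0 ≐ .var 0) 0 0 (.numEq _ _)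
    (by simp only [Formula.ContainsStr]; exact fun h => h.elim (fun h => h.elim id id) id)
    (by simp) (add_zero' _) (fun a ih => ?_) x
  rw [add_succ, ih]

theorem add_assoc' (x y z : M.Num) : x + y + z = x + (y + z) := by
  refine induction₂ (P := fun z => x + y + z = x + (y + z))
    (.var 1 + .var 2 + .var 0 ≐ .var 1 + (.var 2 + .var 0)) x y (.numEq _ _)
    (by rintro (((_ | _) | _) | _ | _ | _) <;> assumption) (by simp)
    (by rw [add_zero', add_zero']) (fun a ih => ?_) z
  rw [add_succ, ih, add_succ, add_succ]

theorem succ_add (x y : M.Num) : x + 1 + y = x + y + 1 := by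
  refine induction₂ (P := fun y => x + 1 + y = x + y + 1)
    (.var 1 + 1 + .var 0 ≐ .var 1 + .var 0 + 1) x x (.numEq _ _)
    (by rintro (((_ | _) | _) | (_ | _) | _) <;> assumption) (by simp)
    (by rw [add_zero', add_zero']) (fun a ih => ?_) y
  rw [add_succ, ih, add_succ]

theorem add_comm' (x y : M.Num) : x + y = y + x := by
  refine induction₂ (P := fun y => x + y = y + x)
    (.var 1 + .var 0 ≐ .var 0 + .var 1) x x (.numEq _ _)
    (by rintro ((_ | _) | (_ | _)) <;> assumption) (by simp)
    (by rw [add_zero', zero_add']) (fun a ih => ?_) y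
  rw [add_succ, ih, succ_add]

theorem zero_mul' (x : M.Num) : 0 * x = 0 := by
  refine induction₂ (P := fun x => 0 * x = 0) (0 * .var 0 ≐ 0) 0 0 (.numEq _ _)
    (by rintro ((_ | _) | _) <;> assumption)
    (by simp) (mul_zero' _) (fun a ih => ?_) x
  rw [mul_succ, ih, add_zero']

theorem mul_add' (x y z : M.Num) : x * (y + z) = x * y + x * z := by
  refine induction₂ (P := fun z => x * (y + z) = x * y + x * z)
    (.var 1 * (.var 2 + .var 0) ≐ .var 1 * .var 2 + .var 1 * .var 0) x y (.numEq _ _)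
    (by rintro ((_ | _ | _) | (_ | _) | _ | _) <;> assumption) (by simp)
    (by rw [add_zero', mul_zero', add_zero']) (fun a ih => ?_) z
  rw [add_succ, mul_succ, ih, mul_succ, add_assoc']

theorem mul_assoc' (x y z : M.Num) : x * y * z = x * (y * z) := by
  refine induction₂ (P := fun z => x * y * z = x * (y * z))
    (.var 1 * .var 2 * .var 0 ≐ .var 1 * (.var 2 * .var 0)) x y (.numEq _ _)
    (by rintro (((_ | _) | _) | _ | _ | _) <;> assumption) (by simp)
    (by rw [mul_zero', mul_zero', mul_zero']) (fun a ih => ?_) z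
  rw [mul_succ, ih, mul_succ, mul_add']

theorem succ_mul (x y : M.Num) : (x + 1) * y = x * y + y := by
  refine induction₂ (P := fun y => (x + 1) * y = x * y + y)
    ((.var 1 + 1) * .var 0 ≐ .var 1 * .var 0 + .var 0) x x (.numEq _ _)
    (by rintro (((_ | _) | _) | (_ | _) | _) <;> assumption) (by simp)
    (by rw [mul_zero', mul_zero', add_zero']) (fun a ih => ?_) y
  rw [mul_succ, ih, mul_succ, add_assoc' _ a, add_comm' a, succ_add, add_assoc' _ x, add_succ x]

theorem mul_comm' (x y : M.Num) : x * y = y * x := by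
  refine induction₂ (P := fun y => x * y = y * x)
    (.var 1 * .var 0 ≐ .var 0 * .var 1) x x (.numEq _ _)
    (by rintro ((_ | _) | (_ | _)) <;> assumption) (by simp)
    (by rw [mul_zero', zero_mul']) (fun a ih => ?_) y
  rw [mul_succ, ih, succ_mul]

theorem add_right_cancel' {x y z : M.Num} (h : x + z = y + z) : x = y := by
  revert h
  refine induction₂ (P := fun z => x + z = y + z → x = y)
    ((.var 1 + .var 0 ≐ .var 2 + .var 0) ⟹ (.var 1 ≐ .var 2)) x y
    (.or (.neg (.numEq _ _)) (.numEq _ _)) (by rintro (((_ | _) | _ | _) | _ | _) <;> assumption)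
    (by simp)
    (by rw [add_zero', add_zero']; exact id) (fun a ih h => ?_) z
  rw [add_succ, add_succ] at h
  exact ih (succ_inj h)

theorem add_le_add' {x y : M.Num} (h : x ≤ y) (z : M.Num) : x + z ≤ y + z := by
  refine induction₂ (P := fun z => x + z ≤ y + z)
    (.var 1 + .var 0 ≼ .var 2 + .var 0) x y (.le _ _)
    (by rintro ((_ | _) | _ | _) <;> assumption) (by simp)
    (by rwa [add_zero', add_zero']) (fun a ih => ?_) z
  rw [add_succ, add_succ]
  exact succ_le_iff.2 ((le_iff_lt_succ _ _).1 ih)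

theorem exists_add_of_le' {x y : M.Num} (h : x ≤ y) : ∃ z, y = x + z := by
  -- The bound on z keeps the induction formula in Σ₀ᴮ.
  suffices ∃ z ≤ y, y = x + z by
    obtain ⟨z, -, hz⟩ := this
    exact ⟨z, hz⟩
  revert h
  refine induction₂ (P := fun y => x ≤ y → ∃ z ≤ y, y = x + z)
    ((.var 1 ≼ .var 0) ⟹ exLe 3 (.var 0) (.var 0 ≐ .var 1 + .var 3)) x x
    (.or (.neg (.le _ _)) (.exLe (by simp [NumTerm.ContainsNum]) (.numEq _ _)))
    (by rintro ((_ | _) | (_ | _) | _ | _ | _) <;> assumption) (by simp [exLe])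
    (fun h => ⟨0, le_refl' _, ?_⟩) (fun a ih h => ?_) y
  · rw [le_zero_iff.1 h, add_zero']
  · rcases le_succ_iff.1 h with h | rfl
    · obtain ⟨z, hz, e⟩ := ih h
      refine ⟨z + 1, add_le_add' hz _, ?_⟩
      rw [add_succ, ← e]
    · exact ⟨0, zero_le' _, (add_zero' _).symm⟩

instance : CommSemiring M.Num where
  add_assoc := add_assoc'
  zero_add := zero_add'
  add_zero := add_zero'
  add_comm := add_comm'
  left_distrib := mul_add'
  right_distrib x y z := by rw [mul_comm', mul_add', mul_comm' z, mul_comm' z]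
  zero_mul := zero_mul'
  mul_zero := mul_zero'
  mul_assoc := mul_assoc'
  one_mul x := by
    rw [mul_comm']
    have := mul_succ x 0
    rwa [mul_zero', zero_add', zero_add'] at this
  mul_one x := by
    have := mul_succ x 0
    rwa [mul_zero', zero_add', zero_add'] at this
  mul_comm := mul_comm'
  nsmul := nsmulRec

noncomputable instance : LinearOrder M.Num where
  le_refl := le_refl'
  le_trans _ _ _ := le_trans'
  le_antisymm _ _ := le_antisymm'
  le_total := le_total'
  lt_iff_le_not_ge x y := ⟨fun h => ⟨h.1, fun h' => h.2 (le_antisymm' h.1 h')⟩,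
    fun h => ⟨h.1, fun e => h.2 (e ▸ le_refl' _)⟩⟩
  toDecidableLE := Classical.decRel _

instance : IsOrderedCancelAddMonoid M.Num where
  add_le_add_left _ _ h z := add_le_add' h z
  le_of_add_le_add_left x y z h := by
    rcases le_total y z with h' | h'
    · exact h'
    · have := le_antisymm h (by simpa [add_comm] using add_le_add' h' x)
      rw [add_comm x, add_comm x] at this
      exact (add_right_cancel' this).le

instance : ExistsAddOfLE M.Num := ⟨fun h => exists_add_of_le' h⟩

/-- With y = x + (u + 1) and z replaced by z + 1, the two products differ by (u + 1)z + u + 1, a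
successor and hence not zero. -/
theorem mul_lt_mul_of_pos' {x y z : M.Num} (hz : 0 < z) (h : x < y) : x * z < y * z := by
  obtain ⟨u, rfl⟩ := exists_add_of_le h.le
  have hu : u ≠ 0 := fun e => by simp [e] at h
  obtain ⟨u, rfl⟩ := exists_succ hu
  obtain ⟨z, rfl⟩ := exists_succ hz.ne'
  have : x * (z + 1) < x * (z + 1) + ((u + 1) * z + u + 1) :=
    ⟨le_add _ _, fun e => succ_ne_zero ((u + 1) * z + u) (by
      have : x * (z + 1) + 0 = x * (z + 1) + ((u + 1) * z + u + 1) := by rw [add_zero]; exact e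
      exact (add_left_cancel this).symm)⟩
  convert this using 1
  ring

instance : IsStrictOrderedRing M.Num where
  zero_le_one := zero_le' _
  exists_pair_ne := ⟨0 + 1, 0, succ_ne_zero _⟩
  mul_lt_mul_of_pos_left z hz x y h := by
    simpa [mul_comm z] using mul_lt_mul_of_pos' hz h
  mul_lt_mul_of_pos_right z hz x y h := mul_lt_mul_of_pos' hz h

end VZeroModel

end TwoSorted

/-! ### The ring of differences of an ordered semiring -/

section

variable {S : Type*} [CommSemiring S] [LinearOrder S] [IsStrictOrderedRing S]

variable (S) in
/-- Pairs `(a, b)`, representing `a - b`, up to equality of differences. -/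
def differenceSetoid : Setoid (S × S) where
  r p q := p.1 + q.2 = q.1 + p.2
  iseqv :=
    { refl := fun _ => rfl
      symm := fun h => h.symm
      trans := fun {p q r} h h' => by
        refine add_right_cancel (b := q.1 + q.2) ?_
        calc p.1 + r.2 + (q.1 + q.2) = (p.1 + q.2) + (q.1 + r.2) := by ring
          _ = r.1 + p.2 + (q.1 + q.2) := by rw [h, h']; ring }

variable (S) in
/-- The ring of differences of an ordered semiring. -/
def DifferenceRing : Type _ := Quotient (differenceSetoid S)

namespace DifferenceRing

/-- The difference `a - b`. -/
def mk (a b : S) : DifferenceRing S := Quotient.mk (differenceSetoid S) (a, b)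

theorem mk_eq_mk {a b c d : S} : mk a b = mk c d ↔ a + d = c + b :=
  Quotient.eq (r := differenceSetoid S)

theorem exists_mk (x : DifferenceRing S) : ∃ a b, x = mk a b :=
  Quotient.inductionOn x fun p => ⟨p.1, p.2, rfl⟩

instance : Zero (DifferenceRing S) := ⟨mk 0 0⟩
instance : One (DifferenceRing S) := ⟨mk 1 0⟩
instance : Add (DifferenceRing S) :=
  ⟨Quotient.map₂ (fun p q => (p.1 + q.1, p.2 + q.2)) fun p p' h q q' h' => by
    change p.1 + q.1 + (p'.2 + q'.2) = p'.1 + q'.1 + (p.2 + q.2)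
    rw [add_add_add_comm, show p.1 + p'.2 = _ from h, show q.1 + q'.2 = _ from h',
      add_add_add_comm]⟩
instance : Neg (DifferenceRing S) :=
  ⟨Quotient.map (fun p => (p.2, p.1)) fun p p' h => by
    change p.2 + p'.1 = p'.2 + p.1
    rw [add_comm, ← show p.1 + p'.2 = _ from h, add_comm]⟩
instance : Mul (DifferenceRing S) :=
  ⟨Quotient.map₂ (fun p q => (p.1 * q.1 + p.2 * q.2, p.1 * q.2 + p.2 * q.1))
    fun p p' h q q' h' => by
    replace h : p.1 + p'.2 = p'.1 + p.2 := h
    replace h' : q.1 + q'.2 = q'.1 + q.2 := h'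
    change p.1 * q.1 + p.2 * q.2 + (p'.1 * q'.2 + p'.2 * q'.1) =
      p'.1 * q'.1 + p'.2 * q'.2 + (p.1 * q.2 + p.2 * q.1)
    refine add_right_cancel (b := p'.1 * q.2 + p'.2 * q.1 + p'.1 * q.1 + p'.2 * q.2) ?_
    calc _ = (p.1 + p'.2) * q.1 + (p'.1 + p.2) * q.2 + p'.1 * (q.1 + q'.2)
          + p'.2 * (q'.1 + q.2) := by ring
      _ = (p'.1 + p.2) * q.1 + (p.1 + p'.2) * q.2 + p'.1 * (q'.1 + q.2)
          + p'.2 * (q.1 + q'.2) := by rw [h, h']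
      _ = _ := by ring⟩
instance : LE (DifferenceRing S) :=
  ⟨Quotient.lift₂ (fun p q => p.1 + q.2 ≤ q.1 + p.2) fun p q p' q' h h' => by
    replace h : p.1 + p'.2 = p'.1 + p.2 := h
    replace h' : q.1 + q'.2 = q'.1 + q.2 := h'
    refine propext ?_
    rw [← add_le_add_iff_right (p'.2 + q'.2), ← add_le_add_iff_right (a := p.2 + q.2)
      (b := p'.1 + q'.2),
      show p.1 + q.2 + (p'.2 + q'.2) = (p.1 + p'.2) + (q.2 + q'.2) by ring,
      show q.1 + p.2 + (p'.2 + q'.2) = (q.1 + q'.2) + (p.2 + p'.2) by ring, h, h']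
    ring_nf⟩

theorem mk_add (a b c d : S) : mk a b + mk c d = mk (a + c) (b + d) := rfl
theorem mk_mul (a b c d : S) : mk a b * mk c d = mk (a * c + b * d) (a * d + b * c) := rfl
theorem neg_mk (a b : S) : -mk a b = mk b a := rfl
theorem mk_le_mk {a b c d : S} : mk a b ≤ mk c d ↔ a + d ≤ c + b := Iff.rfl
theorem zero_def : (0 : DifferenceRing S) = mk 0 0 := rfl
theorem one_def : (1 : DifferenceRing S) = mk 1 0 := rfl

instance : CommRing (DifferenceRing S) where
  add_assoc x y z := by
    obtain ⟨a, b, rfl⟩ := exists_mk x; obtain ⟨c, d, rfl⟩ := exists_mk y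
    obtain ⟨e, f, rfl⟩ := exists_mk z
    simp only [mk_add, add_assoc]
  zero_add x := by
    obtain ⟨a, b, rfl⟩ := exists_mk x
    simp only [zero_def, mk_add, zero_add]
  add_zero x := by
    obtain ⟨a, b, rfl⟩ := exists_mk x
    simp only [zero_def, mk_add, add_zero]
  add_comm x y := by
    obtain ⟨a, b, rfl⟩ := exists_mk x; obtain ⟨c, d, rfl⟩ := exists_mk y
    simp only [mk_add, add_comm]
  left_distrib x y z := by
    obtain ⟨a, b, rfl⟩ := exists_mk x; obtain ⟨c, d, rfl⟩ := exists_mk y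
    obtain ⟨e, f, rfl⟩ := exists_mk z
    simp only [mk_add, mk_mul, mk_eq_mk]
    ring
  right_distrib x y z := by
    obtain ⟨a, b, rfl⟩ := exists_mk x; obtain ⟨c, d, rfl⟩ := exists_mk y
    obtain ⟨e, f, rfl⟩ := exists_mk z
    simp only [mk_add, mk_mul, mk_eq_mk]
    ring
  zero_mul x := by
    obtain ⟨a, b, rfl⟩ := exists_mk x
    simp [zero_def, mk_mul]
  mul_zero x := by
    obtain ⟨a, b, rfl⟩ := exists_mk x
    simp [zero_def, mk_mul]
  mul_assoc x y z := by
    obtain ⟨a, b, rfl⟩ := exists_mk x; obtain ⟨c, d, rfl⟩ := exists_mk y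
    obtain ⟨e, f, rfl⟩ := exists_mk z
    simp only [mk_mul, mk_eq_mk]
    ring
  one_mul x := by
    obtain ⟨a, b, rfl⟩ := exists_mk x
    simp [one_def, mk_mul]
  mul_one x := by
    obtain ⟨a, b, rfl⟩ := exists_mk x
    simp [one_def, mk_mul]
  mul_comm x y := by
    obtain ⟨a, b, rfl⟩ := exists_mk x; obtain ⟨c, d, rfl⟩ := exists_mk y
    simp only [mk_mul, mk_eq_mk]
    ring
  neg_add_cancel x := by
    obtain ⟨a, b, rfl⟩ := exists_mk x
    simp only [neg_mk, mk_add, zero_def, mk_eq_mk]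
    ring
  nsmul := nsmulRec
  zsmul := zsmulRec

noncomputable instance : LinearOrder (DifferenceRing S) where
  le_refl x := by
    obtain ⟨a, b, rfl⟩ := exists_mk x
    exact mk_le_mk.2 le_rfl
  le_trans x y z h h' := by
    obtain ⟨a, b, rfl⟩ := exists_mk x; obtain ⟨c, d, rfl⟩ := exists_mk y
    obtain ⟨e, f, rfl⟩ := exists_mk z
    rw [mk_le_mk] at *
    rw [← add_le_add_iff_right (c + d)]
    calc a + f + (c + d) = (a + d) + (c + f) := by ring
      _ ≤ (c + b) + (e + d) := add_le_add h h'
      _ = _ := by ring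
  le_antisymm x y h h' := by
    obtain ⟨a, b, rfl⟩ := exists_mk x; obtain ⟨c, d, rfl⟩ := exists_mk y
    exact mk_eq_mk.2 (le_antisymm h h')
  le_total x y := by
    obtain ⟨a, b, rfl⟩ := exists_mk x; obtain ⟨c, d, rfl⟩ := exists_mk y
    exact le_total (a + d) (c + b)
  toDecidableLE := Classical.decRel _

theorem mk_lt_mk {a b c d : S} : mk a b < mk c d ↔ a + d < c + b := by
  rw [← not_le, mk_le_mk, not_le]

instance : IsOrderedAddMonoid (DifferenceRing S) where
  add_le_add_left x y h z := by
    obtain ⟨a, b, rfl⟩ := exists_mk x; obtain ⟨c, d, rfl⟩ := exists_mk y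
    obtain ⟨e, f, rfl⟩ := exists_mk z
    simp only [mk_add, mk_le_mk] at *
    calc a + e + (d + f) = a + d + (e + f) := by ring
      _ ≤ c + b + (e + f) := by gcongr
      _ = _ := by ring

instance : Nontrivial (DifferenceRing S) :=
  ⟨1, 0, fun h => one_ne_zero (α := S) (by simp [one_def, zero_def, mk_eq_mk] at h)⟩

instance : ZeroLEOneClass (DifferenceRing S) := ⟨by simp [one_def, zero_def, mk_le_mk]⟩

/-- Positive differences have the form (b + u) - b and (d + v) - d with u, v positive, and their
product is u v. -/
instance [ExistsAddOfLE S] : IsStrictOrderedRing (DifferenceRing S) := .of_mul_pos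
    fun x y hx hy => by
  obtain ⟨a, b, rfl⟩ := exists_mk x; obtain ⟨c, d, rfl⟩ := exists_mk y
  rw [zero_def, mk_lt_mk, zero_add, add_zero] at hx hy
  obtain ⟨u, hu, rfl⟩ := exists_pos_add_of_lt' hx
  obtain ⟨v, hv, rfl⟩ := exists_pos_add_of_lt' hy
  rw [zero_def, mk_mul, mk_lt_mk, zero_add, add_zero]
  have : b * (d + v) + u * d + b * d + u * v > b * (d + v) + u * d + b * d :=
    lt_add_of_pos_right _ (mul_pos hu hv)
  calc _ = b * (d + v) + u * d + b * d := by ring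
    _ < _ := this
    _ = _ := by ring

variable (S) in
/-- The embedding of an ordered semiring into its ring of differences. -/
def of : S →+* DifferenceRing S where
  toFun a := mk a 0
  map_zero' := rfl
  map_one' := rfl
  map_add' a b := by simp [mk_add]
  map_mul' a b := by simp [mk_mul]

theorem of_def (a : S) : of S a = mk a 0 := rfl

@[simp] theorem of_le_of {a b : S} : of S a ≤ of S b ↔ a ≤ b := by
  simp [of_def, mk_le_mk]

@[simp] theorem of_inj {a b : S} : of S a = of S b ↔ a = b := by
  simp [of_def, mk_eq_mk]

@[simp] theorem of_lt_of {a b : S} : of S a < of S b ↔ a < b := by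
  simp [of_def, mk_lt_mk]

/-- The way back from geometry in the ring to strings: points with nonnegative coordinates come from
numbers of the semiring. -/
theorem exists_of_nonneg [ExistsAddOfLE S] {x : DifferenceRing S} (h : 0 ≤ x) :
    ∃ a, of S a = x := by
  obtain ⟨a, b, rfl⟩ := exists_mk x
  rw [zero_def, mk_le_mk, zero_add, add_zero] at h
  obtain ⟨c, rfl⟩ := exists_add_of_le h
  exact ⟨c, by simp [of_def, mk_eq_mk, add_comm]⟩

end DifferenceRing

end

/-- An ordered ring is discrete if there is nothing strictly between `0` and `1`. -/
class DiscreteRing (Z : Type*) [CommRing Z] [LinearOrder Z] : Prop where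
  one_le_of_pos : ∀ x : Z, 0 < x → 1 ≤ x

theorem DiscreteRing.add_one_le {Z : Type*} [CommRing Z] [LinearOrder Z] [IsStrictOrderedRing Z]
    [DiscreteRing Z] {x y : Z} (h : x < y) : x + 1 ≤ y := by
  have := DiscreteRing.one_le_of_pos (y - x) (by linarith)
  linarith

namespace TwoSorted

variable (M : Structure) [VZeroModel M]

/-- The ring of integers of a model of `V⁰`. -/
abbrev Structure.IntRing : Type := DifferenceRing M.Num

instance : DiscreteRing M.IntRing where
  one_le_of_pos x hx := by
    obtain ⟨a, rfl⟩ := DifferenceRing.exists_of_nonneg hx.le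
    rw [← map_zero (DifferenceRing.of M.Num), DifferenceRing.of_lt_of] at hx
    rw [← map_one (DifferenceRing.of M.Num), DifferenceRing.of_le_of, ← zero_add (1 : M.Num)]
    exact VZeroModel.succ_le_iff.2 hx

end TwoSorted

/-! ### Edge relations of graphs whose degrees are `0`, `1` or `2` -/

namespace EdgeRel

variable {P P' : Type*}

/-- The point `p` lies on an edge of `G`. -/
def Supp (G : P → P → Prop) (p : P) : Prop := ∃ q, G p q

/-- The point `p` has degree `1`. -/
def DegOne (G : P → P → Prop) (p : P) : Prop := ∃ q, G p q ∧ ∀ r, G p r → r = q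

/-- The point `p` has degree `2`. -/
def DegTwo (G : P → P → Prop) (p : P) : Prop :=
  ∃ q q', q ≠ q' ∧ G p q ∧ G p q' ∧ ∀ r, G p r → r = q ∨ r = q'

/-- The points `p` and `q` have degree `1`, and all other points have degree `0` or `2`. -/
structure IsPath (G : P → P → Prop) (p q : P) : Prop where
  symm : ∀ x y, G x y → G y x
  irrefl : ∀ x, ¬ G x x
  ne : p ≠ q
  left : DegOne G p
  right : DegOne G q
  inner : ∀ r, r ≠ p → r ≠ q → ¬ Supp G r ∨ DegTwo G r

/-- There is an edge, and all points have degree `0` or `2`. -/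
structure IsCycle (G : P → P → Prop) : Prop where
  symm : ∀ x y, G x y → G y x
  irrefl : ∀ x, ¬ G x x
  nonempty : ∃ p, Supp G p
  deg : ∀ r, ¬ Supp G r ∨ DegTwo G r

/-- The union of two sets of edges. -/
def union (G H : P → P → Prop) (x y : P) : Prop := G x y ∨ H x y

/-- Removal of the edge between `p` and `q`. -/
def erase (G : P → P → Prop) (p q : P) (x y : P) : Prop :=
  G x y ∧ ¬ (x = p ∧ y = q) ∧ ¬ (x = q ∧ y = p)

variable {G H : P → P → Prop} {p q r : P}

theorem DegOne.supp (h : DegOne G p) : Supp G p := h.imp fun _ h => h.1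
theorem DegTwo.supp (h : DegTwo G p) : Supp G p := let ⟨q, _, _, h, _⟩ := h; ⟨q, h⟩

theorem supp_congr (h : ∀ q, G p q ↔ H p q) : Supp G p ↔ Supp H p := by simp only [Supp, h]
theorem degOne_congr (h : ∀ q, G p q ↔ H p q) : DegOne G p ↔ DegOne H p := by
  simp only [DegOne, h]
theorem degTwo_congr (h : ∀ q, G p q ↔ H p q) : DegTwo G p ↔ DegTwo H p := by
  simp only [DegTwo, h]

theorem supp_union : Supp (union G H) p ↔ Supp G p ∨ Supp H p := exists_or

theorem union_iff_left (h : ¬ Supp H p) (q : P) : union G H p q ↔ G p q :=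
  or_iff_left fun h' => h ⟨q, h'⟩

theorem union_iff_right (h : ¬ Supp G p) (q : P) : union G H p q ↔ H p q :=
  or_iff_right fun h' => h ⟨q, h'⟩

theorem IsPath.reverse (h : IsPath G p q) : IsPath G q p :=
  ⟨h.symm, h.irrefl, h.ne.symm, h.right, h.left, fun r h1 h2 => h.inner r h2 h1⟩

theorem IsPath.degTwo (h : IsPath G p q) (hr : Supp G r) (h1 : r ≠ p) (h2 : r ≠ q) :
    DegTwo G r := (h.inner r h1 h2).resolve_left (not_not_intro hr)

theorem IsCycle.degTwo (h : IsCycle G) (hr : Supp G r) : DegTwo G r :=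
  (h.deg r).resolve_left (not_not_intro hr)

theorem DegOne.union_degTwo (h : DegOne G p) (h' : DegOne H p) (hd : ∀ q, G p q → ¬ H p q) :
    DegTwo (union G H) p := by
  obtain ⟨q, hq, hq'⟩ := h
  obtain ⟨r, hr, hr'⟩ := h'
  refine ⟨q, r, ?_, .inl hq, .inr hr, fun s hs => hs.imp (hq' s) (hr' s)⟩
  rintro rfl
  exact hd q hq hr

/-- Away from q each point has the degree given by one of the two sets. At q the degrees add to 2,
because an edge common to both sets would have a second common point as its other end. -/
theorem IsPath.trans (hG : IsPath G p q) (hH : IsPath H q r) (hpr : p ≠ r)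
    (hd : ∀ x, Supp G x → Supp H x → x = q) : IsPath (union G H) p r where
  symm x y h := h.imp (hG.symm x y) (hH.symm x y)
  irrefl x h := h.elim (hG.irrefl x) (hH.irrefl x)
  ne := hpr
  left := (degOne_congr (union_iff_left fun h => hG.ne (hd p hG.left.supp h))).2 hG.left
  right := (degOne_congr (union_iff_right fun h => hH.ne (hd r h hH.right.supp).symm)).2 hH.right
  inner x hp hr := by
    by_cases hxq : x = q
    · subst hxq
      refine .inr (hG.right.union_degTwo hH.left fun y hy hy' => ?_)
      have := hd y ⟨_, hG.symm _ _ hy⟩ ⟨_, hH.symm _ _ hy'⟩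
      exact hG.irrefl y (by rwa [← this] at hy)
    by_cases hx : Supp G x
    · exact .inr ((degTwo_congr (union_iff_left fun h => hxq (hd x hx h))).2 (hG.degTwo hx hp hxq))
    · rw [supp_congr (union_iff_right hx), degTwo_congr (union_iff_right hx)]
      exact hH.inner x hxq hr

/-- As in `IsPath.trans`, now at both ends. An edge in both sets would have to join p and q, which
`hpq` forbids; without it both sets could be that single edge. -/
theorem IsPath.isCycle_union (hG : IsPath G p q) (hH : IsPath H p q) (hpq : ¬ H p q)
    (hd : ∀ x, Supp G x → Supp H x → x = p ∨ x = q) : IsCycle (union G H) where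
  symm x y h := h.imp (hG.symm x y) (hH.symm x y)
  irrefl x h := h.elim (hG.irrefl x) (hH.irrefl x)
  nonempty := ⟨p, supp_union.2 (.inl hG.left.supp)⟩
  deg x := by
    by_cases hxp : x = p
    · subst hxp
      refine .inr (hG.left.union_degTwo hH.left fun y hy hy' => ?_)
      rcases hd y ⟨_, hG.symm _ _ hy⟩ ⟨_, hH.symm _ _ hy'⟩ with rfl | rfl
      · exact hG.irrefl _ hy
      · exact hpq hy'
    by_cases hxq : x = q
    · subst hxq
      refine .inr (hG.right.union_degTwo hH.right fun y hy hy' => ?_)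
      rcases hd y ⟨_, hG.symm _ _ hy⟩ ⟨_, hH.symm _ _ hy'⟩ with rfl | rfl
      · exact hpq (hH.symm _ _ hy')
      · exact hG.irrefl _ hy
    by_cases hx : Supp G x
    · exact .inr ((degTwo_congr (union_iff_left fun h => (hd x hx h).elim hxp hxq)).2
        (hG.degTwo hx hxp hxq))
    · rw [supp_congr (union_iff_right hx), degTwo_congr (union_iff_right hx)]
      exact hH.inner x hxp hxq

theorem erase_comm (G : P → P → Prop) (p q x y : P) : erase G p q x y ↔ erase G q p x y := by
  unfold erase; tauto

theorem erase_iff (h : r ≠ p) (h' : r ≠ q) (x : P) : erase G p q r x ↔ G r x := by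
  simp [erase, h, h']

theorem erase_symm (h : ∀ x y, G x y → G y x) (x y : P) (hxy : erase G p q x y) :
    erase G p q y x :=
  ⟨h _ _ hxy.1, fun h => hxy.2.2 h.symm, fun h => hxy.2.1 h.symm⟩

theorem not_supp_erase (h : DegOne G p) (hpq : G p q) : ¬ Supp (erase G p q) p := by
  rintro ⟨x, hx, hx1, -⟩
  obtain ⟨y, -, hy⟩ := h
  exact hx1 ⟨rfl, (hy x hx).trans (hy q hpq).symm⟩

theorem DegTwo.degOne_erase (hne : p ≠ q) (h : DegTwo G p) (hpq : G p q) :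
    DegOne (erase G p q) p := by
  obtain ⟨x, y, hxy, hx, hy, hall⟩ := h
  have key : ∀ z, erase G p q p z ↔ G p z ∧ z ≠ q := by
    intro z; simp [erase, hne]
  simp only [DegOne, key]
  rcases hall q hpq with rfl | rfl
  · exact ⟨y, ⟨hy, hxy.symm⟩, fun r hr => (hall r hr.1).resolve_left hr.2⟩
  · exact ⟨x, ⟨hx, hxy⟩, fun r hr => (hall r hr.1).resolve_right hr.2⟩

theorem IsCycle.isPath_erase (h : IsCycle G) (hpq : G p q) : IsPath (erase G p q) p q where
  symm := erase_symm h.symm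
  irrefl x hx := h.irrefl x hx.1
  ne := by rintro rfl; exact h.irrefl _ hpq
  left := (h.degTwo ⟨q, hpq⟩).degOne_erase (by rintro rfl; exact h.irrefl _ hpq) hpq
  right := by
    rw [degOne_congr (erase_comm G p q q)]
    exact (h.degTwo ⟨p, h.symm _ _ hpq⟩).degOne_erase (by rintro rfl; exact h.irrefl _ hpq)
      (h.symm _ _ hpq)
  inner x hp hq := by
    rw [supp_congr (erase_iff hp hq), degTwo_congr (erase_iff hp hq)]
    exact h.deg x

/-- The degree of p drops from 1 to 0 and that of q from 2 to 1. -/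
theorem IsPath.isPath_erase (h : IsPath G p r) (hpq : G p q) (hqr : q ≠ r) :
    IsPath (erase G p q) q r where
  symm := erase_symm h.symm
  irrefl x hx := h.irrefl x hx.1
  ne := hqr
  left := by
    have hne : q ≠ p := by rintro rfl; exact h.irrefl _ hpq
    rw [degOne_congr (erase_comm G p q q)]
    exact (h.degTwo ⟨p, h.symm _ _ hpq⟩ hne hqr).degOne_erase hne (h.symm _ _ hpq)
  right := by
    rw [degOne_congr (erase_iff h.ne.symm hqr.symm)]
    exact h.right
  inner x hq hr := by
    by_cases hp : x = p
    · subst hp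
      exact .inl (not_supp_erase h.left hpq)
    · rw [supp_congr (erase_iff hp hq), degTwo_congr (erase_iff hp hq)]
      exact h.inner x hp hr

theorem Supp.of_erase (h : Supp (erase G p q) r) : Supp G r := h.imp fun _ h => h.1

theorem supp_comap (e : P ≃ P') {G : P' → P' → Prop} :
    Supp (fun x y => G (e x) (e y)) p ↔ Supp G (e p) :=
  ⟨fun ⟨y, h⟩ => ⟨e y, h⟩, fun ⟨y, h⟩ => ⟨e.symm y, by simpa using h⟩⟩

theorem degTwo_comap (e : P ≃ P') {G : P' → P' → Prop} :
    DegTwo (fun x y => G (e x) (e y)) p ↔ DegTwo G (e p) := by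
  simp only [DegTwo, e.surjective.exists, e.surjective.forall, ne_eq, e.injective.eq_iff]

theorem IsPath.comap (e : P ≃ P') {G : P' → P' → Prop} {p q : P} (h : IsPath G (e p) (e q)) :
    IsPath (fun x y => G (e x) (e y)) p q where
  symm _ _ := h.symm _ _
  irrefl _ := h.irrefl _
  ne hn := h.ne (congrArg e hn)
  left := by
    obtain ⟨r, h1, h2⟩ := h.left
    exact ⟨e.symm r, by simpa using h1, fun s hs => by simp [← h2 _ hs]⟩
  right := by
    obtain ⟨r, h1, h2⟩ := h.right
    exact ⟨e.symm r, by simpa using h1, fun s hs => by simp [← h2 _ hs]⟩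
  inner x hp hq := by
    rw [supp_comap, degTwo_comap]
    exact h.inner (e x) (by simpa using hp) (by simpa using hq)

theorem IsCycle.comap (e : P ≃ P') {G : P' → P' → Prop} (h : IsCycle G) :
    IsCycle (fun x y => G (e x) (e y)) where
  symm _ _ := h.symm _ _
  irrefl _ := h.irrefl _
  nonempty := by
    obtain ⟨p, q, h⟩ := h.nonempty
    exact ⟨e.symm p, e.symm q, by simpa using h⟩
  deg x := by
    rw [supp_comap, degTwo_comap]
    exact h.deg (e x)

/-! ### Replacing edges by paths -/

/-- A drawing of the graph `T`: the vertex `p` is drawn as the point `φ p`, and the edge between `p`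
and `q` as the path `W p q`; the paths of different edges may share only common ends. -/
structure IsDrawing (T : P → P → Prop) (φ : P → P') (W : P → P → P' → P' → Prop) : Prop where
  path : ∀ {p q}, T p q → IsPath (W p q) (φ p) (φ q)
  symm : ∀ {p q x y}, T p q → W p q x y → W q p x y
  vertex : ∀ {p q r}, Supp T r → T p q → Supp (W p q) (φ r) → r = p ∨ r = q
  inner : ∀ {p q p' q' x}, T p q → T p' q' → Supp (W p q) x → Supp (W p' q') x →
    (∀ r, Supp T r → x ≠ φ r) → p = p' ∧ q = q' ∨ p = q' ∧ q = p'

/-- The image of a set of edges under a drawing. -/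
def image (W : P → P → P' → P' → Prop) (G : P → P → Prop) (x y : P') : Prop :=
  ∃ p q, G p q ∧ W p q x y

namespace IsDrawing

variable {T : P → P → Prop} {φ : P → P'} {W : P → P → P' → P' → Prop}

theorem inj (h : IsDrawing T φ W) (hp : Supp T p) (hq : Supp T q) (e : φ p = φ q) : p = q := by
  obtain ⟨r, hr⟩ := hq
  rcases h.vertex hp hr (e ▸ (h.path hr).left.supp) with rfl | rfl
  · rfl
  · exact absurd e.symm (h.path hr).ne

/-- Paths of edges not incident with r avoid the point φ r. Together with `neighbor_inj` this
transfers degrees from r to φ r. -/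
theorem image_vertex (h : IsDrawing T φ W) (hGT : ∀ x y, G x y → T x y)
    (hG : ∀ x y, G x y → G y x) (hr : Supp T r) (y : P') :
    image W G (φ r) y ↔ ∃ q, G r q ∧ W r q (φ r) y := by
  constructor
  · rintro ⟨p, q, hpq, hw⟩
    rcases h.vertex hr (hGT _ _ hpq) ⟨y, hw⟩ with rfl | rfl
    · exact ⟨q, hpq, hw⟩
    · exact ⟨p, hG _ _ hpq, h.symm (hGT _ _ hpq) hw⟩
  · rintro ⟨q, hq, hw⟩
    exact ⟨r, q, hq, hw⟩

/-- If the common neighbour y is a drawn vertex, it can only be the far end of each of the two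
edges; if not, it is an inner point of both paths, and these belong to one edge. -/
theorem neighbor_inj (h : IsDrawing T φ W) {y : P'} (hp : T r p) (hq : T r q)
    (hp' : W r p (φ r) y) (hq' : W r q (φ r) y) : p = q := by
  have hy : y ≠ φ r := by
    rintro rfl; exact (h.path hp).irrefl _ hp'
  have h1 : Supp (W r p) y := ⟨_, (h.path hp).symm _ _ hp'⟩
  have h2 : Supp (W r q) y := ⟨_, (h.path hq).symm _ _ hq'⟩
  by_cases hv : ∃ s, Supp T s ∧ y = φ s
  · obtain ⟨s, hs, rfl⟩ := hv
    have h3 := (h.vertex hs hp h1).resolve_left (fun e => hy (e ▸ rfl))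
    have h4 := (h.vertex hs hq h2).resolve_left (fun e => hy (e ▸ rfl))
    exact h3.symm.trans h4
  · push Not at hv
    rcases h.inner hp hq h1 h2 hv with h | ⟨rfl, rfl⟩
    · exact h.2
    · rfl

theorem image_degOne (h : IsDrawing T φ W) (hGT : ∀ x y, G x y → T x y)
    (hG : ∀ x y, G x y → G y x) (hr : DegOne G r) : DegOne (image W G) (φ r) := by
  obtain ⟨q, hq, hall⟩ := hr
  obtain ⟨y, hy, hy'⟩ := (h.path (hGT _ _ hq)).left
  refine ⟨y, ⟨r, q, hq, hy⟩, fun z hz => ?_⟩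
  obtain ⟨q', hq', hz⟩ := (h.image_vertex hGT hG ⟨q, hGT _ _ hq⟩ z).1 hz
  obtain rfl := hall q' hq'
  exact hy' z hz

theorem image_degTwo (h : IsDrawing T φ W)
    (hGT : ∀ x y, G x y → T x y) (hG : ∀ x y, G x y → G y x) (hr : DegTwo G r) :
    DegTwo (image W G) (φ r) := by
  obtain ⟨q, q', hne, hq, hq', hall⟩ := hr
  obtain ⟨y, hy, hyall⟩ := (h.path (hGT _ _ hq)).left
  obtain ⟨y', hy', hyall'⟩ := (h.path (hGT _ _ hq')).left
  refine ⟨y, y', ?_, ⟨r, q, hq, hy⟩, ⟨r, q', hq', hy'⟩, fun z hz => ?_⟩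
  · rintro rfl
    exact hne (h.neighbor_inj (hGT _ _ hq) (hGT _ _ hq') hy hy')
  · obtain ⟨s, hs, hz⟩ := (h.image_vertex hGT hG ⟨q, hGT _ _ hq⟩ z).1 hz
    rcases hall s hs with rfl | rfl
    · exact .inl (hyall z hz)
    · exact .inr (hyall' z hz)

theorem isPath_image (h : IsDrawing T φ W) (hT : ∀ x y, T x y → T y x)
    (hGT : ∀ x y, G x y → T x y) (hG : IsPath G p q) : IsPath (image W G) (φ p) (φ q) where
  symm x y := by
    rintro ⟨p, q, hpq, hw⟩
    exact ⟨p, q, hpq, (h.path (hGT _ _ hpq)).symm _ _ hw⟩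
  irrefl x := by
    rintro ⟨p, q, hpq, hw⟩
    exact (h.path (hGT _ _ hpq)).irrefl _ hw
  ne e := hG.ne (h.inj (hG.left.supp.imp (hGT _)) (hG.right.supp.imp (hGT _)) e)
  left := h.image_degOne hGT hG.symm hG.left
  right := h.image_degOne hGT hG.symm hG.right
  inner x hxp hxq := by
    by_cases hv : ∃ s, Supp T s ∧ x = φ s
    · obtain ⟨s, hs, rfl⟩ := hv
      refine (hG.inner s (fun e => hxp (e ▸ rfl)) (fun e => hxq (e ▸ rfl))).imp ?_
        (h.image_degTwo hGT hG.symm)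
      rintro hn ⟨y, hy⟩
      obtain ⟨t, ht, -⟩ := (h.image_vertex hGT hG.symm hs y).1 hy
      exact hn ⟨t, ht⟩
    · push Not at hv
      rw [or_iff_not_imp_left, not_not]
      rintro ⟨y, r, s, hrs, hw⟩
      -- A point that is no drawn vertex lies on the path of one edge only, so its degree is its
      -- degree on that path.
      have key : ∀ z, image W G x z ↔ W r s x z := by
        refine fun z => ⟨?_, fun hz => ⟨r, s, hrs, hz⟩⟩
        rintro ⟨r', s', hrs', hz⟩
        rcases h.inner (hGT _ _ hrs) (hGT _ _ hrs') ⟨y, hw⟩ ⟨z, hz⟩ hv with ⟨rfl, rfl⟩ | ⟨rfl, rfl⟩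
        · exact hz
        · exact h.symm (hGT _ _ hrs') hz
      rw [degTwo_congr key]
      exact (h.path (hGT _ _ hrs)).degTwo ⟨y, hw⟩ (hv r ⟨s, hGT _ _ hrs⟩)
        (hv s ⟨r, hT _ _ (hGT _ _ hrs)⟩)

theorem disjoint_image (h : IsDrawing T φ W) (hGT : ∀ x y, G x y → T x y)
    (hHT : ∀ x y, H x y → T x y) (hG : ∀ x y, G x y → G y x) (hH : ∀ x y, H x y → H y x)
    (hd : ∀ p, Supp G p → ¬ Supp H p) (x : P') (h1 : Supp (image W G) x) :
    ¬ Supp (image W H) x := by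
  rintro ⟨z, hz⟩
  obtain ⟨y, hy⟩ := h1
  by_cases hv : ∃ s, Supp T s ∧ x = φ s
  · obtain ⟨s, hs, rfl⟩ := hv
    obtain ⟨q, hq, -⟩ := (h.image_vertex hGT hG hs y).1 hy
    obtain ⟨q', hq', -⟩ := (h.image_vertex hHT hH hs z).1 hz
    exact hd s ⟨q, hq⟩ ⟨q', hq'⟩
  · push Not at hv
    obtain ⟨p, q, hpq, hy⟩ := hy
    obtain ⟨p', q', hpq', hz⟩ := hz
    rcases h.inner (hGT _ _ hpq) (hHT _ _ hpq') ⟨y, hy⟩ ⟨z, hz⟩ hv with ⟨rfl, rfl⟩ | ⟨rfl, rfl⟩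
    · exact hd p ⟨q, hpq⟩ ⟨q, hpq'⟩
    · exact hd p ⟨q, hpq⟩ ⟨q, hH _ _ hpq'⟩

end IsDrawing

/-! ### Straight segments in the grid -/

variable {Z : Type*} [CommRing Z]

/-- The points `p` and `q` are at distance `1` and agree in one coordinate. -/
def Adj (p q : Z × Z) : Prop :=
  (p.1 + 1 = q.1 ∨ q.1 + 1 = p.1) ∧ p.2 = q.2 ∨ p.1 = q.1 ∧ (p.2 + 1 = q.2 ∨ q.2 + 1 = p.2)

theorem Adj.symm {p q : Z × Z} (h : Adj p q) : Adj q p := by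
  rcases h with ⟨h, h'⟩ | ⟨h, h'⟩
  · exact .inl ⟨h.symm, h'.symm⟩
  · exact .inr ⟨h.symm, h'.symm⟩

variable [LinearOrder Z]

/-- The edges of the horizontal segment from `(a, c)` to `(b, c)`. -/
def hSeg (a b c : Z) (p q : Z × Z) : Prop :=
  (p.1 + 1 = q.1 ∨ q.1 + 1 = p.1) ∧ p.2 = c ∧ q.2 = c ∧
    a ≤ p.1 ∧ p.1 ≤ b ∧ a ≤ q.1 ∧ q.1 ≤ b

/-- The edges of the vertical segment from `(c, a)` to `(c, b)`. -/
def vSeg (a b c : Z) (p q : Z × Z) : Prop :=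
  (p.2 + 1 = q.2 ∨ q.2 + 1 = p.2) ∧ p.1 = c ∧ q.1 = c ∧
    a ≤ p.2 ∧ p.2 ≤ b ∧ a ≤ q.2 ∧ q.2 ≤ b

theorem hSeg_adj {a b c : Z} {p q : Z × Z} (h : hSeg a b c p q) : Adj p q :=
  .inl ⟨h.1, h.2.1.trans h.2.2.1.symm⟩

theorem vSeg_adj {a b c : Z} {p q : Z × Z} (h : vSeg a b c p q) : Adj p q :=
  .inr ⟨h.2.1.trans h.2.2.1.symm, h.1⟩

theorem supp_hSeg {a b c : Z} {p : Z × Z} (h : Supp (hSeg a b c) p) :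
    p.2 = c ∧ a ≤ p.1 ∧ p.1 ≤ b := by
  obtain ⟨q, -, h1, -, h2, h3, -⟩ := h
  exact ⟨h1, h2, h3⟩

theorem supp_vSeg {a b c : Z} {p : Z × Z} (h : Supp (vSeg a b c) p) :
    p.1 = c ∧ a ≤ p.2 ∧ p.2 ≤ b := by
  obtain ⟨q, -, h1, -, h2, h3, -⟩ := h
  exact ⟨h1, h2, h3⟩

variable [IsStrictOrderedRing Z]

theorem Adj.ne {p q : Z × Z} (h : Adj p q) : p ≠ q := by
  rintro rfl
  rcases h with ⟨h | h, -⟩ | ⟨-, h | h⟩ <;> linarith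

variable [DiscreteRing Z]

/-- Since a path is given by degrees, no induction along the segment is needed: discreteness turns a
< x < b into a ≤ x - 1 and x + 1 ≤ b, which are the two neighbours. -/
theorem isPath_hSeg {a b : Z} (hab : a < b) (c : Z) : IsPath (hSeg a b c) (a, c) (b, c) where
  symm p q h := ⟨h.1.symm, h.2.2.1, h.2.1, h.2.2.2.2.2.1, h.2.2.2.2.2.2, h.2.2.2.1, h.2.2.2.2.1⟩
  irrefl p h := (hSeg_adj h).ne rfl
  ne h := hab.ne (congrArg Prod.fst h)
  left := by
    have := DiscreteRing.add_one_le hab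
    refine ⟨(a + 1, c), ⟨.inl rfl, rfl, rfl, le_rfl, hab.le, by simp, this⟩, ?_⟩
    rintro ⟨x, y⟩ ⟨h | h, -, h2, -, -, h3, -⟩
    · exact Prod.ext h.symm h2
    · dsimp at *; linarith
  right := by
    have := DiscreteRing.add_one_le hab
    refine ⟨(b - 1, c), ⟨.inr (by simp), rfl, rfl, hab.le, le_rfl, by dsimp; linarith, by simp⟩, ?_⟩
    rintro ⟨x, y⟩ ⟨h | h, -, h2, -, -, -, h3⟩
    · dsimp at *; linarith
    · exact Prod.ext (by dsimp at *; linarith) h2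
  inner := by
    rintro ⟨x, y⟩ h1 h2
    rw [or_iff_not_imp_left, not_not]
    intro h
    obtain ⟨rfl, h3, h4⟩ := supp_hSeg h
    have h5 := DiscreteRing.add_one_le (lt_of_le_of_ne h3 fun e => h1 (by rw [e]))
    have h6 := DiscreteRing.add_one_le (lt_of_le_of_ne h4 fun e => h2 (by rw [← e]))
    dsimp at *
    refine ⟨(x - 1, y), (x + 1, y), fun e => ?_, ?_, ?_, ?_⟩
    · have := congrArg Prod.fst e
      dsimp at this; linarith
    · exact ⟨.inr (by simp), rfl, rfl, h3, h4, by dsimp; linarith, by dsimp; linarith⟩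
    · exact ⟨.inl (by simp), rfl, rfl, h3, h4, by dsimp; linarith, by dsimp; linarith⟩
    · rintro ⟨x', y'⟩ ⟨h | h, -, h7, -⟩
      · exact .inr (Prod.ext h.symm h7)
      · exact .inl (Prod.ext (by dsimp at *; linarith) h7)

theorem isPath_vSeg {a b : Z} (hab : a < b) (c : Z) : IsPath (vSeg a b c) (c, a) (c, b) :=
  IsPath.comap (Equiv.prodComm Z Z) (p := (c, a)) (q := (c, b)) (isPath_hSeg hab c)

end EdgeRel

namespace TwoSorted

open EdgeRel DifferenceRing

variable {M : Structure}

theorem NumTerm.val_update {t : NumTerm} {x : ℕ} (h : ¬ t.ContainsNum x) (v : ℕ → M.Num)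
    (V : ℕ → M.Str) (a : M.Num) : t.val M (Function.update v x a) V = t.val M v V := by
  induction t with
  | var y => exact Function.update_of_ne (fun e => h e.symm) _ _
  | zero => rfl
  | one => rfl
  | len X => rfl
  | add t u iht ihu =>
    simp only [NumTerm.val, iht fun h' => h (.inl h'), ihu fun h' => h (.inr h')]
  | mul t u iht ihu =>
    simp only [NumTerm.val, iht fun h' => h (.inl h'), ihu fun h' => h (.inr h')]

/-! ### Codes of edges -/

/-- The value of the pairing function. -/
def pairNum (a b : M.Num) : M.Num := (a + b) * (a + b + 1) + (1 + 1) * b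

/-- The code of the edge from `(a, b)` to `(c, d)`. -/
def codeNum (a b c d : M.Num) : M.Num := pairNum (pairNum a b) (pairNum c d)

/-- The points `(a, b)` and `(c, d)` are adjacent. -/
def AdjNum (a b c d : M.Num) : Prop :=
  ((a + 1 = c ∨ c + 1 = a) ∧ b = d) ∨ (a = c ∧ (b + 1 = d ∨ d + 1 = b))

theorem AdjNum.symm {a b c d : M.Num} (h : AdjNum a b c d) : AdjNum c d a b := by
  rcases h with ⟨h, h'⟩ | ⟨h, h'⟩
  · exact .inl ⟨h.symm, h'.symm⟩
  · exact .inr ⟨h.symm, h'.symm⟩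

/-- One of the codes of the edge between `(a, b)` and `(c, d)` is in `E`. -/
def HasEdge (E : M.Str) (a b c d : M.Num) : Prop :=
  M.mem (codeNum a b c d) E ∨ M.mem (codeNum c d a b) E

/-- All elements of `E` represent edges of the grid. -/
def IsEdgeSet (n : M.Num) (E : M.Str) : Prop :=
  ∀ e < M.len E, M.mem e E → ∃ a ≤ n, ∃ b ≤ n, ∃ c ≤ n, ∃ d ≤ n, AdjNum a b c d ∧
    e = codeNum a b c d

/-- The term contains no number variable that the formulas about degrees and edges bind. -/
def NumTerm.IsFresh (t : NumTerm) : Prop := ∀ x, 10 ≤ x → x ≤ 35 → ¬ t.ContainsNum x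

section

variable {v : ℕ → M.Num} {V : ℕ → M.Str} {N a b c d : NumTerm} {E : ℕ}

theorem holds_hasEdge : (hasEdge E a b c d).Holds M v V ↔
    HasEdge (V E) (a.val M v V) (b.val M v V) (c.val M v V) (d.val M v V) := by
  simp [hasEdge, HasEdge, edgeCode, codeNum, pair, pairNum]

theorem holds_adjacent : (adjacent a b c d).Holds M v V ↔
    AdjNum (a.val M v V) (b.val M v V) (c.val M v V) (d.val M v V) := by
  simp [adjacent, AdjNum]

theorem holds_isEdgeSet (hN : N.IsFresh) :
    (isEdgeSet N E).Holds M v V ↔ IsEdgeSet (N.val M v V) (V E) := by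
  have h (x) (h1 : 10 ≤ x) (h2 : x ≤ 35) := NumTerm.val_update (M := M) (hN x h1 h2)
  simp [isEdgeSet, IsEdgeSet, allLt, exLe, holds_adjacent, h, edgeCode, codeNum, pair, pairNum]

end

variable [VZeroModel M]

/-- With s = a + b, the codes on the diagonal s are at most s(s + 1) + 2s, which is less than (s +
1)(s + 2), where the next diagonal begins. -/
theorem pairNum_lt {a b c d : M.Num} (h : a + b < c + d) : pairNum a b < pairNum c d := by
  have h1 : a + b + 1 ≤ c + d := VZeroModel.succ_le_iff.2 h
  have h2 : b ≤ a + b := by rw [add_comm]; exact VZeroModel.le_add _ _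
  have h3 : (a + b + 1) * (a + b + 1 + 1) ≤ (c + d) * (c + d + 1) := by
    have := VZeroModel.zero_le' (a + b + 1)
    have := VZeroModel.zero_le' (c + d)
    gcongr
  calc pairNum a b ≤ (a + b) * (a + b + 1) + (1 + 1) * (a + b) := by
        unfold pairNum; gcongr
    _ < (a + b) * (a + b + 1) + (1 + 1) * (a + b) + 1 + 1 :=
        (lt_add_one _).trans (lt_add_one _)
    _ = (a + b + 1) * (a + b + 1 + 1) := by ring
    _ ≤ (c + d) * (c + d + 1) := h3
    _ ≤ pairNum c d := VZeroModel.le_add _ _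

theorem pairNum_inj {a b c d : M.Num} (h : pairNum a b = pairNum c d) : a = c ∧ b = d := by
  have hs : a + b = c + d := by
    rcases lt_trichotomy (a + b) (c + d) with h' | h' | h'
    · exact absurd h (pairNum_lt h').ne
    · exact h'
    · exact absurd h (pairNum_lt h').ne'
  have hb : b = d := by
    unfold pairNum at h
    rw [hs] at h
    exact mul_left_cancel₀ (a := (1 + 1 : M.Num)) (VZeroModel.succ_ne_zero _)
      (add_left_cancel h)
  subst hb
  exact ⟨add_right_cancel hs, rfl⟩

theorem codeNum_inj {a b c d a' b' c' d' : M.Num} (h : codeNum a b c d = codeNum a' b' c' d') :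
    (a = a' ∧ b = b') ∧ c = c' ∧ d = d' :=
  (pairNum_inj h).imp pairNum_inj pairNum_inj

/-- Yields one bound for the codes of all edges of a grid, as comprehension requires. -/
theorem pairNum_mono {a b c d : M.Num} (h : a ≤ c) (h' : b ≤ d) : pairNum a b ≤ pairNum c d := by
  unfold pairNum
  have := VZeroModel.zero_le' (a + b + 1)
  have := VZeroModel.zero_le' (c + d)
  have : (0 : M.Num) ≤ 1 + 1 := VZeroModel.zero_le' _
  gcongr

theorem codeNum_mono {a b c d a' b' c' d' : M.Num} (h1 : a ≤ a') (h2 : b ≤ b') (h3 : c ≤ c')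
    (h4 : d ≤ d') : codeNum a b c d ≤ codeNum a' b' c' d' :=
  pairNum_mono (pairNum_mono h1 h2) (pairNum_mono h3 h4)

/-! ### The edge relation of a string -/

/-- The relation between grid points of being joined by an edge in `E`. -/
def edgeRel (n : M.Num) (E : M.Str) (p q : M.IntRing × M.IntRing) : Prop :=
  ∃ a, of _ a ≤ of _ n ∧ ∃ b, of _ b ≤ of _ n ∧ ∃ c, of _ c ≤ of _ n ∧ ∃ d, of _ d ≤ of _ n ∧
    p.1 = of _ a ∧ p.2 = of _ b ∧ q.1 = of _ c ∧ q.2 = of _ d ∧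
      (M.mem (codeNum a b c d) E ∨ M.mem (codeNum c d a b) E)

variable {n : M.Num} {E : M.Str}

theorem edgeRel_of {a b c d : M.Num} : edgeRel n E (of _ a, of _ b) (of _ c, of _ d) ↔
    a ≤ n ∧ b ≤ n ∧ c ≤ n ∧ d ≤ n ∧ HasEdge E a b c d := by
  constructor
  · rintro ⟨a', ha, b', hb, c', hc, d', hd, h1, h2, h3, h4, h⟩
    simp only [of_inj, of_le_of] at *
    subst h1 h2 h3 h4
    exact ⟨ha, hb, hc, hd, h⟩
  · rintro ⟨ha, hb, hc, hd, h⟩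
    exact ⟨a, of_le_of.2 ha, b, of_le_of.2 hb, c, of_le_of.2 hc, d, of_le_of.2 hd, rfl, rfl, rfl,
      rfl, h⟩

theorem edgeRel.exists_of {p q : M.IntRing × M.IntRing} (h : edgeRel n E p q) :
    ∃ a ≤ n, ∃ b ≤ n, ∃ c ≤ n, ∃ d ≤ n, p = (of _ a, of _ b) ∧ q = (of _ c, of _ d) ∧
      HasEdge E a b c d := by
  obtain ⟨a, ha, b, hb, c, hc, d, hd, h1, h2, h3, h4, h⟩ := h
  exact ⟨a, of_le_of.1 ha, b, of_le_of.1 hb, c, of_le_of.1 hc, d, of_le_of.1 hd, Prod.ext h1 h2,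
    Prod.ext h3 h4, h⟩

theorem edgeRel_symm (p q : M.IntRing × M.IntRing) (h : edgeRel n E p q) : edgeRel n E q p := by
  obtain ⟨a, ha, b, hb, c, hc, d, hd, h1, h2, h3, h4, h⟩ := h
  exact ⟨c, hc, d, hd, a, ha, b, hb, h3, h4, h1, h2, h.symm⟩

theorem adj_of_iff {a b c d : M.Num} :
    Adj (of _ a, of _ b) (of _ c, of _ d) ↔ AdjNum a b c d := by
  simp only [Adj, AdjNum, ← map_one (of M.Num), ← map_add, of_inj]

theorem IsEdgeSet.adj (h : IsEdgeSet n E) {p q : M.IntRing × M.IntRing} (hpq : edgeRel n E p q) :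
    Adj p q := by
  obtain ⟨a, ha, b, hb, c, hc, d, hd, rfl, rfl, hE⟩ := hpq.exists_of
  rw [adj_of_iff]
  -- Either of the two codes may be the one in E; injectivity of the coding identifies the adjacent
  -- pair it stands for.
  rcases hE with hE | hE <;> obtain ⟨a', -, b', -, c', -, d', -, hadj, e⟩ :=
    h _ (VZeroModel.lt_len hE) hE <;> obtain ⟨⟨rfl, rfl⟩, rfl, rfl⟩ := codeNum_inj e
  exacts [hadj, hadj.symm]

theorem supp_edgeRel {a b : M.Num} (ha : a ≤ n) (hb : b ≤ n) :
    Supp (edgeRel n E) (of _ a, of _ b) ↔ ∃ c ≤ n, ∃ d ≤ n, HasEdge E a b c d := by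
  constructor
  · rintro ⟨q, h⟩
    obtain ⟨a', -, b', -, c, hc, d, hd, e, rfl, h'⟩ := h.exists_of
    exact ⟨c, hc, d, hd, (edgeRel_of.1 h).2.2.2.2⟩
  · rintro ⟨c, hc, d, hd, h⟩
    exact ⟨_, edgeRel_of.2 ⟨ha, hb, hc, hd, h⟩⟩

theorem degOne_edgeRel {a b : M.Num} (ha : a ≤ n) (hb : b ≤ n) :
    DegOne (edgeRel n E) (of _ a, of _ b) ↔ ∃ c ≤ n, ∃ d ≤ n, HasEdge E a b c d ∧
      ∀ e ≤ n, ∀ f ≤ n, HasEdge E a b e f → e = c ∧ f = d := by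
  constructor
  · rintro ⟨q, h, h'⟩
    obtain ⟨a', -, b', -, c, hc, d, hd, -, rfl, -⟩ := h.exists_of
    refine ⟨c, hc, d, hd, (edgeRel_of.1 h).2.2.2.2, fun e he f hf hef => ?_⟩
    simpa using h' (of _ e, of _ f) (edgeRel_of.2 ⟨ha, hb, he, hf, hef⟩)
  · rintro ⟨c, hc, d, hd, h, hall⟩
    refine ⟨_, edgeRel_of.2 ⟨ha, hb, hc, hd, h⟩, fun r hr => ?_⟩
    obtain ⟨a', -, b', -, c', hc', d', hd', -, rfl, -⟩ := hr.exists_of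
    obtain ⟨rfl, rfl⟩ := hall c' hc' d' hd' (edgeRel_of.1 hr).2.2.2.2
    rfl

theorem degTwo_edgeRel {a b : M.Num} (ha : a ≤ n) (hb : b ≤ n) :
    DegTwo (edgeRel n E) (of _ a, of _ b) ↔ ∃ c ≤ n, ∃ d ≤ n, ∃ c' ≤ n, ∃ d' ≤ n,
      ¬ (c = c' ∧ d = d') ∧ HasEdge E a b c d ∧ HasEdge E a b c' d' ∧
      ∀ e ≤ n, ∀ f ≤ n, HasEdge E a b e f → e = c ∧ f = d ∨ e = c' ∧ f = d' := by
  constructor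
  · rintro ⟨q, q', hne, h, h', hall⟩
    obtain ⟨-, -, -, -, c, hc, d, hd, -, rfl, -⟩ := h.exists_of
    obtain ⟨-, -, -, -, c', hc', d', hd', -, rfl, -⟩ := h'.exists_of
    refine ⟨c, hc, d, hd, c', hc', d', hd', fun e => hne (by rw [e.1, e.2]),
      (edgeRel_of.1 h).2.2.2.2, (edgeRel_of.1 h').2.2.2.2, fun e he f hf hef => ?_⟩
    simpa using hall (of _ e, of _ f) (edgeRel_of.2 ⟨ha, hb, he, hf, hef⟩)
  · rintro ⟨c, hc, d, hd, c', hc', d', hd', hne, h, h', hall⟩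
    refine ⟨_, _, ?_, edgeRel_of.2 ⟨ha, hb, hc, hd, h⟩, edgeRel_of.2 ⟨ha, hb, hc', hd', h'⟩,
      fun r hr => ?_⟩
    · simpa using hne
    · obtain ⟨-, -, -, -, e, he, f, hf, -, rfl, -⟩ := hr.exists_of
      simpa using hall e he f hf (edgeRel_of.1 hr).2.2.2.2

theorem exists_of_supp {p : M.IntRing × M.IntRing} (h : Supp (edgeRel n E) p) :
    ∃ a ≤ n, ∃ b ≤ n, p = (of _ a, of _ b) := by
  obtain ⟨q, h⟩ := h
  obtain ⟨a, ha, b, hb, -, -, -, -, rfl, -⟩ := h.exists_of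
  exact ⟨a, ha, b, hb, rfl⟩

/-! ### The meaning of the formulas about edges -/

variable {v : ℕ → M.Num} {V : ℕ → M.Str} {N a b c d : NumTerm} {E B R : ℕ}

theorem holds_degPos (hN : N.IsFresh) (ha : a.IsFresh) (hb : b.IsFresh)
    (hav : a.val M v V ≤ N.val M v V) (hbv : b.val M v V ≤ N.val M v V) :
    (degPos N E a b).Holds M v V ↔
      Supp (edgeRel (N.val M v V) (V E)) (of _ (a.val M v V), of _ (b.val M v V)) := by
  have h (x) (h1 : 10 ≤ x) (h2 : x ≤ 35) := NumTerm.val_update (M := M) (hN x h1 h2)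
  have h' (x) (h1 : 10 ≤ x) (h2 : x ≤ 35) := NumTerm.val_update (M := M) (ha x h1 h2)
  have h'' (x) (h1 : 10 ≤ x) (h2 : x ≤ 35) := NumTerm.val_update (M := M) (hb x h1 h2)
  rw [supp_edgeRel hav hbv]
  simp [degPos, exLe, holds_hasEdge, h, h', h'']

theorem holds_degOne (hN : N.IsFresh) (ha : a.IsFresh) (hb : b.IsFresh)
    (hav : a.val M v V ≤ N.val M v V) (hbv : b.val M v V ≤ N.val M v V) :
    (degOne N E a b).Holds M v V ↔
      DegOne (edgeRel (N.val M v V) (V E)) (of _ (a.val M v V), of _ (b.val M v V)) := by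
  have h (x) (h1 : 10 ≤ x) (h2 : x ≤ 35) := NumTerm.val_update (M := M) (hN x h1 h2)
  have h' (x) (h1 : 10 ≤ x) (h2 : x ≤ 35) := NumTerm.val_update (M := M) (ha x h1 h2)
  have h'' (x) (h1 : 10 ≤ x) (h2 : x ≤ 35) := NumTerm.val_update (M := M) (hb x h1 h2)
  rw [degOne_edgeRel hav hbv]
  simp [degOne, exLe, allLe, holds_hasEdge, h, h', h'']

theorem holds_degTwo (hN : N.IsFresh) (ha : a.IsFresh) (hb : b.IsFresh)
    (hav : a.val M v V ≤ N.val M v V) (hbv : b.val M v V ≤ N.val M v V) :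
    (degTwo N E a b).Holds M v V ↔
      DegTwo (edgeRel (N.val M v V) (V E)) (of _ (a.val M v V), of _ (b.val M v V)) := by
  have h (x) (h1 : 10 ≤ x) (h2 : x ≤ 35) := NumTerm.val_update (M := M) (hN x h1 h2)
  have h' (x) (h1 : 10 ≤ x) (h2 : x ≤ 35) := NumTerm.val_update (M := M) (ha x h1 h2)
  have h'' (x) (h1 : 10 ≤ x) (h2 : x ≤ 35) := NumTerm.val_update (M := M) (hb x h1 h2)
  rw [degTwo_edgeRel hav hbv]
  simp [degTwo, exLe, allLe, holds_hasEdge, h, h', h'']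

end TwoSorted

/-! ### Curves, paths and the two sentences inside a model -/

namespace TwoSorted

open EdgeRel DifferenceRing

variable {M : Structure} [VZeroModel M]

/-- The term contains no number variable other than the first ten. -/
def NumTerm.IsSimple (t : NumTerm) : Prop := ∀ x, 10 ≤ x → ¬ t.ContainsNum x

theorem NumTerm.IsSimple.isFresh {t : NumTerm} (h : t.IsSimple) : t.IsFresh := fun x hx _ => h x hx

theorem NumTerm.isFresh_var {x : ℕ} (h : 35 < x) : (NumTerm.var x).IsFresh :=
  fun y _ hy e => by have : y = x := e; omega

theorem NumTerm.isSimple_var {x : ℕ} (h : x < 10) : (NumTerm.var x).IsSimple :=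
  fun y hy e => by have : y = x := e; omega

theorem NumTerm.isSimple_zero : (0 : NumTerm).IsSimple := fun _ _ => id

/-- The grid point with coordinates `a` and `b`. -/
noncomputable def point (a b : M.Num) : M.IntRing × M.IntRing := (of _ a, of _ b)

theorem point_inj {a b c d : M.Num} : point a b = point c d ↔ a = c ∧ b = d := by
  simp [point]

variable {v : ℕ → M.Num} {V : ℕ → M.Str} {N a b c d : NumTerm} {E B R : ℕ}

theorem holds_degree (hN : N.IsSimple) {x y : M.Num} (hx : x ≤ N.val M v V) (hy : y ≤ N.val M v V) :
    ((degZero N E (.var 36) (.var 37)) ⩔ (degTwo N E (.var 36) (.var 37))).Holds M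
      (Function.update (Function.update v 36 x) 37 y) V ↔
    ¬ Supp (edgeRel (N.val M v V) (V E)) (point x y) ∨
      DegTwo (edgeRel (N.val M v V) (V E)) (point x y) := by
  have h (x) (h1 : 10 ≤ x) := NumTerm.val_update (M := M) (hN x h1)
  have h36 := NumTerm.isFresh_var (show 35 < 36 by norm_num)
  have h37 := NumTerm.isFresh_var (show 35 < 37 by norm_num)
  rw [Formula.holds_or, holds_degTwo hN.isFresh h36 h37 (by simpa [h] using hx)
    (by simpa [h] using hy), degZero, Formula.holds_neg, holds_degPos hN.isFresh h36 h37
    (by simpa [h] using hx) (by simpa [h] using hy)]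
  simp [h, point]

theorem holds_isCurve (hN : N.IsSimple) : (isCurve N E).Holds M v V ↔
    IsEdgeSet (N.val M v V) (V E) ∧ IsCycle (edgeRel (N.val M v V) (V E)) := by
  have h (x) (h1 : 10 ≤ x) := NumTerm.val_update (M := M) (hN x h1)
  simp only [isCurve, Formula.holds_and, holds_isEdgeSet hN.isFresh, exLt, allLe,
    Formula.holds_exNum, Formula.holds_allNum, Formula.holds_imp, Formula.holds_le,
    Formula.holds_lt, Formula.holds_mem, NumTerm.val_var, NumTerm.val_len, Function.update_self,
    h _ (show 10 ≤ 36 by norm_num), h _ (show 10 ≤ 37 by norm_num)]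
  refine and_congr_right fun hE => ?_
  constructor
  · rintro ⟨⟨e, he, he'⟩, hd⟩
    refine ⟨edgeRel_symm, fun p hp => (hE.adj hp).ne rfl, ?_, fun r => ?_⟩
    · obtain ⟨x, hx, y, hy, z, hz, w, hw, -, rfl⟩ := hE e he he'
      exact ⟨_, _, edgeRel_of.2 ⟨hx, hy, hz, hw, .inl he'⟩⟩
    · by_cases hr : Supp (edgeRel (N.val M v V) (V E)) r
      · obtain ⟨x, hx, y, hy, rfl⟩ := exists_of_supp hr
        exact (holds_degree hN hx hy).1 (hd x hx y hy)
      · exact .inl hr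
  · intro hc
    refine ⟨?_, fun x hx y hy => (holds_degree hN hx hy).2 (hc.deg _)⟩
    obtain ⟨p, q, hpq⟩ := hc.nonempty
    obtain ⟨_, -, _, -, _, -, _, -, -, -, h' | h'⟩ := hpq.exists_of <;>
    exact ⟨_, VZeroModel.lt_len h', h'⟩

/-- The formula does not say that the two ends differ, whereas `IsPath` does; hence the assumption
`hne`. -/
theorem holds_connects (hN : N.IsSimple) (ha : a.IsSimple) (hb : b.IsSimple) (hc : c.IsSimple)
    (hd : d.IsSimple) (hav : a.val M v V ≤ N.val M v V) (hbv : b.val M v V ≤ N.val M v V)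
    (hcv : c.val M v V ≤ N.val M v V) (hdv : d.val M v V ≤ N.val M v V)
    (hne : point (a.val M v V) (b.val M v V) ≠ point (c.val M v V) (d.val M v V)) :
    (connects N E a b c d).Holds M v V ↔ IsEdgeSet (N.val M v V) (V E) ∧
      IsPath (edgeRel (N.val M v V) (V E)) (point (a.val M v V) (b.val M v V))
        (point (c.val M v V) (d.val M v V)) := by
  have h {t : NumTerm} (ht : t.IsSimple) (x) (h1 : 10 ≤ x) :=
    NumTerm.val_update (M := M) (ht x h1)
  simp only [connects, Formula.holds_and, holds_isEdgeSet hN.isFresh, allLe,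
    holds_degOne hN.isFresh ha.isFresh hb.isFresh hav hbv,
    holds_degOne hN.isFresh hc.isFresh hd.isFresh hcv hdv,
    Formula.holds_allNum, Formula.holds_imp, Formula.holds_le, Formula.holds_neg,
    Formula.holds_numEq, NumTerm.val_var, Function.update_self,
    h hN _ (show 10 ≤ 36 by norm_num), h hN _ (show 10 ≤ 37 by norm_num),
    h ha _ (show 10 ≤ 36 by norm_num), h ha _ (show 10 ≤ 37 by norm_num),
    h hb _ (show 10 ≤ 36 by norm_num), h hb _ (show 10 ≤ 37 by norm_num),
    h hc _ (show 10 ≤ 36 by norm_num), h hc _ (show 10 ≤ 37 by norm_num),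
    h hd _ (show 10 ≤ 36 by norm_num), h hd _ (show 10 ≤ 37 by norm_num),
    Function.update_of_ne (show (36 : ℕ) ≠ 37 by norm_num), ← point_inj]
  refine and_congr_right fun hE => ?_
  constructor
  · rintro ⟨h1, h2, h3⟩
    refine ⟨edgeRel_symm, fun p hp => (hE.adj hp).ne rfl, hne, h1, h2, fun r hr1 hr2 => ?_⟩
    by_cases hr : Supp (edgeRel (N.val M v V) (V E)) r
    · obtain ⟨x, hx, y, hy, rfl⟩ := exists_of_supp hr
      exact (holds_degree hN hx hy).1 (h3 x hx y hy ⟨hr1, hr2⟩)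
    · exact .inl hr
  · intro hp
    exact ⟨hp.left, hp.right, fun x hx y hy hr =>
      (holds_degree hN hx hy).2 (hp.inner _ hr.1 hr.2)⟩

theorem holds_intersect (hN : N.IsSimple) : (intersect N B R).Holds M v V ↔
    ∃ p, Supp (edgeRel (N.val M v V) (V B)) p ∧ Supp (edgeRel (N.val M v V) (V R)) p := by
  have h (x) (h1 : 10 ≤ x) := NumTerm.val_update (M := M) (hN x h1)
  have h36 := NumTerm.isFresh_var (show 35 < 36 by norm_num)
  have h37 := NumTerm.isFresh_var (show 35 < 37 by norm_num)
  have key (x y : M.Num) (hx : x ≤ N.val M v V) (hy : y ≤ N.val M v V) (X : ℕ) :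
      (degPos N X (.var 36) (.var 37)).Holds M
        (Function.update (Function.update v 36 x) 37 y) V ↔
      Supp (edgeRel (N.val M v V) (V X)) (point x y) := by
    rw [holds_degPos hN.isFresh h36 h37 (by simpa [h] using hx) (by simpa [h] using hy)]
    simp [h, point]
  simp only [intersect, exLe, Formula.holds_and, Formula.holds_exNum, Formula.holds_le,
    NumTerm.val_var, Function.update_self, h _ (show 10 ≤ 36 by norm_num),
    h _ (show 10 ≤ 37 by norm_num)]
  constructor
  · rintro ⟨x, hx, y, hy, h1, h2⟩
    exact ⟨point x y, (key x y hx hy B).1 h1, (key x y hx hy R).1 h2⟩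
  · rintro ⟨p, h1, h2⟩
    obtain ⟨x, hx, y, hy, rfl⟩ := exists_of_supp h1
    exact ⟨x, hx, y, hy, (key x y hx hy B).2 h1, (key x y hx hy R).2 h2⟩

/-- The points `p` and `q` lie on different sides of `G`. -/
def DifferentSides {Z : Type*} [CommRing Z] (G : Z × Z → Z × Z → Prop) (p q : Z × Z) : Prop :=
  p.1 = q.1 ∧ (p.2 + 2 = q.2 ∨ q.2 + 2 = p.2) ∧ ¬ Supp G p ∧ ¬ Supp G q ∧
    ∃ y, 2 * y = p.2 + q.2 ∧ DegTwo G (p.1, y)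

theorem holds_differentSides (hN : N.IsSimple) (ha : a.IsSimple) (hb : b.IsSimple) (hc : c.IsSimple)
    (hd : d.IsSimple) (hav : a.val M v V ≤ N.val M v V) (hbv : b.val M v V ≤ N.val M v V)
    (hcv : c.val M v V ≤ N.val M v V) (hdv : d.val M v V ≤ N.val M v V) :
    (differentSides N E a b c d).Holds M v V ↔
      DifferentSides (edgeRel (N.val M v V) (V E)) (point (a.val M v V) (b.val M v V))
        (point (c.val M v V) (d.val M v V)) := by
  have h {t : NumTerm} (ht : t.IsSimple) (x) (h1 : 10 ≤ x) :=
    NumTerm.val_update (M := M) (ht x h1)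
  have h36 := NumTerm.isFresh_var (show 35 < 36 by norm_num)
  have key (y : M.Num) (hy : y ≤ N.val M v V) :
      (degTwo N E a (.var 36)).Holds M (Function.update v 36 y) V ↔
      DegTwo (edgeRel (N.val M v V) (V E)) (point (a.val M v V) y) := by
    rw [holds_degTwo hN.isFresh ha.isFresh h36 (by simpa [h hN, h ha] using hav)
      (by simpa [h hN] using hy)]
    simp [h hN, h ha, point]
  have cast (x y : M.Num) : of M.Num x + 2 = of M.Num y ↔ x + (1 + 1) = y := by
    rw [← of_inj (S := M.Num), map_add, map_add, map_one, one_add_one_eq_two]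
  have cast' (x y z : M.Num) : 2 * of M.Num x = of M.Num y + of M.Num z ↔
      (1 + 1) * x = y + z := by
    rw [← of_inj (S := M.Num), map_add, map_mul, map_add, map_one, one_add_one_eq_two]
  simp only [differentSides, DifferentSides, exLe, Formula.holds_and, Formula.holds_exNum,
    Formula.holds_le, Formula.holds_or, Formula.holds_numEq, degZero, Formula.holds_neg,
    holds_degPos hN.isFresh ha.isFresh hb.isFresh hav hbv,
    holds_degPos hN.isFresh hc.isFresh hd.isFresh hcv hdv, NumTerm.val_add, NumTerm.val_mul,
    NumTerm.val_one,
    NumTerm.val_var, Function.update_self, h hN _ (show 10 ≤ 36 by norm_num),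
    h hb _ (show 10 ≤ 36 by norm_num), h hd _ (show 10 ≤ 36 by norm_num), point, of_inj, cast]
  refine and_congr_right fun _ => and_congr_right fun _ => and_congr_right fun _ =>
    and_congr_right fun _ => ?_
  constructor
  · rintro ⟨y, hy, hy', hd⟩
    exact ⟨of _ y, (cast' _ _ _).2 hy', (key y hy).1 hd⟩
  · rintro ⟨y, hy', hd⟩
    -- The midpoint is a priori only a ring element; having positive degree makes it a number
    -- bounded by n.
    obtain ⟨x, hx, y, hy, e⟩ := exists_of_supp hd.supp
    obtain ⟨-, rfl⟩ := Prod.mk.inj e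
    exact ⟨y, hy, (cast' _ _ _).1 hy', (key y hy).2 hd⟩

theorem holds_jordanCurveSentence : jordanCurveSentence.Holds M v V ↔
    ∀ (n : M.Num) (B R : M.Str), ∀ x₁ ≤ n, ∀ y₁ ≤ n, ∀ x₂ ≤ n, ∀ y₂ ≤ n,
      IsEdgeSet n B → IsEdgeSet n R → IsCycle (edgeRel n B) →
      DifferentSides (edgeRel n B) (point x₁ y₁) (point x₂ y₂) →
      IsPath (edgeRel n R) (point x₁ y₁) (point x₂ y₂) →
      ∃ p, Supp (edgeRel n B) p ∧ Supp (edgeRel n R) p := by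
  simp only [jordanCurveSentence, allLe, Formula.holds_allNum, Formula.holds_allStr,
    Formula.holds_imp, Formula.holds_le, NumTerm.val_var, Function.update_self]
  simp only [Function.update_of_ne (show (0 : ℕ) ≠ 1 by norm_num),
    Function.update_of_ne (show (0 : ℕ) ≠ 2 by norm_num),
    Function.update_of_ne (show (0 : ℕ) ≠ 3 by norm_num),
    Function.update_of_ne (show (0 : ℕ) ≠ 4 by norm_num), Function.update_self]
  refine forall_congr' fun n => forall_congr' fun B => forall_congr' fun R =>
    forall_congr' fun x₁ => forall_congr' fun h₁ => forall_congr' fun y₁ =>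
    forall_congr' fun h₂ => forall_congr' fun x₂ => forall_congr' fun h₃ =>
    forall_congr' fun y₂ => forall_congr' fun h₄ => ?_
  have s (i : ℕ) (hi : i < 10) := NumTerm.isSimple_var hi
  rw [holds_intersect (s 0 (by norm_num)), Formula.holds_and, Formula.holds_and,
    holds_isCurve (s 0 (by norm_num)), holds_differentSides (s 0 (by norm_num))
      (s 1 (by norm_num)) (s 2 (by norm_num)) (s 3 (by norm_num)) (s 4 (by norm_num))
      (by simpa) (by simpa) (by simpa) (by simpa)]
  simp only [NumTerm.val_var, Function.update_self, ne_eq, zero_ne_one,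
    not_false_eq_true, Function.update_of_ne, Nat.reduceEqDiff, OfNat.zero_ne_ofNat,
    OfNat.one_ne_ofNat]
  -- Points on different sides are distinct, so `holds_connects` applies in the only case that
  -- matters.
  by_cases hd : DifferentSides (edgeRel n B) (point x₁ y₁) (point x₂ y₂)
  · have hne : point x₁ y₁ ≠ point x₂ y₂ := by
      intro e
      rw [e] at hd
      rcases hd.2.1 with h | h <;> linarith
    rw [holds_connects (s 0 (by norm_num))
      (s 1 (by norm_num)) (s 2 (by norm_num)) (s 3 (by norm_num)) (s 4 (by norm_num))
      (by simpa) (by simpa) (by simpa) (by simpa) (by simpa using hne)]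
    simp only [NumTerm.val_var, Function.update_self, ne_eq, zero_ne_one,
      not_false_eq_true, Function.update_of_ne, Nat.reduceEqDiff, OfNat.zero_ne_ofNat,
      OfNat.one_ne_ofNat]
    tauto
  · simp [hd]

theorem holds_stConnectivitySentence : stConnectivitySentence.Holds M v V ↔
    ∀ (n : M.Num) (B R : M.Str), IsEdgeSet n B → IsEdgeSet n R →
      IsPath (edgeRel n B) (point 0 n) (point n 0) →
      IsPath (edgeRel n R) (point 0 0) (point n n) →
      ∃ p, Supp (edgeRel n B) p ∧ Supp (edgeRel n R) p := by
  simp only [stConnectivitySentence, Formula.holds_allNum, Formula.holds_allStr,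
    Formula.holds_imp]
  refine forall_congr' fun n => forall_congr' fun B => forall_congr' fun R => ?_
  have s (i : ℕ) (hi : i < 10) := NumTerm.isSimple_var hi
  have z := NumTerm.isSimple_zero
  rw [holds_intersect (s 0 (by norm_num)), Formula.holds_and]
  -- For n = 0 the corners coincide and `holds_connects` is unavailable. Both versions then hold
  -- vacuously: the grid has one point and edges have distinct ends, so no point has degree 1.
  by_cases hn : n = 0
  · subst hn
    constructor
    · intro _ _ _ h
      exact absurd rfl h.ne
    · rintro - ⟨-, h⟩
      simp only [connects, Formula.holds_and] at h
      have h1 := (holds_isEdgeSet (s 0 (by norm_num)).isFresh).1 h.1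
      have h2 := (holds_degOne (s 0 (by norm_num)).isFresh z.isFresh z.isFresh
        (by simp) (by simp)).1 h.2.1
      obtain ⟨q, hq, -⟩ := h2
      have hne := (h1.adj hq).ne
      obtain ⟨a, ha, b, hb, c, hc, d, hd, e, rfl, -⟩ := hq.exists_of
      simp only [NumTerm.val_var, Function.update_self, VZeroModel.le_zero_iff] at hc hd
      subst hc hd
      exact absurd rfl hne
  · rw [holds_connects (s 0 (by norm_num)) z (s 0 (by norm_num)) (s 0 (by norm_num)) z
      (by simpa using VZeroModel.zero_le' _) le_rfl le_rfl (by simpa using VZeroModel.zero_le' _)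
      (by simpa [point_inj] using fun h => (hn h.symm).elim),
      holds_connects (s 0 (by norm_num)) z z (s 0 (by norm_num)) (s 0 (by norm_num))
      (by simpa using VZeroModel.zero_le' _) (by simpa using VZeroModel.zero_le' _) le_rfl le_rfl
      (by simpa [point_inj] using fun h => (hn h.symm).elim)]
    simp only [NumTerm.val_var, NumTerm.val_zero, Function.update_self, ne_eq, zero_ne_one,
      not_false_eq_true, Function.update_of_ne]
    tauto

end TwoSorted

namespace TwoSorted

open EdgeRel DifferenceRing

variable {M : Structure}

/-! ### Definable predicates -/

section Definability

variable (prm : ℕ → M.Num) (B : M.Str)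

/-- The variables below `8` have the parameters `prm` as values, and the variables from `10` on the
entries of `w`. -/
def Agrees {k : ℕ} (w : Fin k → M.Num) (v : ℕ → M.Num) : Prop :=
  (∀ i < 8, v i = prm i) ∧ ∀ i : Fin k, v (10 + i) = w i

/-- The predicate is defined by a `Σ₀ᴮ` formula in which the string variable `0` does not occur and
the other string variables denote `B`. -/
def IsDef {k : ℕ} (P : (Fin k → M.Num) → Prop) : Prop :=
  ∃ φ, IsSigmaZeroB φ ∧ ¬ φ.ContainsStr 0 ∧
    ∀ w v A, Agrees prm w v → (φ.Holds M v (Function.update (fun _ => B) 0 A) ↔ P w)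

variable {prm B} {k : ℕ} {P Q : (Fin k → M.Num) → Prop}

namespace IsDef

theorem not (hP : IsDef prm B P) : IsDef prm B fun w => ¬ P w := by
  obtain ⟨φ, h1, h2, h3⟩ := hP
  exact ⟨∼φ, h1.neg, h2, fun w v A h => not_congr (h3 w v A h)⟩

theorem and (hP : IsDef prm B P) (hQ : IsDef prm B Q) : IsDef prm B fun w => P w ∧ Q w := by
  obtain ⟨φ, h1, h2, h3⟩ := hP
  obtain ⟨ψ, h1', h2', h3'⟩ := hQ
  exact ⟨φ ⩓ ψ, h1.and h1', fun h => h.elim h2 h2',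
    fun w v A h => and_congr (h3 w v A h) (h3' w v A h)⟩

theorem or (hP : IsDef prm B P) (hQ : IsDef prm B Q) : IsDef prm B fun w => P w ∨ Q w := by
  obtain ⟨φ, h1, h2, h3⟩ := hP
  obtain ⟨ψ, h1', h2', h3'⟩ := hQ
  exact ⟨φ ⩔ ψ, h1.or h1', fun h => h.elim h2 h2',
    fun w v A h => or_congr (h3 w v A h) (h3' w v A h)⟩

theorem _root_.TwoSorted.containsStr_pair {X : ℕ} {a b : NumTerm} (h : (pair a b).ContainsStr X) :
    a.ContainsStr X ∨ b.ContainsStr X := by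
  rcases h with ((h | h) | (h | h) | h) | (h | h) | h
  exacts [.inl h, .inr h, .inl h, .inr h, h.elim, h.elim, h.elim, .inr h]

theorem mem_codeNum (i j l m : Fin k) :
    IsDef prm B fun w => M.mem (codeNum (w i) (w j) (w l) (w m)) B := by
  refine ⟨.mem (edgeCode (.var (10 + i)) (.var (10 + j)) (.var (10 + l)) (.var (10 + m))) 1,
    .mem _ _, ?_, fun w v A h => ?_⟩
  · rintro (h | h)
    · exact (containsStr_pair h).elim (fun h => (containsStr_pair h).elim id id)
        (fun h => (containsStr_pair h).elim id id)
    · exact zero_ne_one h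
  · simp [edgeCode, codeNum, pair, pairNum, h.2]

end IsDef

variable [VZeroModel M]

variable (prm) in
/-- The function is the difference of two terms, in parameters and the variables from `10` on. -/
def IsTerm (f : (Fin k → M.Num) → M.IntRing) : Prop :=
  ∃ t s : NumTerm, (∀ x, 10 + k ≤ x → ¬ t.ContainsNum x ∧ ¬ s.ContainsNum x) ∧
    (¬ t.ContainsStr 0 ∧ ¬ s.ContainsStr 0) ∧
    ∀ w v V, Agrees prm w v → f w = of _ (t.val M v V) - of _ (s.val M v V)

variable {f g : (Fin k → M.Num) → M.IntRing}

namespace IsTerm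

theorem var (i : Fin k) : IsTerm prm fun w : Fin k → M.Num => of _ (w i) := by
  refine ⟨.var (10 + i), 0, fun x hx => ⟨fun h => ?_, id⟩, ⟨id, id⟩, fun w v V h => ?_⟩
  · have : x = 10 + i := h
    omega
  · simp [h.2 i]

theorem param {i : ℕ} (hi : i < 8) : IsTerm prm fun _ : Fin k → M.Num => of _ (prm i) := by
  refine ⟨.var i, 0, fun x hx => ⟨fun h => ?_, id⟩, ⟨id, id⟩, fun w v V h => ?_⟩
  · have : x = i := h
    omega
  · simp [h.1 i hi]

theorem zero : IsTerm prm fun _ : Fin k → M.Num => (0 : M.IntRing) :=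
  ⟨0, 0, fun _ _ => ⟨id, id⟩, ⟨id, id⟩, by simp⟩

theorem one : IsTerm prm fun _ : Fin k → M.Num => (1 : M.IntRing) :=
  ⟨1, 0, fun _ _ => ⟨id, id⟩, ⟨id, id⟩, by simp⟩

theorem add (hf : IsTerm prm f) (hg : IsTerm prm g) : IsTerm prm fun w => f w + g w := by
  obtain ⟨t, s, h1, h2, h3⟩ := hf
  obtain ⟨t', s', h1', h2', h3'⟩ := hg
  refine ⟨t + t', s + s', fun x hx => ⟨fun h => ?_, fun h => ?_⟩,
    ⟨fun h => ?_, fun h => ?_⟩, fun w v V h => ?_⟩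
  · exact h.elim (h1 x hx).1 (h1' x hx).1
  · exact h.elim (h1 x hx).2 (h1' x hx).2
  · exact h.elim h2.1 h2'.1
  · exact h.elim h2.2 h2'.2
  · simp only [h3 w v V h, h3' w v V h, NumTerm.val_add, map_add]
    ring

theorem neg (hf : IsTerm prm f) : IsTerm prm fun w => -f w := by
  obtain ⟨t, s, h1, h2, h3⟩ := hf
  exact ⟨s, t, fun x hx => (h1 x hx).symm, h2.symm, fun w v V h => by
    simp only [h3 w v V h, neg_sub]⟩

theorem sub (hf : IsTerm prm f) (hg : IsTerm prm g) : IsTerm prm fun w => f w - g w := by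
  simpa only [sub_eq_add_neg] using hf.add hg.neg

theorem two_mul (hf : IsTerm prm f) : IsTerm prm fun w => 2 * f w := by
  simpa only [_root_.two_mul] using hf.add hf

theorem ofNat (m : ℕ) [m.AtLeastTwo] :
    IsTerm prm fun _ : Fin k → M.Num => (OfNat.ofNat m : M.IntRing) := by
  have (m : ℕ) : IsTerm prm fun _ : Fin k → M.Num => (m : M.IntRing) := by
    induction m with
    | zero => simpa only [Nat.cast_zero] using zero
    | succ m ih => simpa only [Nat.cast_succ] using ih.add one
  exact this m

theorem init (hf : IsTerm prm f) : IsTerm prm fun w : Fin (k + 1) → M.Num => f (Fin.init w) := by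
  obtain ⟨t, s, h1, h2, h3⟩ := hf
  exact ⟨t, s, fun x hx => h1 x (by omega), h2, fun w v V h =>
    h3 _ _ _ ⟨h.1, fun i => h.2 i.castSucc⟩⟩

end IsTerm

namespace IsDef

/-- The vocabulary has no subtraction, so the subtracted terms are moved to the opposite sides. -/
theorem le (hf : IsTerm prm f) (hg : IsTerm prm g) : IsDef prm B fun w => f w ≤ g w := by
  obtain ⟨t, s, h1, h2, h3⟩ := hf
  obtain ⟨t', s', h1', h2', h3'⟩ := hg
  refine ⟨t + s' ≼ t' + s, .le _ _, ?_, fun w v A h => ?_⟩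
  · rintro ((h | h) | h | h)
    exacts [h2.1 h, h2'.2 h, h2'.1 h, h2.2 h]
  · beta_reduce
    rw [h3 w v _ h, h3' w v _ h, Formula.holds_le, NumTerm.val_add, NumTerm.val_add, ← of_le_of,
      map_add, map_add, sub_le_sub_iff]

theorem eq (hf : IsTerm prm f) (hg : IsTerm prm g) : IsDef prm B fun w => f w = g w := by
  obtain ⟨t, s, h1, h2, h3⟩ := hf
  obtain ⟨t', s', h1', h2', h3'⟩ := hg
  refine ⟨t + s' ≐ t' + s, .numEq _ _, ?_, fun w v A h => ?_⟩
  · rintro ((h | h) | h | h)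
    exacts [h2.1 h, h2'.2 h, h2'.1 h, h2.2 h]
  · beta_reduce
    rw [h3 w v _ h, h3' w v _ h, Formula.holds_numEq, NumTerm.val_add, NumTerm.val_add, ← of_inj,
      map_add, map_add, sub_eq_sub_iff_add_eq_add]

/-- A bound a ≤ t - s is expressed by a + s ≤ t; it implies a ≤ t, which serves as the syntactic
bound. The quantified variable is 10 + k, the next one after the entries of w. -/
theorem ex {Q : (Fin k → M.Num) → M.Num → Prop} (hf : IsTerm prm f)
    (hQ : IsDef prm B fun w : Fin (k + 1) → M.Num => Q (Fin.init w) (w (Fin.last k))) :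
    IsDef prm B fun w => ∃ a, of _ a ≤ f w ∧ Q w a := by
  obtain ⟨t, s, h1, h2, h3⟩ := hf
  obtain ⟨φ, h1', h2', h3'⟩ := hQ
  have hx := h1 (10 + k) le_rfl
  refine ⟨exLe (10 + k) t ((.var (10 + k) + s ≼ t) ⩓ φ), .exLe hx.1 (.and (.le _ _) h1'), ?_,
    fun w v A h => ?_⟩
  · rintro ((h | h) | ((h | h) | h) | h)
    exacts [h, h2.1 h, h, h2.2 h, h2.1 h, h2' h]
  · simp only [exLe, Formula.holds_exNum, Formula.holds_and, Formula.holds_le, NumTerm.val_var,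
      Function.update_self, NumTerm.val_add, NumTerm.val_update hx.1, NumTerm.val_update hx.2]
    refine exists_congr fun a => ?_
    have ha : Agrees prm (Fin.snoc (α := fun _ => M.Num) w a) (Function.update v (10 + k) a) := by
      refine ⟨fun i hi => ?_, fun i => ?_⟩
      · rw [Function.update_of_ne (by omega), h.1 i hi]
      · refine Fin.lastCases ?_ (fun i => ?_) i
        · simp
        · rw [Fin.snoc_castSucc, Function.update_of_ne (by simp; omega), ← h.2 i]
          rfl
    rw [h3' _ _ A ha]
    beta_reduce
    rw [h3 w v (Function.update (fun _ => B) 0 A) h, le_sub_iff_add_le, ← map_add, of_le_of,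
      Fin.init_snoc, Fin.snoc_last]
    exact ⟨fun h => h.2, fun h => ⟨(VZeroModel.le_add _ _).trans h.1, h⟩⟩

/-- The definition of `TwoSorted.edgeRel` has its quantifiers bounded in the ring and its equations
spelled out so that the closure rules apply to it directly. -/
protected theorem edgeRel {i : ℕ} (hi : i < 8) {f₁ f₂ f₃ f₄ : (Fin k → M.Num) → M.IntRing}
    (h₁ : IsTerm prm f₁) (h₂ : IsTerm prm f₂) (h₃ : IsTerm prm f₃) (h₄ : IsTerm prm f₄) :
    IsDef prm B fun w => TwoSorted.edgeRel (prm i) B (f₁ w, f₂ w) (f₃ w, f₄ w) := by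
  refine .ex (.param hi) <| .ex (.param hi) <| .ex (.param hi) <| .ex (.param hi) <|
    .and (.eq h₁.init.init.init.init (.var _)) <| .and (.eq h₂.init.init.init.init (.var _)) <|
    .and (.eq h₃.init.init.init.init (.var _)) <| .and (.eq h₄.init.init.init.init (.var _)) <|
    .or (.mem_codeNum _ _ _ _) (.mem_codeNum _ _ _ _)

protected theorem hSeg {a b c f₁ f₂ f₃ f₄ : (Fin k → M.Num) → M.IntRing} (ha : IsTerm prm a)
    (hb : IsTerm prm b) (hc : IsTerm prm c) (h₁ : IsTerm prm f₁) (h₂ : IsTerm prm f₂)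
    (h₃ : IsTerm prm f₃) (h₄ : IsTerm prm f₄) :
    IsDef prm B fun w => hSeg (a w) (b w) (c w) (f₁ w, f₂ w) (f₃ w, f₄ w) :=
  .and (.or (.eq (.add h₁ .one) h₃) (.eq (.add h₃ .one) h₁)) <| .and (.eq h₂ hc) <|
    .and (.eq h₄ hc) <| .and (.le ha h₁) <| .and (.le h₁ hb) <| .and (.le ha h₃) (.le h₃ hb)

protected theorem vSeg {a b c f₁ f₂ f₃ f₄ : (Fin k → M.Num) → M.IntRing} (ha : IsTerm prm a)
    (hb : IsTerm prm b) (hc : IsTerm prm c) (h₁ : IsTerm prm f₁) (h₂ : IsTerm prm f₂)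
    (h₃ : IsTerm prm f₃) (h₄ : IsTerm prm f₄) :
    IsDef prm B fun w => vSeg (a w) (b w) (c w) (f₁ w, f₂ w) (f₃ w, f₄ w) :=
  .hSeg ha hb hc h₂ h₁ h₄ h₃

end IsDef

/-- A definable set of edges of the grid is the edge relation of a string. -/
theorem exists_edgeRel_eq {G : M.IntRing × M.IntRing → M.IntRing × M.IntRing → Prop}
    (hG : IsDef prm B fun w : Fin 4 → M.Num => G (of _ (w 0), of _ (w 1)) (of _ (w 2), of _ (w 3)))
    (hsymm : ∀ p q, G p q → G q p) (hadj : ∀ p q, G p q → Adj p q)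
    (hbox : ∀ p, Supp G p → (0 ≤ p.1 ∧ p.1 ≤ of _ (prm 0)) ∧ 0 ≤ p.2 ∧ p.2 ≤ of _ (prm 0)) :
    ∃ E, IsEdgeSet (prm 0) E ∧ edgeRel (prm 0) E = G := by
  obtain ⟨φ, h1, h2, h3⟩ := hG
  set N := prm 0
  -- Variables 8 and 9 are neither parameters nor entries of w and serve as bound and element. The
  -- bound is one more than the largest possible code of an edge.
  obtain ⟨E, hlen, hE⟩ := VZeroModel.comprehension
    (exLe 10 (.var 0) (exLe 11 (.var 0) (exLe 12 (.var 0) (exLe 13 (.var 0)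
      (φ ⩓ (.var 9 ≐ edgeCode (.var 10) (.var 11) (.var 12) (.var 13)))))))
    (.exLe (by simp [NumTerm.ContainsNum]) <| .exLe (by simp [NumTerm.ContainsNum]) <|
      .exLe (by simp [NumTerm.ContainsNum]) <| .exLe (by simp [NumTerm.ContainsNum]) <|
      h1.and (.numEq _ _)) (X := 0) (by
        have : ¬ (edgeCode (.var 10) (.var 11) (.var 12) (.var 13)).ContainsStr 0 := fun h =>
          (containsStr_pair h).elim (fun h => (containsStr_pair h).elim id id)
            (fun h => (containsStr_pair h).elim id id)
        simp [exLe, Formula.ContainsStr, NumTerm.ContainsStr, h2, this])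
    (y := 8) (z := 9) (by norm_num) prm (fun _ => B) (codeNum N N N N + 1)
  have key {e : M.Num} (he : e ≤ codeNum N N N N) : M.mem e E ↔ ∃ a ≤ N, ∃ b ≤ N, ∃ c ≤ N,
      ∃ d ≤ N, G (of _ a, of _ b) (of _ c, of _ d) ∧ e = codeNum a b c d := by
    rw [hE e ((VZeroModel.le_iff_lt_succ _ _).1 he)]
    simp only [exLe, Formula.holds_exNum, Formula.holds_and, Formula.holds_le,
      Formula.holds_numEq, NumTerm.val_var, Function.update_self]
    refine exists_congr fun a => ?_
    refine and_congr (by simp [N]) (exists_congr fun b => and_congr (by simp [N])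
      (exists_congr fun c => and_congr (by simp [N]) (exists_congr fun d => and_congr (by simp [N])
        (and_congr ?_ (by simp [edgeCode, codeNum, pair, pairNum])))))
    refine h3 ![a, b, c, d] _ E ⟨fun i hi => ?_, fun i => ?_⟩
    · simp only [ne_eq, Function.update_of_ne, show i ≠ 13 by omega, show i ≠ 12 by omega,
        show i ≠ 11 by omega, show i ≠ 10 by omega, show i ≠ 9 by omega, show i ≠ 8 by omega,
        not_false_eq_true]
    · fin_cases i <;> simp
  have key' {a b c d : M.Num} (ha : a ≤ N) (hb : b ≤ N) (hc : c ≤ N) (hd : d ≤ N) :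
      M.mem (codeNum a b c d) E ↔ G (of _ a, of _ b) (of _ c, of _ d) := by
    rw [key (codeNum_mono ha hb hc hd)]
    constructor
    · rintro ⟨a', -, b', -, c', -, d', -, h, e⟩
      obtain ⟨⟨rfl, rfl⟩, rfl, rfl⟩ := codeNum_inj e
      exact h
    · exact fun h => ⟨a, ha, b, hb, c, hc, d, hd, h, rfl⟩
  refine ⟨E, fun e _ he => ?_, ?_⟩
  · obtain ⟨a, ha, b, hb, c, hc, d, hd, h, rfl⟩ :=
      (key ((VZeroModel.le_iff_lt_succ _ _).2 ((VZeroModel.lt_len he).trans_le hlen))).1 he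
    exact ⟨a, ha, b, hb, c, hc, d, hd, adj_of_iff.1 (hadj _ _ h), rfl⟩
  · funext p q
    refine propext ⟨fun h => ?_, fun h => ?_⟩
    · obtain ⟨a, ha, b, hb, c, hc, d, hd, rfl, rfl, h' | h'⟩ := TwoSorted.edgeRel.exists_of h
      · exact (key' ha hb hc hd).1 h'
      · exact hsymm _ _ ((key' hc hd ha hb).1 h')
    · have hp := hbox p ⟨q, h⟩
      have hq := hbox q ⟨p, hsymm _ _ h⟩
      obtain ⟨p1, p2⟩ := p
      obtain ⟨q1, q2⟩ := q
      obtain ⟨a, rfl⟩ := exists_of_nonneg hp.1.1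
      obtain ⟨b, rfl⟩ := exists_of_nonneg hp.2.1
      obtain ⟨c, rfl⟩ := exists_of_nonneg hq.1.1
      obtain ⟨d, rfl⟩ := exists_of_nonneg hq.2.1
      have ha := of_le_of.1 hp.1.2
      have hb := of_le_of.1 hp.2.2
      have hc := of_le_of.1 hq.1.2
      have hd := of_le_of.1 hq.2.2
      exact edgeRel_of.2 ⟨ha, hb, hc, hd, .inl ((key' ha hb hc hd).2 h)⟩

end Definability

end TwoSorted

/-! ### Closing one path to a curve and prolonging the other -/

namespace EdgeRel

section

variable {Z : Type*} [CommRing Z] [LinearOrder Z]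

/-- The edges from `(0, n)` via `(-2, n)`, `(-2, -2)` and `(n, -2)` to `(n, 0)`. -/
def frame (n : Z) : Z × Z → Z × Z → Prop :=
  union (union (union (hSeg (-2) 0 n) (vSeg (-2) n (-2))) (hSeg (-2) n (-2))) (vSeg (-2) 0 n)

/-- Extension of `G` by the edge from `(0, -1)` to `(0, 0)` and the edges from `(n, n)` via
`(n + 1, n)` and `(n + 1, -3)` to `(0, -3)`. -/
def prolong (n : Z) (G : Z × Z → Z × Z → Prop) : Z × Z → Z × Z → Prop :=
  union (union (union (union (vSeg (-1) 0 0) G) (hSeg n (n + 1) n)) (vSeg (-3) n (n + 1)))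
    (hSeg 0 (n + 1) (-3))

/-- The support of `G` lies in the square of side `n`. -/
def InBox (n : Z) (G : Z × Z → Z × Z → Prop) : Prop :=
  ∀ p, Supp G p → (0 ≤ p.1 ∧ p.1 ≤ n) ∧ 0 ≤ p.2 ∧ p.2 ≤ n

theorem supp_frame {n x y : Z} (h : Supp (frame n) (x, y)) :
    (y = n ∧ -2 ≤ x ∧ x ≤ 0) ∨ (x = -2 ∧ -2 ≤ y ∧ y ≤ n) ∨ (y = -2 ∧ -2 ≤ x ∧ x ≤ n) ∨
      (x = n ∧ -2 ≤ y ∧ y ≤ 0) := by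
  simp only [frame, supp_union] at h
  rcases h with ((h | h) | h) | h
  exacts [.inl (supp_hSeg h), .inr (.inl (supp_vSeg h)), .inr (.inr (.inl (supp_hSeg h))),
    .inr (.inr (.inr (supp_vSeg h)))]

theorem supp_prolong {n x y : Z} {G : Z × Z → Z × Z → Prop} (h : Supp (prolong n G) (x, y)) :
    Supp G (x, y) ∨ (x = 0 ∧ -1 ≤ y ∧ y ≤ 0) ∨ (y = n ∧ n ≤ x ∧ x ≤ n + 1) ∨
      (x = n + 1 ∧ -3 ≤ y ∧ y ≤ n) ∨ (y = -3 ∧ 0 ≤ x ∧ x ≤ n + 1) := by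
  simp only [prolong, supp_union] at h
  rcases h with (((h | h) | h) | h) | h
  exacts [.inr (.inl (supp_vSeg h)), .inl h, .inr (.inr (.inl (supp_hSeg h))),
    .inr (.inr (.inr (.inl (supp_vSeg h)))), .inr (.inr (.inr (.inr (supp_hSeg h))))]

variable [IsStrictOrderedRing Z] {n : Z}

/-- The frame meets the square only at (0, n) and (n, 0), which lie on G and hence not on H. The
added edges of `prolong` meet it only at (0, 0) and (n, n), which lie on H and hence not on G.
Outside the square the two sets of additions are disjoint. -/
theorem disjoint_frame_prolong {G H : Z × Z → Z × Z → Prop} (hn : 0 < n) (hG : InBox n G)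
    (hH : InBox n H) (hpG : IsPath G (0, n) (n, 0)) (hpH : IsPath H (0, 0) (n, n))
    (hd : ∀ p, Supp G p → ¬ Supp H p) (p : Z × Z) (h : Supp (union G (frame n)) p) :
    ¬ Supp (prolong n H) p := by
  obtain ⟨x, y⟩ := p
  intro h'
  have h1 := hd _ hpG.left.supp
  have h2 := hd _ hpG.right.supp
  have h3 : ¬ Supp G (0, 0) := fun h => hd _ h hpH.left.supp
  have h4 : ¬ Supp G (n, n) := fun h => hd _ h hpH.right.supp
  rcases supp_union.1 h with h | h
  · have hb := hG _ h
    rcases supp_prolong h' with h' | h' | h' | h' | h'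
    · exact hd _ h h'
    · exact h3 (by convert h <;> grind)
    · exact h4 (by convert h <;> grind)
    · dsimp at *; linarith
    · dsimp at *; linarith
  · have hf := supp_frame h
    rcases supp_prolong h' with h' | h' | h' | h' | h'
    · have hb := hH _ h'
      dsimp at hb
      rcases hf with h | h | h | h
      · exact h1 (by convert h' <;> linarith)
      · linarith
      · linarith
      · exact h2 (by convert h' <;> linarith)
    all_goals rcases hf with h | h | h | h <;> linarith

variable [DiscreteRing Z]

theorem isPath_frame (hn : 0 < n) : IsPath (frame n) (0, n) (n, 0) := by
  have h1 : IsPath (hSeg (-2) 0 n) (0, n) (-2, n) := (isPath_hSeg (by norm_num) n).reverse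
  have h2 : IsPath (vSeg (-2) n (-2)) (-2, n) (-2, -2) := (isPath_vSeg (by linarith) _).reverse
  have h3 : IsPath (hSeg (-2) n (-2)) (-2, -2) (n, -2) := isPath_hSeg (by linarith) _
  have h4 : IsPath (vSeg (-2) 0 n) (n, -2) (n, 0) := isPath_vSeg (by norm_num) _
  refine ((h1.trans h2 ?_ ?_).trans h3 ?_ ?_).trans h4 ?_ ?_
  · intro h; have := congrArg Prod.fst h; dsimp at this; linarith
  · rintro ⟨x, y⟩ h h'
    have := supp_hSeg h
    have := supp_vSeg h'
    exact Prod.ext (by grind) (by grind)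
  · intro h; have := congrArg Prod.fst h; dsimp at this; linarith
  · rintro ⟨x, y⟩ h h'
    have := supp_hSeg h'
    rcases supp_union.1 h with h | h
    · have := supp_hSeg h
      dsimp at *
      linarith
    · have := supp_vSeg h
      exact Prod.ext (by grind) (by grind)
  · intro h; have := congrArg Prod.fst h; dsimp at this; linarith
  · rintro ⟨x, y⟩ h h'
    have := supp_vSeg h'
    rcases supp_union.1 h with h | h
    · rcases supp_union.1 h with h | h
      · have := supp_hSeg h
        dsimp at *
        linarith
      · have := supp_vSeg h
        dsimp at *
        linarith
    · have := supp_hSeg h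
      exact Prod.ext (by grind) (by grind)

theorem isCycle_frame {G : Z × Z → Z × Z → Prop} (hn : 0 < n) (hbox : InBox n G)
    (hG : IsPath G (0, n) (n, 0)) : IsCycle (union G (frame n)) := by
  refine hG.isCycle_union (isPath_frame hn) ?_ ?_
  · simp only [frame, union, hSeg, vSeg]
    rintro (((h | h) | h) | h) <;> linarith
  · rintro ⟨x, y⟩ h h'
    have := hbox _ h
    dsimp at this
    rcases supp_frame h' with h | h | h | h
    · exact .inl (Prod.ext (by grind) (by grind))
    · linarith
    · linarith
    · exact .inr (Prod.ext (by grind) (by grind))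

theorem isPath_prolong {G : Z × Z → Z × Z → Prop} (hn : 0 < n) (hbox : InBox n G)
    (hG : IsPath G (0, 0) (n, n)) : IsPath (prolong n G) (0, -1) (0, -3) := by
  have h1 : IsPath (vSeg (-1) 0 0) ((0, -1) : Z × Z) (0, 0) := isPath_vSeg (by norm_num) _
  have h2 : IsPath (hSeg n (n + 1) n) (n, n) (n + 1, n) := isPath_hSeg (by linarith) _
  have h3 : IsPath (vSeg (-3) n (n + 1)) (n + 1, n) (n + 1, -3) :=
    (isPath_vSeg (by linarith) _).reverse
  have h4 : IsPath (hSeg 0 (n + 1) (-3)) (n + 1, -3) (0, -3) :=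
    (isPath_hSeg (by linarith) _).reverse
  refine (((h1.trans hG ?_ ?_).trans h2 ?_ ?_).trans h3 ?_ ?_).trans h4 ?_ ?_
  · intro h; have := congrArg Prod.fst h; dsimp at this; linarith
  · rintro ⟨x, y⟩ h h'
    have := supp_vSeg h
    have := hbox _ h'
    exact Prod.ext (by grind) (by grind)
  · intro h; have := congrArg Prod.fst h; dsimp at this; linarith
  · rintro ⟨x, y⟩ h h'
    have := supp_hSeg h'
    rcases supp_union.1 h with h | h
    · have := supp_vSeg h
      dsimp at *
      linarith
    · have := hbox _ h
      exact Prod.ext (by grind) (by grind)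
  · intro h; have := congrArg Prod.fst h; dsimp at this; linarith
  · rintro ⟨x, y⟩ h h'
    have := supp_vSeg h'
    rcases supp_union.1 h with h | h
    · rcases supp_union.1 h with h | h
      · have := supp_vSeg h
        dsimp at *
        linarith
      · have := hbox _ h
        dsimp at *
        linarith
    · have := supp_hSeg h
      exact Prod.ext (by grind) (by grind)
  · intro h; have := congrArg Prod.snd h; dsimp at this; linarith
  · rintro ⟨x, y⟩ h h'
    have := supp_hSeg h'
    rcases supp_union.1 h with h | h
    · rcases supp_union.1 h with h | h
      · rcases supp_union.1 h with h | h
        · have := supp_vSeg h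
          dsimp at *
          linarith
        · have := hbox _ h
          dsimp at *
          linarith
      · have := supp_hSeg h
        dsimp at *
        linarith
    · have := supp_vSeg h
      exact Prod.ext (by grind) (by grind)

/-- In column 0 the closed curve has just one point with negative second coordinate, namely (0, -2).
-/
theorem differentSides_frame {G : Z × Z → Z × Z → Prop} (hn : 0 < n) (hG : InBox n G)
    (hpG : IsPath G (0, n) (n, 0)) :
    TwoSorted.DifferentSides (union G (frame n)) (0, -1) (0, -3) := by
  have key (y : Z) (hy : y ≠ n) (hy' : y ≠ -2) (hy0 : y < 0) :
      ¬ Supp (union G (frame n)) (0, y) := by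
    intro h
    rcases supp_union.1 h with h | h
    · have := hG _ h
      dsimp at this
      linarith
    · rcases supp_frame h with h | h | h | h
      · exact hy h.1
      · linarith
      · exact hy' h.1
      · linarith
  refine ⟨rfl, .inr (by norm_num), key _ (by linarith) (by norm_num) (by norm_num),
    key _ (by linarith) (by norm_num) (by norm_num), -2, by norm_num,
    (isCycle_frame hn hG hpG).degTwo (supp_union.2 (.inr ?_))⟩
  -- The right neighbour of (0, -2) is on the bottom side of the frame because n is at least 1.
  refine ⟨(1, -2), .inl (.inr ⟨.inl (by norm_num), rfl, rfl, ?_⟩)⟩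
  have := DiscreteRing.add_one_le hn
  refine ⟨by norm_num, by simpa using hn.le, by norm_num, ?_⟩
  dsimp; linarith

end

/-- Translation by `-c` in both directions. -/
def shift {Z : Type*} [CommRing Z] (c : Z) : Z × Z ≃ Z × Z where
  toFun p := (p.1 - c, p.2 - c)
  invFun p := (p.1 + c, p.2 + c)
  left_inv p := by simp
  right_inv p := by simp

end EdgeRel

/-! ### From the Jordan curve sentence to st-connectivity -/

namespace TwoSorted

open EdgeRel DifferenceRing

variable {M : Structure} [VZeroModel M]

theorem IsEdgeSet.inBox (n : M.Num) (E : M.Str) : InBox (of _ n) (edgeRel n E) := by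
  intro p hp
  obtain ⟨a, ha, b, hb, rfl⟩ := exists_of_supp hp
  have h (x : M.Num) : 0 ≤ of M.Num x := by
    rw [← map_zero (of M.Num), of_le_of]; exact VZeroModel.zero_le' _
  exact ⟨⟨h a, of_le_of.2 ha⟩, h b, of_le_of.2 hb⟩

/-- A definable set of edges of a translate of the grid is the edge relation of a string. -/
theorem exists_edgeRel_shift {prm : ℕ → M.Num} {B : M.Str} (c : M.IntRing)
    {G : M.IntRing × M.IntRing → M.IntRing × M.IntRing → Prop}
    (hG : IsDef prm B fun w : Fin 4 → M.Num =>
      G (of _ (w 0) - c, of _ (w 1) - c) (of _ (w 2) - c, of _ (w 3) - c))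
    (hsymm : ∀ p q, G p q → G q p) (hadj : ∀ p q, G p q → Adj p q)
    (hbox : ∀ p, Supp G p →
      (-c ≤ p.1 ∧ p.1 ≤ of _ (prm 0) - c) ∧ -c ≤ p.2 ∧ p.2 ≤ of _ (prm 0) - c) :
    ∃ E, IsEdgeSet (prm 0) E ∧ edgeRel (prm 0) E = fun p q => G (shift c p) (shift c q) := by
  refine exists_edgeRel_eq hG (fun _ _ => hsymm _ _) (fun p q h => ?_) fun p hp => ?_
  · have := hadj _ _ h
    simp only [Adj, shift, Equiv.coe_fn_mk] at this ⊢
    grind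
  · have := hbox _ ((supp_comap (shift c)).1 hp)
    simp only [shift, Equiv.coe_fn_mk] at this
    grind

variable {prm : ℕ → M.Num} {B : M.Str} {k : ℕ}

theorem IsDef.frame {n f₁ f₂ f₃ f₄ : (Fin k → M.Num) → M.IntRing} (hn : IsTerm prm n)
    (h₁ : IsTerm prm f₁) (h₂ : IsTerm prm f₂) (h₃ : IsTerm prm f₃) (h₄ : IsTerm prm f₄) :
    IsDef prm B fun w => frame (n w) (f₁ w, f₂ w) (f₃ w, f₄ w) :=
  have m2 := IsTerm.neg (IsTerm.ofNat (prm := prm) (k := k) 2)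
  .or (.or (.or (.hSeg m2 .zero hn h₁ h₂ h₃ h₄) (.vSeg m2 hn m2 h₁ h₂ h₃ h₄))
    (.hSeg m2 hn m2 h₁ h₂ h₃ h₄)) (.vSeg m2 .zero hn h₁ h₂ h₃ h₄)

theorem IsDef.prolong {n f₁ f₂ f₃ f₄ : (Fin k → M.Num) → M.IntRing}
    {G : M.IntRing × M.IntRing → M.IntRing × M.IntRing → Prop} (hn : IsTerm prm n)
    (h₁ : IsTerm prm f₁) (h₂ : IsTerm prm f₂) (h₃ : IsTerm prm f₃) (h₄ : IsTerm prm f₄)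
    (hG : IsDef prm B fun w => G (f₁ w, f₂ w) (f₃ w, f₄ w)) :
    IsDef prm B fun w => prolong (n w) G (f₁ w, f₂ w) (f₃ w, f₄ w) :=
  have m1 := IsTerm.neg (IsTerm.one (prm := prm) (k := k))
  have m3 := IsTerm.neg (IsTerm.ofNat (prm := prm) (k := k) 3)
  have n1 := hn.add .one
  .or (.or (.or (.or (.vSeg m1 .zero .zero h₁ h₂ h₃ h₄) hG) (.hSeg hn n1 hn h₁ h₂ h₃ h₄))
    (.vSeg m3 hn n1 h₁ h₂ h₃ h₄)) (.hSeg .zero n1 m3 h₁ h₂ h₃ h₄)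

theorem stConnectivity_of_jordanCurve (v : ℕ → M.Num) (V : ℕ → M.Str)
    (hJ : jordanCurveSentence.Holds M v V) : stConnectivitySentence.Holds M v V := by
  rw [holds_jordanCurveSentence] at hJ
  rw [holds_stConnectivitySentence]
  intro n B R hB hR hpB hpR
  by_contra hcon
  push Not at hcon
  have hn : (0 : M.IntRing) < of _ n := by
    rw [← map_zero (of M.Num), of_lt_of]
    refine lt_of_le_of_ne (VZeroModel.zero_le' _) ?_
    rintro rfl
    exact hpB.ne rfl
  simp only [point, map_zero] at hpB hpR
  -- All coordinates lie between -3 and n + 1, so the shift by 3 puts the picture into the grid of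
  -- side n + 4; the points (0, -1) and (0, -3) become (3, 2) and (3, 0).
  let prm : ℕ → M.Num := fun | 0 => n + 4 | _ => n
  have hN : of M.Num (prm 0) = of _ n + 4 := by simp [prm, map_ofNat]
  have tn {k : ℕ} : IsTerm prm fun _ : Fin k → M.Num => of _ n :=
    IsTerm.param (i := 1) (by norm_num)
  have tx (i : Fin 4) : IsTerm prm fun w : Fin 4 → M.Num => of _ (w i) - 3 :=
    .sub (.var i) (.ofNat 3)
  have boxB := IsEdgeSet.inBox n B
  have boxR := IsEdgeSet.inBox n R
  obtain ⟨B', hB', eB⟩ := exists_edgeRel_shift (prm := prm) (B := B) 3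
    (G := union (edgeRel n B) (frame (of _ n)))
    (.or (.edgeRel (i := 1) (by norm_num) (tx 0) (tx 1) (tx 2) (tx 3))
      (.frame tn (tx 0) (tx 1) (tx 2) (tx 3)))
    (isCycle_frame hn boxB hpB).symm
    (by
      rintro p q (h | ((h | h) | h) | h)
      exacts [hB.adj h, hSeg_adj h, vSeg_adj h, hSeg_adj h, vSeg_adj h])
    (by
      rintro ⟨x, y⟩ h
      rw [hN]
      rcases supp_union.1 h with h | h
      · have := boxB _ h
        grind
      · have := supp_frame h
        grind)
  obtain ⟨R', hR', eR⟩ := exists_edgeRel_shift (prm := prm) (B := R) 3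
    (G := prolong (of _ n) (edgeRel n R))
    (.prolong tn (tx 0) (tx 1) (tx 2) (tx 3)
      (.edgeRel (i := 1) (by norm_num) (tx 0) (tx 1) (tx 2) (tx 3)))
    (isPath_prolong hn boxR hpR).symm
    (by
      rintro p q ((((h | h) | h) | h) | h)
      exacts [vSeg_adj h, hR.adj h, hSeg_adj h, vSeg_adj h, hSeg_adj h])
    (by
      rintro ⟨x, y⟩ h
      rw [hN]
      rcases supp_prolong h with h | h
      · have := boxR _ h
        grind
      · grind)
  have le_four {x : M.Num} (hx : x ≤ 4) : x ≤ n + 4 :=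
    hx.trans (by rw [add_comm]; exact VZeroModel.le_add _ _)
  have e1 : shift (3 : M.IntRing) (point 3 2) = (0, -1) := by
    simp [shift, point, map_ofNat]; norm_num
  have e2 : shift (3 : M.IntRing) (point 3 0) = (0, -3) := by
    simp [shift, point, map_ofNat]
  obtain ⟨p, hp, hp'⟩ := hJ (prm 0) B' R' 3 (le_four (by norm_num)) 2 (le_four (by norm_num))
    3 (le_four (by norm_num)) 0 (VZeroModel.zero_le' _) hB' hR'
    (eB ▸ (isCycle_frame hn boxB hpB).comap (shift 3))
    (by
      obtain ⟨h1, h2, h3, h4, y, h5, h6⟩ := differentSides_frame hn boxB hpB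
      rw [← e1] at h3
      rw [← e2] at h4
      rw [eB]
      refine ⟨rfl, .inr ?_, fun h => h3 ((supp_comap _).1 h), fun h => h4 ((supp_comap _).1 h), 1,
        ?_, ?_⟩
      · simp [point, map_ofNat]
      · simp [point, map_ofNat]
      · rw [degTwo_comap]
        have e3 : shift (3 : M.IntRing) ((point 3 2).1, 1) = (0, y) := by
          dsimp at h5
          simp only [shift, point, Equiv.coe_fn_mk, map_ofNat]
          exact Prod.ext (by norm_num) (by linarith)
        rwa [e3])
    (eR ▸ IsPath.comap (shift 3) (by
      rw [e1, e2]
      exact isPath_prolong hn boxR hpR))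
  rw [eB] at hp
  rw [eR] at hp'
  exact disjoint_frame_prolong hn boxB boxR hpB hpR hcon _ ((supp_comap _).1 hp)
    ((supp_comap _).1 hp')

end TwoSorted

/-! ### Cutting the grid and exchanging the half planes -/

namespace EdgeRel

section

variable {P : Type*}

theorem isPath_single {p q : P} (h : p ≠ q) :
    IsPath (fun x y => x = p ∧ y = q ∨ x = q ∧ y = p) p q where
  symm x y := by tauto
  irrefl x := by rintro (⟨rfl, h'⟩ | ⟨rfl, h'⟩); exacts [h h', h h'.symm]
  ne := h
  left := ⟨q, .inl ⟨rfl, rfl⟩, fun r hr => by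
    rcases hr with hr | hr
    exacts [hr.2, absurd hr.1 h]⟩
  right := ⟨p, .inr ⟨rfl, rfl⟩, fun r hr => by
    rcases hr with hr | hr
    exacts [absurd hr.1.symm h, hr.2]⟩
  inner r hp hq := .inl (by
    rintro ⟨s, hs | hs⟩
    exacts [hp hs.1, hq hs.1])

/-- Deleting a possible first edge moves the end from p to q if the edge is present and changes
nothing if it is not, so a path remains in either case. -/
theorem IsPath.exists_isPath_erase {G : P → P → Prop} {p q r : P} (h : IsPath G p r)
    (hqr : q ≠ r) : ∃ e, (e = p ∨ e = q) ∧ IsPath (erase G p q) e r := by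
  by_cases hpq : G p q
  · exact ⟨q, .inr rfl, h.isPath_erase hpq hqr⟩
  · refine ⟨p, .inl rfl, ?_⟩
    convert h using 1
    funext x y
    refine propext ⟨fun h => h.1, fun hxy => ⟨hxy, ?_, ?_⟩⟩
    · rintro ⟨rfl, rfl⟩; exact hpq hxy
    · rintro ⟨rfl, rfl⟩; exact hpq (h.symm _ _ hxy)

end

variable {Z : Type*} [CommRing Z]

/-- The edge between `p` and `q` joins the columns `a` and `a + 1`. -/
def Crosses (a : Z) (p q : Z × Z) : Prop :=
  p.2 = q.2 ∧ (p.1 = a ∧ q.1 = a + 1 ∨ q.1 = a ∧ p.1 = a + 1)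

theorem Crosses.symm {a : Z} {p q : Z × Z} (h : Crosses a p q) : Crosses a q p :=
  ⟨h.1.symm, h.2.symm⟩

variable [LinearOrder Z]

/-- The arc from `(K, k)` to `(-K, k)` along the upper half of the boundary of the square with
half side `2 * K - k`. -/
def arc (K k : Z) : Z × Z → Z × Z → Prop :=
  union (union (union (union (hSeg K (2 * K - k) k) (vSeg k (2 * K - k) (2 * K - k)))
    (hSeg (-(2 * K - k)) (2 * K - k) (2 * K - k))) (vSeg k (2 * K - k) (-(2 * K - k))))
    (hSeg (-(2 * K - k)) (-K) k)

/-- The mirror image of an arc. -/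
def arcDown (K k : Z) (p q : Z × Z) : Prop := arc K k (p.1, -p.2) (q.1, -q.2)

theorem supp_arc {K k x y : Z} (h : Supp (arc K k) (x, y)) :
    (y = k ∧ K ≤ x ∧ x ≤ 2 * K - k) ∨ (x = 2 * K - k ∧ k ≤ y ∧ y ≤ 2 * K - k) ∨
    (y = 2 * K - k ∧ -(2 * K - k) ≤ x ∧ x ≤ 2 * K - k) ∨
    (x = -(2 * K - k) ∧ k ≤ y ∧ y ≤ 2 * K - k) ∨ (y = k ∧ -(2 * K - k) ≤ x ∧ x ≤ -K) := by
  simp only [arc, supp_union] at h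
  rcases h with (((h | h) | h) | h) | h
  exacts [.inl (supp_hSeg h), .inr (.inl (supp_vSeg h)), .inr (.inr (.inl (supp_hSeg h))),
    .inr (.inr (.inr (.inl (supp_vSeg h)))), .inr (.inr (.inr (.inr (supp_hSeg h))))]

theorem supp_arcDown {K k x y : Z} (h : Supp (arcDown K k) (x, y)) : Supp (arc K k) (x, -y) :=
  h.elim fun _ h => ⟨_, h⟩

theorem arc_adj {K k : Z} {p q : Z × Z} (h : arc K k p q) : Adj p q := by
  rcases h with (((h | h) | h) | h) | h
  exacts [hSeg_adj h, vSeg_adj h, hSeg_adj h, vSeg_adj h, hSeg_adj h]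

/-- The two halves of the plane on the left and on the right of the line between the columns `a` and
`a + 1` change places. -/
def swap (K a b : Z) (p : Z × Z) : Z × Z :=
  if p.1 ≤ a then (p.1 - a + K, p.2 - b) else (p.1 - a - 1 - K, p.2 - b)

theorem swap_left {K a b x y : Z} (h : x ≤ a) : swap K a b (x, y) = (x - a + K, y - b) := if_pos h

theorem swap_right {K a b x y : Z} (h : a < x) : swap K a b (x, y) = (x - a - 1 - K, y - b) :=
  if_neg (not_le.2 h)

/-- Edges within a half plane move with it, and those between the two halves become arcs. -/
def swapEdge (K a b : Z) (p q x y : Z × Z) : Prop :=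
  ¬ Crosses a p q ∧ (x = swap K a b p ∧ y = swap K a b q ∨ x = swap K a b q ∧ y = swap K a b p) ∨
  Crosses a p q ∧ b + 1 ≤ p.2 ∧ arc K (p.2 - b) x y ∨
  Crosses a p q ∧ p.2 + 1 ≤ b ∧ arcDown K (b - p.2) x y

/-- The edges of the grid of side `n` other than the three edges between the columns `a` and `a + 1`
in the rows `b - 1`, `b` and `b + 1`. -/
def cutGrid (n a b : Z) (p q : Z × Z) : Prop :=
  Adj p q ∧ ((0 ≤ p.1 ∧ p.1 ≤ n) ∧ 0 ≤ p.2 ∧ p.2 ≤ n) ∧ ((0 ≤ q.1 ∧ q.1 ≤ n) ∧ 0 ≤ q.2 ∧ q.2 ≤ n) ∧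
    (Crosses a p q → b + 2 ≤ p.2 ∨ p.2 + 2 ≤ b)

theorem cutGrid_symm {n a b : Z} {p q : Z × Z} (h : cutGrid n a b p q) : cutGrid n a b q p :=
  ⟨h.1.symm, h.2.2.1, h.2.1, fun h' => h'.1 ▸ h.2.2.2 h'.symm⟩

theorem supp_cutGrid {n a b : Z} {p : Z × Z} (h : Supp (cutGrid n a b) p) :
    (0 ≤ p.1 ∧ p.1 ≤ n) ∧ 0 ≤ p.2 ∧ p.2 ≤ n := h.elim fun _ h => h.2.1

variable [IsStrictOrderedRing Z]

/-- The arcs are nested: the one with the higher feet runs along the smaller square. -/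
theorem arc_disjoint {K k l x y : Z} (hk : 0 < k) (hkl : k < l) (hl : l < K)
    (h : Supp (arc K k) (x, y)) : ¬ Supp (arc K l) (x, y) := by
  intro h'
  rcases supp_arc h with h | h | h | h | h <;> rcases supp_arc h' with h' | h' | h' | h' | h' <;>
    linarith

theorem arc_inj {K k l x y : Z} (hk : 0 < k) (hl : 0 < l) (hkK : k < K) (hlK : l < K)
    (h : Supp (arc K k) (x, y)) (h' : Supp (arc K l) (x, y)) : k = l := by
  rcases lt_trichotomy k l with hkl | hkl | hkl
  · exact absurd h' (arc_disjoint hk hkl hlK h)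
  · exact hkl
  · exact absurd h (arc_disjoint hl hkl hkK h')

/-- Within a half plane the map is a translation. Points of different halves with the same image
would have first coordinates 2K + 1 apart, which is more than n. -/
theorem swap_inj {K n a b : Z} (hK : K = n + 1) (hn : 0 < n) {p q : Z × Z}
    (hp : 0 ≤ p.1 ∧ p.1 ≤ n)
    (hq : 0 ≤ q.1 ∧ q.1 ≤ n) (h : swap K a b p = swap K a b q) : p = q := by
  obtain ⟨p1, p2⟩ := p
  obtain ⟨q1, q2⟩ := q
  dsimp at *
  rcases le_or_gt p1 a with hp' | hp' <;> rcases le_or_gt q1 a with hq' | hq' <;>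
    simp only [swap_left, swap_right, hp', hq', Prod.mk.injEq] at h <;> obtain ⟨h1, h2⟩ := h
  · exact Prod.ext (by dsimp; linarith) (by dsimp; linarith)
  · linarith
  · linarith
  · exact Prod.ext (by dsimp; linarith) (by dsimp; linarith)

theorem swap_crosses {K a b : Z} {p q : Z × Z} (h : Crosses a p q) :
    swap K a b p = (K, p.2 - b) ∧ swap K a b q = (-K, p.2 - b) ∨
    swap K a b p = (-K, p.2 - b) ∧ swap K a b q = (K, p.2 - b) := by
  obtain ⟨p1, p2⟩ := p
  obtain ⟨q1, q2⟩ := q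
  obtain ⟨h, h'⟩ := h
  dsimp at h h'
  subst h
  rcases h' with ⟨rfl, rfl⟩ | ⟨rfl, rfl⟩
  · left
    rw [swap_left le_rfl, swap_right (lt_add_one _)]
    constructor <;> ext <;> simp
  · right
    rw [swap_left le_rfl, swap_right (lt_add_one _)]
    constructor <;> ext <;> simp

variable [DiscreteRing Z]

/-- The image of a point of the grid lies on an arc only at the ends of the arc. -/
theorem swap_mem_arc {K n a b k : Z} (hK : K = n + 1) {p : Z × Z} (ha : 0 ≤ a) (ha' : a ≤ n)
    (hb : 0 ≤ b) (hp : (0 ≤ p.1 ∧ p.1 ≤ n) ∧ 0 ≤ p.2 ∧ p.2 ≤ n) (hk : k < K)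
    (h : Supp (arc K k) (swap K a b p)) : p.2 = b + k ∧ (p.1 = a ∨ p.1 = a + 1) := by
  obtain ⟨x, y⟩ := p
  dsimp at *
  rcases le_or_gt x a with hx | hx
  · rw [swap_left hx] at h
    rcases supp_arc h with h | h | h | h | h
    · exact ⟨by linarith, .inl (by linarith)⟩
    all_goals linarith
  · have := DiscreteRing.add_one_le hx
    rw [swap_right hx] at h
    rcases supp_arc h with h | h | h | h | h
    · linarith
    · linarith
    · linarith
    · linarith
    · exact ⟨by linarith, .inr (by linarith)⟩

theorem swap_mem_arcDown {K n a b k : Z} (hK : K = n + 1) {p : Z × Z} (ha : 0 ≤ a) (ha' : a ≤ n)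
    (hb : b ≤ n) (hp : (0 ≤ p.1 ∧ p.1 ≤ n) ∧ 0 ≤ p.2 ∧ p.2 ≤ n) (hk : k < K)
    (h : Supp (arcDown K k) (swap K a b p)) : p.2 = b - k ∧ (p.1 = a ∨ p.1 = a + 1) := by
  obtain ⟨x, y⟩ := p
  dsimp at *
  rcases le_or_gt x a with hx | hx
  · rw [swap_left hx] at h
    rcases supp_arc (supp_arcDown h) with h | h | h | h | h
    · exact ⟨by linarith, .inl (by linarith)⟩
    all_goals linarith
  · have := DiscreteRing.add_one_le hx
    rw [swap_right hx] at h
    rcases supp_arc (supp_arcDown h) with h | h | h | h | h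
    · linarith
    · linarith
    · linarith
    · linarith
    · exact ⟨by linarith, .inr (by linarith)⟩


theorem isPath_arc {K k : Z} (hk : 0 < k) (hkK : k < K) : IsPath (arc K k) (K, k) (-K, k) := by
  have h1 : IsPath (hSeg K (2 * K - k) k) (K, k) (2 * K - k, k) := isPath_hSeg (by linarith) _
  have h2 : IsPath (vSeg k (2 * K - k) (2 * K - k)) (2 * K - k, k) (2 * K - k, 2 * K - k) :=
    isPath_vSeg (by linarith) _
  have h3 : IsPath (hSeg (-(2 * K - k)) (2 * K - k) (2 * K - k)) (2 * K - k, 2 * K - k)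
    (-(2 * K - k), 2 * K - k) := (isPath_hSeg (by linarith) _).reverse
  have h4 : IsPath (vSeg k (2 * K - k) (-(2 * K - k))) (-(2 * K - k), 2 * K - k)
    (-(2 * K - k), k) := (isPath_vSeg (by linarith) _).reverse
  have h5 : IsPath (hSeg (-(2 * K - k)) (-K) k) (-(2 * K - k), k) (-K, k) :=
    isPath_hSeg (by linarith) _
  refine (((h1.trans h2 ?_ ?_).trans h3 ?_ ?_).trans h4 ?_ ?_).trans h5 ?_ ?_
  · intro h; have := congrArg Prod.fst h; dsimp at this; linarith
  · rintro ⟨x, y⟩ h h'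
    have := supp_hSeg h
    have := supp_vSeg h'
    exact Prod.ext (by grind) (by grind)
  · intro h; have := congrArg Prod.fst h; dsimp at this; linarith
  · rintro ⟨x, y⟩ h h'
    have := supp_hSeg h'
    rcases supp_union.1 h with h | h
    · have := supp_hSeg h
      dsimp at *
      linarith
    · have := supp_vSeg h
      exact Prod.ext (by grind) (by grind)
  · intro h; have := congrArg Prod.fst h; dsimp at this; linarith
  · rintro ⟨x, y⟩ h h'
    have := supp_vSeg h'
    rcases supp_union.1 h with h | h
    · rcases supp_union.1 h with h | h
      · have := supp_hSeg h
        dsimp at *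
        linarith
      · have := supp_vSeg h
        dsimp at *
        linarith
    · have := supp_hSeg h
      exact Prod.ext (by grind) (by grind)
  · intro h; have := congrArg Prod.fst h; dsimp at this; linarith
  · rintro ⟨x, y⟩ h h'
    have := supp_hSeg h'
    rcases supp_union.1 h with h | h
    · rcases supp_union.1 h with h | h
      · rcases supp_union.1 h with h | h
        · have := supp_hSeg h
          dsimp at *
          linarith
        · have := supp_vSeg h
          dsimp at *
          linarith
      · have := supp_hSeg h
        dsimp at *
        linarith
    · have := supp_vSeg h
      exact Prod.ext (by grind) (by grind)

/-- Reflection in the horizontal axis. -/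
def mirror : Z × Z ≃ Z × Z where
  toFun p := (p.1, -p.2)
  invFun p := (p.1, -p.2)
  left_inv p := by simp
  right_inv p := by simp

theorem isPath_arcDown {K k : Z} (hk : 0 < k) (hkK : k < K) :
    IsPath (arcDown K k) (K, -k) (-K, -k) :=
  IsPath.comap mirror (G := arc K k) (p := (K, -k)) (q := (-K, -k)) (by
    simpa [mirror] using isPath_arc hk hkK)

/-- The swapped grid stays in the columns from -K to K and in rows of absolute value below K, while
arcs leave this region at once from their feet; hence arcs meet drawn vertices only at their ends.
Distinct arcs are disjoint by nesting, or because they lie on opposite sides of row 0. -/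
theorem isDrawing_swap {K n a b : Z} (hK : K = n + 1) (ha : 0 ≤ a) (ha' : a + 1 ≤ n)
    (hb : 0 ≤ b) (hb' : b ≤ n) : IsDrawing (cutGrid n a b) (swap K a b) (swapEdge K a b) where
  path {p q} h := by
    obtain ⟨hadj, hp, hq, hc⟩ := h
    by_cases hpq : Crosses a p q
    · rcases hc hpq with h | h
      · have e : swapEdge K a b p q = arc K (p.2 - b) := by
          funext x y
          have : b + 1 ≤ p.2 := by linarith
          have : ¬ p.2 + 1 ≤ b := by linarith
          simp [swapEdge, *]
        have := isPath_arc (K := K) (k := p.2 - b) (by linarith) (by linarith)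
        rw [e]
        rcases swap_crosses (K := K) (b := b) hpq with ⟨h1, h2⟩ | ⟨h1, h2⟩ <;> rw [h1, h2]
        exacts [this, this.reverse]
      · have e : swapEdge K a b p q = arcDown K (b - p.2) := by
          funext x y
          have : ¬ b + 1 ≤ p.2 := by linarith
          have : p.2 + 1 ≤ b := by linarith
          simp [swapEdge, *]
        have := isPath_arcDown (K := K) (k := b - p.2) (by linarith) (by linarith)
        rw [neg_sub] at this
        rw [e]
        rcases swap_crosses (K := K) (b := b) hpq with ⟨h1, h2⟩ | ⟨h1, h2⟩ <;> rw [h1, h2]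
        exacts [this, this.reverse]
    · have e : swapEdge K a b p q = fun x y => x = swap K a b p ∧ y = swap K a b q ∨
          x = swap K a b q ∧ y = swap K a b p := by
        funext x y
        simp [swapEdge, hpq]
      rw [e]
      exact isPath_single fun h => hadj.ne (swap_inj hK (by linarith) hp.1 hq.1 h)
  symm {p q x y} h hw := by
    rcases hw with ⟨h1, h2⟩ | ⟨h1, h2⟩ | ⟨h1, h2⟩
    · exact .inl ⟨fun h => h1 h.symm, h2.symm⟩
    · exact .inr (.inl ⟨h1.symm, h1.1 ▸ h2⟩)
    · exact .inr (.inr ⟨h1.symm, h1.1 ▸ h2⟩)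
  vertex {p q r} hr h := by
    obtain ⟨hadj, hp, hq, hc⟩ := h
    have hr' := supp_cutGrid hr
    have key (h1 : Crosses a p q) (h2 : r.2 = p.2) (h3 : r.1 = a ∨ r.1 = a + 1) :
        r = p ∨ r = q := by
      obtain ⟨h4, h5⟩ := h1
      simp only [Prod.ext_iff]
      grind
    rintro ⟨y, ⟨h1, h2⟩ | ⟨h1, h2, h3⟩ | ⟨h1, h2, h3⟩⟩
    · have hn : 0 < n := by linarith
      exact h2.imp (fun h => swap_inj hK hn hr'.1 hp.1 h.1) (fun h => swap_inj hK hn hr'.1 hq.1 h.1)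
    · obtain ⟨h4, h5⟩ := swap_mem_arc hK ha (by linarith) hb hr' (by linarith) ⟨_, h3⟩
      exact key h1 (by linarith) h5
    · obtain ⟨h4, h5⟩ := swap_mem_arcDown hK ha (by linarith) hb' hr' (by linarith) ⟨_, h3⟩
      exact key h1 (by linarith) h5
  inner {p q p' q' x} h h' := by
    rintro ⟨y, hy⟩ ⟨z, hz⟩ hv
    have key (h1 : Crosses a p q) (h2 : Crosses a p' q') (h3 : p.2 = p'.2) :
        p = p' ∧ q = q' ∨ p = q' ∧ q = p' := by
      obtain ⟨h4, h5⟩ := h1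
      obtain ⟨h6, h7⟩ := h2
      simp only [Prod.ext_iff]
      grind
    have hp := h.2.1
    have hp' := h'.2.1
    have novertex {p q y : Z × Z} (h : cutGrid n a b p q)
        (hy : x = swap K a b p ∧ y = swap K a b q ∨ x = swap K a b q ∧ y = swap K a b p) :
        False := by
      rcases hy with hy | hy
      · exact hv p ⟨q, h⟩ hy.1
      · exact hv q ⟨p, cutGrid_symm h⟩ hy.1
    obtain ⟨x1, x2⟩ := x
    -- The signs of the rows separate the upper arcs from the lower ones.
    have pos {k : Z} (hk : 0 < k) (hkK : k < K) (h : Supp (arc K k) (x1, x2)) : 0 < x2 := by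
      rcases supp_arc h with h | h | h | h | h <;> linarith
    have neg {k : Z} (hk : 0 < k) (hkK : k < K) (h : Supp (arcDown K k) (x1, x2)) : x2 < 0 := by
      rcases supp_arc (supp_arcDown h) with h | h | h | h | h <;> linarith
    rcases hy with ⟨-, hy⟩ | ⟨h1, h2, hy⟩ | ⟨h1, h2, hy⟩
    · exact (novertex h hy).elim
    · rcases hz with ⟨-, hz⟩ | ⟨h3, h4, hz⟩ | ⟨h3, h4, hz⟩
      · exact (novertex h' hz).elim
      · have := arc_inj (by linarith) (by linarith) (by linarith) (by linarith) ⟨_, hy⟩ ⟨_, hz⟩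
        exact key h1 h3 (by linarith)
      · have := pos (by linarith) (by linarith) ⟨_, hy⟩
        have := neg (by linarith) (by linarith) ⟨_, hz⟩
        linarith
    · rcases hz with ⟨-, hz⟩ | ⟨h3, h4, hz⟩ | ⟨h3, h4, hz⟩
      · exact (novertex h' hz).elim
      · have := neg (by linarith) (by linarith) ⟨_, hy⟩
        have := pos (by linarith) (by linarith) ⟨_, hz⟩
        linarith
      · have := arc_inj (by linarith) (by linarith) (by linarith) (by linarith)
          (supp_arcDown ⟨_, hy⟩) (supp_arcDown ⟨_, hz⟩)
        exact key h1 h3 (by linarith)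

end EdgeRel

/-! ### Tails from the cut ends to the corners -/

namespace EdgeRel

variable {Z : Type*} [CommRing Z]

/-- Rotation by a half turn. -/
def rotate (G : Z × Z → Z × Z → Prop) (p q : Z × Z) : Prop := G (-p.1, -p.2) (-q.1, -q.2)

theorem supp_rotate {G : Z × Z → Z × Z → Prop} {x y : Z} (h : Supp (rotate G) (x, y)) :
    Supp G (-x, -y) := h.elim fun _ h => ⟨_, h⟩

theorem IsPath.rotate {G : Z × Z → Z × Z → Prop} {x y z w : Z} (h : IsPath G (x, y) (z, w)) :
    IsPath (rotate G) (-x, -y) (-z, -w) :=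
  IsPath.comap (Equiv.neg (Z × Z)) (p := (-x, -y)) (q := (-z, -w)) (by simpa using h)

variable [LinearOrder Z]

/-- The edges from `(K, c)` via `(N, c)` to `(N, N)`. -/
def shortTail (K N c : Z) : Z × Z → Z × Z → Prop := union (hSeg K N c) (vSeg c N N)

/-- The edges from `(-K, 1)` via `(1 - N, 1)` and `(1 - N, N)` to `(N, N)`. -/
def longTail (K N : Z) : Z × Z → Z × Z → Prop :=
  union (union (hSeg (1 - N) (-K) 1) (vSeg 1 N (1 - N))) (hSeg (1 - N) N N)

/-- The edges from `(K, 0)` via `(N, 0)` to `(N, -N)`. -/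
def downTail (K N : Z) : Z × Z → Z × Z → Prop := union (hSeg K N 0) (vSeg (-N) 0 N)

theorem supp_downTail {K N x y : Z} (h : Supp (downTail K N) (x, y)) :
    y = 0 ∧ K ≤ x ∧ x ≤ N ∨ x = N ∧ -N ≤ y ∧ y ≤ 0 := by
  simp only [downTail, supp_union] at h
  exact h.imp supp_hSeg supp_vSeg

theorem supp_shortTail {K N c x y : Z} (h : Supp (shortTail K N c) (x, y)) :
    y = c ∧ K ≤ x ∧ x ≤ N ∨ x = N ∧ c ≤ y ∧ y ≤ N := by
  simp only [shortTail, supp_union] at h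
  exact h.imp supp_hSeg supp_vSeg

theorem supp_longTail {K N x y : Z} (h : Supp (longTail K N) (x, y)) :
    y = 1 ∧ 1 - N ≤ x ∧ x ≤ -K ∨ x = 1 - N ∧ 1 ≤ y ∧ y ≤ N ∨ y = N ∧ 1 - N ≤ x ∧ x ≤ N := by
  simp only [longTail, supp_union] at h
  rcases h with (h | h) | h
  exacts [.inl (supp_hSeg h), .inr (.inl (supp_vSeg h)), .inr (.inr (supp_hSeg h))]

theorem downTail_adj {K N : Z} {p q : Z × Z} (h : downTail K N p q) : Adj p q :=
  h.elim hSeg_adj vSeg_adj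

theorem shortTail_adj {K N c : Z} {p q : Z × Z} (h : shortTail K N c p q) : Adj p q :=
  h.elim hSeg_adj vSeg_adj

theorem longTail_adj {K N : Z} {p q : Z × Z} (h : longTail K N p q) : Adj p q :=
  h.elim (fun h => h.elim hSeg_adj vSeg_adj) hSeg_adj

/-- `T` is one of the two tails that lead from the images of `(a, b + 1)` and `(a + 1, b + 1)` to
the corner `(N, N)`. -/
def IsTail (K N : Z) (T : Z × Z → Z × Z → Prop) : Prop := T = shortTail K N 1 ∨ T = longTail K N

variable {K N : Z} {G T : Z × Z → Z × Z → Prop}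

theorem IsTail.adj (hT : IsTail K N T) {p q : Z × Z} (h : T p q) : Adj p q := by
  rcases hT with rfl | rfl
  exacts [shortTail_adj h, longTail_adj h]

variable [IsStrictOrderedRing Z]

theorem rotate_adj (hG : ∀ {p q}, G p q → Adj p q) {p q : Z × Z} (h : rotate G p q) : Adj p q := by
  have := hG h
  simp only [Adj] at *
  grind

/-- The points outside the square of half side `K` that the arcs may meet. -/
def ArcRegion (K x y : Z) : Prop :=
  (2 ≤ y ∨ y ≤ -2) ∧ (-(2 * K - 2) ≤ y ∧ y ≤ 2 * K - 2) ∧ -(2 * K - 2) ≤ x ∧ x ≤ 2 * K - 2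

/-- The crossings that are not cut are at least two rows away from row b, so their arcs avoid rows
-1, 0, 1 and stay in the square of half side 2K - 2. This is the room used by the tails. -/
theorem supp_image_swapEdge {n a b x y : Z} (hK : K = n + 1) (hb : 0 ≤ b) (hb' : b ≤ n)
    (hG : ∀ p q, G p q → cutGrid n a b p q)
    (h : Supp (image (swapEdge K a b) G) (x, y)) :
    (∃ r, (∃ s, G r s ∨ G s r) ∧ (x, y) = swap K a b r) ∨ ArcRegion K x y := by
  obtain ⟨z, p, q, hpq, h⟩ := h
  have hT := hG _ _ hpq
  obtain ⟨hadj, hp, hq, hc⟩ := hT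
  rcases h with ⟨-, h | h⟩ | ⟨h1, h2, h3⟩ | ⟨h1, h2, h3⟩
  · exact .inl ⟨p, ⟨q, .inl hpq⟩, h.1⟩
  · exact .inl ⟨q, ⟨p, .inr hpq⟩, h.1⟩
  · right
    have hk : 2 ≤ p.2 - b := by
      rcases hc h1 with h | h <;> linarith
    rcases supp_arc ⟨_, h3⟩ with h | h | h | h | h <;>
      refine ⟨.inl ?_, ⟨?_, ?_⟩, ?_, ?_⟩ <;> linarith
  · right
    have hk : 2 ≤ b - p.2 := by
      rcases hc h1 with h | h <;> linarith
    rcases supp_arc (supp_arcDown ⟨_, h3⟩) with h | h | h | h | h <;>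
      refine ⟨.inr ?_, ⟨?_, ?_⟩, ?_, ?_⟩ <;> linarith

variable [DiscreteRing Z]

theorem isPath_downTail (hK : 0 < K) (hKN : K < N) : IsPath (downTail K N) (K, 0) (N, -N) := by
  have h1 : IsPath (hSeg K N 0) (K, 0) (N, 0) := isPath_hSeg (by linarith) _
  have h2 : IsPath (vSeg (-N) 0 N) (N, 0) (N, -N) := (isPath_vSeg (by linarith) _).reverse
  refine h1.trans h2 ?_ ?_
  · intro h; have := congrArg Prod.fst h; dsimp at this; linarith
  · rintro ⟨x, y⟩ h h'
    have := supp_hSeg h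
    have := supp_vSeg h'
    exact Prod.ext (by grind) (by grind)

theorem isPath_shortTail {c : Z} (hKN : K < N) (hc : c < N) :
    IsPath (shortTail K N c) (K, c) (N, N) := by
  have h1 : IsPath (hSeg K N c) (K, c) (N, c) := isPath_hSeg (by linarith) _
  have h2 : IsPath (vSeg c N N) (N, c) (N, N) := isPath_vSeg (by linarith) _
  refine h1.trans h2 ?_ ?_
  · intro h; have := congrArg Prod.fst h; dsimp at this; linarith
  · rintro ⟨x, y⟩ h h'
    have := supp_hSeg h
    have := supp_vSeg h'
    exact Prod.ext (by grind) (by grind)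

theorem isPath_longTail (hK : 0 < K) (hKN : K + 1 < N) :
    IsPath (longTail K N) (-K, 1) (N, N) := by
  have h1 : IsPath (hSeg (1 - N) (-K) 1) (-K, 1) (1 - N, 1) :=
    (isPath_hSeg (by linarith) _).reverse
  have h2 : IsPath (vSeg 1 N (1 - N)) (1 - N, 1) (1 - N, N) := isPath_vSeg (by linarith) _
  have h3 : IsPath (hSeg (1 - N) N N) (1 - N, N) (N, N) := isPath_hSeg (by linarith) _
  refine (h1.trans h2 ?_ ?_).trans h3 ?_ ?_
  · intro h; have := congrArg Prod.fst h; dsimp at this; linarith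
  · rintro ⟨x, y⟩ h h'
    have := supp_hSeg h
    have := supp_vSeg h'
    exact Prod.ext (by grind) (by grind)
  · intro h; have := congrArg Prod.fst h; dsimp at this; linarith
  · rintro ⟨x, y⟩ h h'
    have := supp_hSeg h'
    rcases supp_union.1 h with h | h
    · have := supp_hSeg h
      dsimp at *
      linarith
    · have := supp_vSeg h
      exact Prod.ext (by grind) (by grind)

/-- The region containing the tails from `(K, 1)` or `(-K, 1)` to `(N, N)`, without the starting
point. -/
def UpperRegion (K N x y : Z) : Prop :=
  (1 ≤ y ∧ y ≤ N) ∧ (1 - N ≤ x ∧ x ≤ N) ∧ (y = 1 ∧ (K < x ∨ x < -K) ∨ x = N ∨ x = 1 - N ∨ y = N)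

/-- On whichever side the end lies, there is a tail to the same corner. From the left it goes around
in column 1 - N, which leaves column -N free for the tail of the curve. -/
theorem exists_isTail (hK : 0 < K) (hKN : K + 1 < N) {s : Z × Z} (hs : s = (K, 1) ∨ s = (-K, 1)) :
    ∃ T, IsTail K N T ∧ IsPath T s (N, N) ∧
      ∀ x y, Supp T (x, y) → (x, y) = s ∨ UpperRegion K N x y := by
  rcases hs with rfl | rfl
  · refine ⟨_, .inl rfl, isPath_shortTail (by linarith) (by linarith), fun x y h => ?_⟩
    rw [Prod.ext_iff]
    have := supp_shortTail h
    unfold UpperRegion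
    grind
  · refine ⟨_, .inr rfl, isPath_longTail (by linarith) (by linarith), fun x y h => ?_⟩
    rw [Prod.ext_iff]
    have := supp_longTail h
    unfold UpperRegion
    grind

/-! ### The swapped edges -/

theorem swapEdge_adj {n a b : Z} {p q x y : Z × Z} (hpq : cutGrid n a b p q)
    (h : swapEdge K a b p q x y) : Adj x y := by
  have key {p q : Z × Z} (h : Adj p q) (h' : ¬ Crosses a p q) :
      Adj (swap K a b p) (swap K a b q) := by
    obtain ⟨p1, p2⟩ := p
    obtain ⟨q1, q2⟩ := q
    unfold Crosses at h'
    unfold Adj at h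
    dsimp at h h'
    rcases le_or_gt p1 a with hp | hp <;> rcases le_or_gt q1 a with hq | hq
    · rw [swap_left hp, swap_left hq]
      unfold Adj
      grind
    · have := DiscreteRing.add_one_le hq
      -- Adjacent points in different half planes form a crossing edge.
      exact absurd ⟨by grind, by grind⟩ h'
    · have := DiscreteRing.add_one_le hp
      exact absurd ⟨by grind, by grind⟩ h'
    · rw [swap_right hp, swap_right hq]
      unfold Adj
      grind
  rcases h with ⟨h, ⟨rfl, rfl⟩ | ⟨rfl, rfl⟩⟩ | ⟨-, -, h⟩ | ⟨-, -, h⟩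
  · exact key hpq.1 h
  · exact (key hpq.1 h).symm
  · exact arc_adj h
  · have := arc_adj h
    simp only [Adj] at *
    grind

theorem swap_bounds {n a b : Z} (hK : K = n + 1) (ha : 0 ≤ a) (ha' : a + 1 ≤ n) (hb : 0 ≤ b)
    (hb' : b ≤ n) {r : Z × Z} (hr : (0 ≤ r.1 ∧ r.1 ≤ n) ∧ 0 ≤ r.2 ∧ r.2 ≤ n) {x y : Z}
    (h : (x, y) = swap K a b r) : (-K ≤ x ∧ x ≤ K) ∧ (-K < y ∧ y < K) ∧ y = r.2 - b ∧
      (x = K → r.1 = a) ∧ (x = -K → r.1 = a + 1) := by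
  obtain ⟨r1, r2⟩ := r
  dsimp at hr
  rcases le_or_gt r1 a with h' | h'
  · rw [swap_left h', Prod.mk.injEq] at h
    obtain ⟨rfl, rfl⟩ := h
    refine ⟨⟨by linarith, by linarith⟩, ⟨by linarith, by linarith⟩, rfl, fun h => ?_, fun h => ?_⟩
    · dsimp; linarith
    · linarith
  · have := DiscreteRing.add_one_le h'
    rw [swap_right h', Prod.mk.injEq] at h
    obtain ⟨rfl, rfl⟩ := h
    refine ⟨⟨by linarith, by linarith⟩, ⟨by linarith, by linarith⟩, rfl, fun h => ?_, fun h => ?_⟩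
    · linarith
    · dsimp; linarith

end EdgeRel

/-! ### Attaching the tails to the swapped paths -/

namespace EdgeRel

variable {Z : Type*} [CommRing Z] [LinearOrder Z]

/-- The region that contains the image of the grid. -/
def InnerRegion (K x y : Z) : Prop :=
  (-K ≤ x ∧ x ≤ K) ∧ (-K < y ∧ y < K) ∨ ArcRegion K x y

/-- The path `I` with two tails attached. -/
def addTails (T I T' : Z × Z → Z × Z → Prop) : Z × Z → Z × Z → Prop :=
  union (union T I) (rotate T')

variable [IsStrictOrderedRing Z] {K N x y : Z} {I J T T' : Z × Z → Z × Z → Prop}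

/-- The tails of R therefore touch the swapped grid and its arcs only at their starting points;
`InnerRegion.neg` gives the same for the rotated tails. -/
theorem InnerRegion.not_upper (h : InnerRegion K x y) (hK : 1 < K) (hN : N = 2 * K) :
    ¬ UpperRegion K N x y := by
  rintro ⟨h1, h2, h3⟩
  rcases h with ⟨h4, h5⟩ | ⟨h4, h5, h6⟩
  · rcases h3 with ⟨h3, h7 | h7⟩ | h3 | h3 | h3 <;> linarith
  · rcases h3 with ⟨h3, -⟩ | h3 | h3 | h3
    · rcases h4 with h | h <;> linarith
    all_goals linarith

theorem InnerRegion.neg (h : InnerRegion K x y) : InnerRegion K (-x) (-y) := by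
  rcases h with ⟨h4, h5⟩ | ⟨h4, h5, h6⟩
  · exact .inl ⟨⟨by linarith, by linarith⟩, by linarith, by linarith⟩
  · exact .inr ⟨h4.symm.imp (fun _ => by linarith) fun _ => by linarith,
      ⟨by linarith, by linarith⟩, by linarith, by linarith⟩

theorem InnerRegion.eq_of_downTail (h : InnerRegion K x y) (hK : 1 < K) (hN : N = 2 * K)
    (h' : Supp (downTail K N) (x, y)) : (x, y) = (K, 0) := by
  rcases h with ⟨h4, h5⟩ | ⟨h4, h5, h6⟩
  · rcases supp_downTail h' with h' | h'
    · exact Prod.ext (by dsimp; linarith) h'.1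
    · linarith
  · rcases supp_downTail h' with h' | h'
    · rcases h4 with h | h <;> linarith
    · linarith

theorem isPath_addTails {s s' : Z × Z} (hK : 1 < K) (hN : N = 2 * K) (hI : IsPath I s (-s'))
    (hr : ∀ x y, Supp I (x, y) → InnerRegion K x y)
    (hT : IsPath T s (N, N)) (hT' : IsPath T' s' (N, N)) (hs : s.2 = 1) (hs' : s'.2 = 1)
    (h1 : ∀ x y, Supp T (x, y) → (x, y) = s ∨ UpperRegion K N x y)
    (h2 : ∀ x y, Supp T' (x, y) → (x, y) = s' ∨ UpperRegion K N x y) :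
    IsPath (addTails T I T') (N, N) (-N, -N) := by
  have h3 : IsPath (rotate T') (-s') (-N, -N) := hT'.rotate
  obtain ⟨s1, s2⟩ := s
  obtain ⟨s1', s2'⟩ := s'
  dsimp at hs hs'
  subst hs hs'
  refine (hT.reverse.trans hI ?_ ?_).trans h3 ?_ ?_
  · intro h; have := congrArg Prod.snd h; dsimp at this; linarith
  · rintro ⟨x, y⟩ h h'
    exact (h1 x y h).resolve_right ((hr x y h').not_upper hK hN)
  · intro h; have := congrArg Prod.fst h; dsimp at this; linarith
  · rintro ⟨x, y⟩ h h'
    have h4 := h2 _ _ (supp_rotate h')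
    rcases supp_union.1 h with h | h
    · have h5 := h1 _ _ h
      unfold UpperRegion at h4 h5
      simp only [Prod.mk.injEq] at h4 h5
      exfalso
      have : y ≤ -1 := by rcases h4 with h | h <;> linarith
      have : 1 ≤ y := by rcases h5 with h | h <;> linarith
      linarith
    · have := h4.resolve_right ((hr x y h).neg.not_upper hK hN)
      rw [← this]; simp

/-- A tail of J has y ≥ 1 and x > -N, so it misses `downTail`, where y ≤ 0, and its rotation, where
y = 0 or x = -N; half turns give the other pairs. A tail meets the inner path of the other colour at
most at its own starting point, which lies on the path of its own colour. -/
theorem disjoint_addTails {s s' : Z × Z} (hK : 1 < K) (hN : N = 2 * K)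
    (hI : IsPath I (K, 0) (-K, 0)) (hJ : IsPath J s (-s'))
    (hrI : ∀ x y, Supp I (x, y) → InnerRegion K x y)
    (hrJ : ∀ x y, Supp J (x, y) → InnerRegion K x y)
    (hs : s = (K, 1) ∨ s = (-K, 1)) (hs' : s' = (K, 1) ∨ s' = (-K, 1))
    (h1 : ∀ x y, Supp T (x, y) → (x, y) = s ∨ UpperRegion K N x y)
    (h2 : ∀ x y, Supp T' (x, y) → (x, y) = s' ∨ UpperRegion K N x y)
    (hd : ∀ p, Supp I p → ¬ Supp J p) (p : Z × Z)
    (h : Supp (addTails (downTail K N) I (downTail K N)) p) : ¬ Supp (addTails T J T') p := by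
  have key {s : Z × Z} {x y : Z} (hs : s = (K, 1) ∨ s = (-K, 1))
      (h : (x, y) = s ∨ UpperRegion K N x y) : 1 ≤ y ∧ -N < x := by
    rcases h with rfl | h
    · simp only [Prod.mk.injEq] at hs
      constructor <;> rcases hs with hs | hs <;> linarith
    · exact ⟨h.1.1, by linarith [h.2.1.1]⟩
  obtain ⟨x, y⟩ := p
  intro h'
  rcases supp_union.1 h with h | h
  · rcases supp_union.1 h with h | h
    · rcases supp_union.1 h' with h' | h'
      · rcases supp_union.1 h' with h' | h'
        · have := key hs (h1 _ _ h')
          rcases supp_downTail h with h | h <;> linarith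
        · have e := (hrJ x y h').eq_of_downTail hK hN h
          rw [e] at h'
          exact hd _ hI.left.supp h'
      · have := key hs' (h2 _ _ (supp_rotate h'))
        rcases supp_downTail h with h | h <;> linarith
    · rcases supp_union.1 h' with h' | h'
      · rcases supp_union.1 h' with h' | h'
        · have e := (h1 x y h').resolve_right ((hrI x y h).not_upper hK hN)
          rw [e] at h
          exact hd _ h hJ.left.supp
        · exact hd _ h h'
      · have e := (h2 _ _ (supp_rotate h')).resolve_right ((hrI x y h).neg.not_upper hK hN)
        have e' : (x, y) = -s' := by rw [← e]; simp
        rw [e'] at h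
        exact hd _ h hJ.right.supp
  · have h := supp_rotate h
    rcases supp_union.1 h' with h' | h'
    · rcases supp_union.1 h' with h' | h'
      · have := key hs (h1 _ _ h')
        rcases supp_downTail h with h | h <;> linarith
      · have e := (hrJ x y h').neg.eq_of_downTail hK hN h
        have e' : (x, y) = (-K, 0) := by
          simp only [Prod.mk.injEq] at e ⊢
          exact ⟨by linarith, by linarith⟩
        rw [e'] at h'
        exact hd _ hI.right.supp h'
    · have := key hs' (h2 _ _ (supp_rotate h'))
      rcases supp_downTail h with h | h <;> linarith

theorem InnerRegion.bounds (hK : 1 < K) (hN : N = 2 * K) (h : InnerRegion K x y) :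
    (-N ≤ x ∧ x ≤ N) ∧ -N ≤ y ∧ y ≤ N := by
  rcases h with ⟨h4, h5⟩ | ⟨h4, h5, h6⟩ <;>
    refine ⟨⟨?_, ?_⟩, ?_, ?_⟩ <;> linarith

theorem bounds_addTails (hK : 1 < K) (hN : N = 2 * K)
    (hr : ∀ x y, Supp I (x, y) → InnerRegion K x y)
    (hT : ∀ x y, Supp T (x, y) → (-N ≤ x ∧ x ≤ N) ∧ -N ≤ y ∧ y ≤ N)
    (hT' : ∀ x y, Supp T' (x, y) → (-N ≤ x ∧ x ≤ N) ∧ -N ≤ y ∧ y ≤ N) (p : Z × Z)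
    (h : Supp (addTails T I T') p) : (-N ≤ p.1 ∧ p.1 ≤ N) ∧ -N ≤ p.2 ∧ p.2 ≤ N := by
  obtain ⟨x, y⟩ := p
  rcases supp_union.1 h with h | h
  · rcases supp_union.1 h with h | h
    · exact hT _ _ h
    · exact (hr _ _ h).bounds hK hN
  · have := hT' _ _ (supp_rotate h)
    exact ⟨⟨by linarith, by linarith⟩, by linarith, by linarith⟩

theorem bounds_downTail (hK : 1 < K) (hN : N = 2 * K) (h : Supp (downTail K N) (x, y)) :
    (-N ≤ x ∧ x ≤ N) ∧ -N ≤ y ∧ y ≤ N := by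
  rcases supp_downTail h with h | h <;> refine ⟨⟨?_, ?_⟩, ?_, ?_⟩ <;> linarith

theorem IsTail.bounds (hT : IsTail K N T) (hK : 1 < K) (hN : N = 2 * K) (h : Supp T (x, y)) :
    (-N ≤ x ∧ x ≤ N) ∧ -N ≤ y ∧ y ≤ N := by
  rcases hT with rfl | rfl
  · rcases supp_shortTail h with h | h <;> refine ⟨⟨?_, ?_⟩, ?_, ?_⟩ <;> linarith
  · rcases supp_longTail h with h | h | h <;> refine ⟨⟨?_, ?_⟩, ?_, ?_⟩ <;> linarith

theorem addTails_adj (hT : ∀ {p q}, T p q → Adj p q) (hI : ∀ {p q}, I p q → Adj p q)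
    (hT' : ∀ {p q}, T' p q → Adj p q) (p q : Z × Z) (h : addTails T I T' p q) : Adj p q := by
  rcases h with (h | h) | h
  exacts [hT h, hI h, rotate_adj hT' h]

variable [DiscreteRing Z]

theorem isPath_addTails_down (hK : 1 < K) (hN : N = 2 * K) (hI : IsPath I (K, 0) (-K, 0))
    (hr : ∀ x y, Supp I (x, y) → InnerRegion K x y) :
    IsPath (addTails (downTail K N) I (downTail K N)) (N, -N) (-N, N) := by
  have h1 := isPath_downTail (K := K) (N := N) (by linarith) (by linarith)
  have h2 : IsPath (rotate (downTail K N)) (-K, 0) (-N, N) := by simpa using h1.rotate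
  refine (h1.reverse.trans hI ?_ ?_).trans h2 ?_ ?_
  · intro h; have := congrArg Prod.fst h; dsimp at this; linarith
  · rintro ⟨x, y⟩ h h'
    exact (hr x y h').eq_of_downTail hK hN h
  · intro h; have := congrArg Prod.fst h; dsimp at this; linarith
  · rintro ⟨x, y⟩ h h'
    have h3 := supp_rotate h'
    rcases supp_union.1 h with h | h
    · have := supp_downTail h
      have := supp_downTail h3
      grind
    · have := (hr x y h).neg.eq_of_downTail hK hN h3
      simp only [Prod.mk.injEq] at this ⊢
      exact ⟨by linarith, by linarith⟩

/-! ### Swapping the half planes of a curve and a path -/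

theorem cutGrid_of_not_crossing {n a b : Z} {F : Z × Z → Z × Z → Prop}
    (hadj : ∀ p q, F p q → Adj p q) (hsymm : ∀ p q, F p q → F q p) (hbox : InBox n F)
    (hF : ∀ y, y = b - 1 ∨ y = b ∨ y = b + 1 → ¬ F (a, y) (a + 1, y)) (p q : Z × Z)
    (h : F p q) : cutGrid n a b p q := by
  refine ⟨hadj _ _ h, hbox p ⟨q, h⟩, hbox q ⟨p, hsymm _ _ h⟩, fun hc => ?_⟩
  obtain ⟨p1, p2⟩ := p
  obtain ⟨q1, q2⟩ := q
  obtain ⟨h1, h2⟩ := hc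
  dsimp at *
  subst h1
  have h3 : F (a, p2) (a + 1, p2) := by
    rcases h2 with ⟨rfl, rfl⟩ | ⟨rfl, rfl⟩
    exacts [h, hsymm _ _ h]
  have h4 : ¬ (p2 = b - 1 ∨ p2 = b ∨ p2 = b + 1) := fun h => hF _ h h3
  push Not at h4
  rcases lt_or_gt_of_ne h4.2.1 with h5 | h5
  · have := DiscreteRing.add_one_le h5
    have := DiscreteRing.add_one_le (lt_of_le_of_ne (show p2 ≤ b - 1 by linarith) h4.1)
    right; linarith
  · have := DiscreteRing.add_one_le h5
    have := DiscreteRing.add_one_le (lt_of_le_of_ne this (Ne.symm h4.2.2))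
    left; linarith

theorem image_inner {n a b : Z} {F : Z × Z → Z × Z → Prop} (hK : K = n + 1) (ha : 0 ≤ a)
    (ha' : a + 1 ≤ n) (hb : 0 ≤ b) (hb' : b ≤ n) (hF : ∀ p q, F p q → cutGrid n a b p q) (x y : Z)
    (h : Supp (image (swapEdge K a b) F) (x, y)) : InnerRegion K x y := by
  rcases supp_image_swapEdge hK hb hb' hF h with ⟨r, ⟨s, hs⟩, e⟩ | h
  · have hr : (0 ≤ r.1 ∧ r.1 ≤ n) ∧ 0 ≤ r.2 ∧ r.2 ≤ n := by
      rcases hs with hs | hs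
      exacts [(hF _ _ hs).2.1, (hF _ _ hs).2.2.1]
    have := swap_bounds hK ha ha' hb hb' hr e
    exact .inl ⟨this.1, this.2.1⟩
  · exact .inr h

/-- Removal of the edges between the columns `a` and `a + 1` in the rows `b + 1` and `b - 1`. -/
def erasePair (a b : Z) (H : Z × Z → Z × Z → Prop) : Z × Z → Z × Z → Prop :=
  erase (erase H (a, b + 1) (a + 1, b + 1)) (a, b - 1) (a + 1, b - 1)

/-- Collects the geometry of the harder direction. The explicit equations for G' and H' are kept in
the conclusion because definability is read off from them. -/
theorem exists_swapped_paths {n a b : Z} {G H : Z × Z → Z × Z → Prop} (hK : K = n + 1)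
    (hN : N = 2 * K) (ha : 0 ≤ a) (ha' : a + 1 ≤ n) (hb : 1 ≤ b) (hb' : b + 1 ≤ n)
    (hGadj : ∀ p q, G p q → Adj p q) (hHadj : ∀ p q, H p q → Adj p q) (hGbox : InBox n G)
    (hHbox : InBox n H) (hG : IsCycle G) (hab : G (a, b) (a + 1, b))
    (hG1 : ¬ Supp G (a, b + 1)) (hG2 : ¬ Supp G (a, b - 1))
    (hH : IsPath H (a, b + 1) (a, b - 1)) (hd : ∀ p, Supp G p → ¬ Supp H p) :
    ∃ T T' G' H', IsTail K N T ∧ IsTail K N T' ∧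
      G' = addTails (downTail K N) (image (swapEdge K a b) (erase G (a, b) (a + 1, b)))
        (downTail K N) ∧
      H' = addTails T (image (swapEdge K a b) (erasePair a b H)) T' ∧
      IsPath G' (-N, N) (N, -N) ∧ IsPath H' (-N, -N) (N, N) ∧ (∀ p, Supp G' p → ¬ Supp H' p) ∧
      (∀ p q, G' p q → Adj p q) ∧ (∀ p q, H' p q → Adj p q) ∧
      (∀ p, Supp G' p → (-N ≤ p.1 ∧ p.1 ≤ N) ∧ -N ≤ p.2 ∧ p.2 ≤ N) ∧
      (∀ p, Supp H' p → (-N ≤ p.1 ∧ p.1 ≤ N) ∧ -N ≤ p.2 ∧ p.2 ≤ N) := by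
  have hK1 : 1 < K := by linarith
  have hpG := hG.isPath_erase hab
  -- After the crossing in row b + 1 is removed, the upper end lies in column a or a + 1; next,
  -- likewise for the lower end and row b - 1.
  obtain ⟨e₁, he₁, hp₁⟩ := hH.exists_isPath_erase (q := (a + 1, b + 1)) (by
    intro h; have := congrArg Prod.snd h; dsimp at this; linarith)
  obtain ⟨e₂, he₂, hp₂⟩ := hp₁.reverse.exists_isPath_erase (q := (a + 1, b - 1)) (by
    rintro rfl
    simp only [Prod.mk.injEq] at he₁
    rcases he₁ with h | h <;> linarith)
  have hpH : IsPath (erasePair a b H) e₁ e₂ := hp₂.reverse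
  have hGT := cutGrid_of_not_crossing (n := n) (a := a) (b := b)
    (fun p q h => hGadj p q h.1) hpG.symm (fun p hp => hGbox p hp.of_erase) (by
      rintro y (rfl | rfl | rfl) h
      · exact hG2 ⟨_, h.1⟩
      · exact h.2.1 ⟨rfl, rfl⟩
      · exact hG1 ⟨_, h.1⟩)
  have hHT := cutGrid_of_not_crossing (n := n) (a := a) (b := b)
    (fun p q h => hHadj p q h.1.1) hpH.symm (fun p hp => hHbox p hp.of_erase.of_erase) (by
      rintro y (rfl | rfl | rfl) h
      · exact h.2.1 ⟨rfl, rfl⟩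
      -- In row b nothing has to be removed from H, since (a, b) lies on the curve.
      · exact hd _ ⟨_, hab⟩ ⟨_, h.1.1⟩
      · exact h.1.2.1 ⟨rfl, rfl⟩)
  have hdraw := isDrawing_swap hK ha ha' (by linarith : 0 ≤ b) (by linarith)
  have hI := hdraw.isPath_image (fun _ _ => cutGrid_symm) hGT hpG
  have hJ := hdraw.isPath_image (fun _ _ => cutGrid_symm) hHT hpH
  have hrI := image_inner hK ha ha' (by linarith) (by linarith) hGT
  have hrJ := image_inner hK ha ha' (by linarith) (by linarith) hHT
  have hdIJ := hdraw.disjoint_image hGT hHT hpG.symm hpH.symm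
    fun p h h' => hd p h.of_erase h'.of_erase.of_erase
  have hl (y : Z) : swap K a b (a, y) = (K, y - b) := by rw [swap_left le_rfl]; simp
  have hr (y : Z) : swap K a b (a + 1, y) = (-K, y - b) := by
    rw [swap_right (lt_add_one a)]; simp
  rw [hl, hr, sub_self] at hI
  have hs : swap K a b e₁ = (K, 1) ∨ swap K a b e₁ = (-K, 1) := by
    rcases he₁ with rfl | rfl
    · left; rw [hl]; simp
    · right; rw [hr]; simp
  have hs' : -swap K a b e₂ = (K, 1) ∨ -swap K a b e₂ = (-K, 1) := by
    rcases he₂ with rfl | rfl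
    · right; rw [hl]; simp
    · left; rw [hr]; simp
  -- The lower end is handled by a half turn: its negative is one of the two upper starting points.
  rw [← neg_neg (swap K a b e₂)] at hJ
  generalize swap K a b e₁ = s at hs hJ
  generalize -swap K a b e₂ = s' at hs' hJ
  obtain ⟨T, hT, hTp, hTr⟩ := exists_isTail (K := K) (N := N) (by linarith) (by linarith) hs
  obtain ⟨T', hT', hTp', hTr'⟩ := exists_isTail (K := K) (N := N) (by linarith) (by linarith) hs'
  refine ⟨T, T', _, _, hT, hT', rfl, rfl, (isPath_addTails_down hK1 hN hI hrI).reverse,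
    (isPath_addTails hK1 hN hJ hrJ hTp hTp' ?_ ?_ hTr hTr').reverse,
    disjoint_addTails hK1 hN hI hJ hrI hrJ hs hs' hTr hTr' hdIJ,
    addTails_adj downTail_adj ?_ downTail_adj, addTails_adj hT.adj ?_ hT'.adj,
    bounds_addTails hK1 hN hrI (fun _ _ => bounds_downTail hK1 hN)
      (fun _ _ => bounds_downTail hK1 hN),
    bounds_addTails hK1 hN hrJ (fun _ _ => hT.bounds hK1 hN) (fun _ _ => hT'.bounds hK1 hN)⟩
  · rcases hs with rfl | rfl <;> rfl
  · rcases hs' with rfl | rfl <;> rfl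
  · rintro x y ⟨p, q, hpq, h⟩
    exact swapEdge_adj (hGT _ _ hpq) h
  · rintro x y ⟨p, q, hpq, h⟩
    exact swapEdge_adj (hHT _ _ hpq) h

end EdgeRel

namespace EdgeRel

variable {Z : Type*} [CommRing Z]

/-- If a point of degree `2` has no neighbour above or below it, it has one to its right. -/
theorem right_of_degTwo {a b : Z} {G : Z × Z → Z × Z → Prop} (hadj : ∀ p q, G p q → Adj p q)
    (hsymm : ∀ p q, G p q → G q p) (h1 : ¬ Supp G (a, b + 1)) (h2 : ¬ Supp G (a, b - 1))
    (h : DegTwo G (a, b)) : G (a, b) (a + 1, b) := by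
  have key (q : Z × Z) (hq : G (a, b) q) : q = (a + 1, b) ∨ q = (a - 1, b) := by
    obtain ⟨x, y⟩ := q
    rcases hadj _ _ hq with ⟨h3, h4⟩ | ⟨h3, h4⟩ <;> dsimp at h3 h4
    · subst h4
      rcases h3 with h3 | h3
      · exact .inl (by rw [h3])
      · exact .inr (by rw [← h3, add_sub_cancel_right])
    · subst h3
      rcases h4 with rfl | rfl
      · exact (h1 ⟨_, hsymm _ _ hq⟩).elim
      · exact (h2 ⟨_, hsymm _ _ (by simpa using hq)⟩).elim
  obtain ⟨q, q', hne, hq, hq', -⟩ := h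
  rcases key _ hq with rfl | rfl
  · exact hq
  · rcases key _ hq' with rfl | rfl
    exacts [hq', (hne rfl).elim]

end EdgeRel

/-! ### Definability of the swapped sets of edges -/

namespace TwoSorted

open EdgeRel DifferenceRing

variable {M : Structure} {prm : ℕ → M.Num} {B : M.Str} {k : ℕ}

namespace IsDef

theorem congr {P Q : (Fin k → M.Num) → Prop} (h : IsDef prm B P) (e : ∀ w, P w ↔ Q w) :
    IsDef prm B Q := by
  rwa [← funext fun w => propext (e w)]

variable [VZeroModel M] {f₁ f₂ f₃ f₄ g₁ g₂ g₃ g₄ : (Fin k → M.Num) → M.IntRing}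
  {G : M.IntRing × M.IntRing → M.IntRing × M.IntRing → Prop}

theorem prodEq (h₁ : IsTerm prm f₁) (h₂ : IsTerm prm f₂) (h₃ : IsTerm prm f₃)
    (h₄ : IsTerm prm f₄) : IsDef prm B fun w => (f₁ w, f₂ w) = (f₃ w, f₄ w) :=
  ((eq h₁ h₃).and (eq h₂ h₄)).congr fun _ => Prod.mk_inj.symm

protected theorem erase (h₁ : IsTerm prm f₁) (h₂ : IsTerm prm f₂) (h₃ : IsTerm prm f₃)
    (h₄ : IsTerm prm f₄) (h₁' : IsTerm prm g₁) (h₂' : IsTerm prm g₂) (h₃' : IsTerm prm g₃)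
    (h₄' : IsTerm prm g₄) (hG : IsDef prm B fun w => G (f₁ w, f₂ w) (f₃ w, f₄ w)) :
    IsDef prm B fun w => erase G (g₁ w, g₂ w) (g₃ w, g₄ w) (f₁ w, f₂ w) (f₃ w, f₄ w) :=
  .and hG <| .and (.not <| .and (.prodEq h₁ h₂ h₁' h₂') (.prodEq h₃ h₄ h₃' h₄'))
    (.not <| .and (.prodEq h₁ h₂ h₃' h₄') (.prodEq h₃ h₄ h₁' h₂'))

variable {K N a b l : (Fin k → M.Num) → M.IntRing}

protected theorem erasePair (h₁ : IsTerm prm f₁) (h₂ : IsTerm prm f₂) (h₃ : IsTerm prm f₃)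
    (h₄ : IsTerm prm f₄) (ha : IsTerm prm a) (hb : IsTerm prm b)
    (hG : IsDef prm B fun w => G (f₁ w, f₂ w) (f₃ w, f₄ w)) :
    IsDef prm B fun w => erasePair (a w) (b w) G (f₁ w, f₂ w) (f₃ w, f₄ w) :=
  .and (.erase h₁ h₂ h₃ h₄ ha (hb.add .one) (ha.add .one) (hb.add .one) hG) <|
    .and (.not <| .and (.prodEq h₁ h₂ ha (hb.sub .one))
      (.prodEq h₃ h₄ (ha.add .one) (hb.sub .one)))
    (.not <| .and (.prodEq h₁ h₂ (ha.add .one) (hb.sub .one)) (.prodEq h₃ h₄ ha (hb.sub .one)))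

protected theorem arc (hK : IsTerm prm K) (hl : IsTerm prm l) (h₁ : IsTerm prm f₁)
    (h₂ : IsTerm prm f₂) (h₃ : IsTerm prm f₃) (h₄ : IsTerm prm f₄) :
    IsDef prm B fun w => arc (K w) (l w) (f₁ w, f₂ w) (f₃ w, f₄ w) :=
  have h := hK.two_mul.sub hl
  .or (.or (.or (.or (.hSeg hK h hl h₁ h₂ h₃ h₄) (.vSeg hl h h h₁ h₂ h₃ h₄))
    (.hSeg h.neg h h h₁ h₂ h₃ h₄)) (.vSeg hl h h.neg h₁ h₂ h₃ h₄))
    (.hSeg h.neg hK.neg hl h₁ h₂ h₃ h₄)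

protected theorem crosses (ha : IsTerm prm a) (h₁ : IsTerm prm f₁) (h₂ : IsTerm prm f₂)
    (h₃ : IsTerm prm f₃) (h₄ : IsTerm prm f₄) :
    IsDef prm B fun w => Crosses (a w) (f₁ w, f₂ w) (f₃ w, f₄ w) :=
  .and (.eq h₂ h₄) <| .or (.and (.eq h₁ ha) (.eq h₃ (ha.add .one)))
    (.and (.eq h₃ ha) (.eq h₁ (ha.add .one)))

protected theorem swap (hK : IsTerm prm K) (ha : IsTerm prm a) (hb : IsTerm prm b)
    (h₁ : IsTerm prm f₁) (h₂ : IsTerm prm f₂) (h₃ : IsTerm prm f₃) (h₄ : IsTerm prm f₄) :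
    IsDef prm B fun w => (f₃ w, f₄ w) = swap (K w) (a w) (b w) (f₁ w, f₂ w) := by
  refine ((and (.le h₁ ha) (.prodEq h₃ h₄ ((h₁.sub ha).add hK) (h₂.sub hb))).or
    (.and (.not <| .le h₁ ha)
      (.prodEq h₃ h₄ (((h₁.sub ha).sub .one).sub hK) (h₂.sub hb)))).congr fun w => ?_
  unfold EdgeRel.swap
  split_ifs with h <;> simp [h]

protected theorem swapEdge (hK : IsTerm prm K) (ha : IsTerm prm a) (hb : IsTerm prm b)
    (h₁ : IsTerm prm f₁) (h₂ : IsTerm prm f₂) (h₃ : IsTerm prm f₃) (h₄ : IsTerm prm f₄)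
    (h₁' : IsTerm prm g₁) (h₂' : IsTerm prm g₂) (h₃' : IsTerm prm g₃) (h₄' : IsTerm prm g₄) :
    IsDef prm B fun w => swapEdge (K w) (a w) (b w) (f₁ w, f₂ w) (f₃ w, f₄ w) (g₁ w, g₂ w)
      (g₃ w, g₄ w) :=
  have hc := IsDef.crosses ha h₁ h₂ h₃ h₄
  .or (.and hc.not <| .or
    (.and (.swap hK ha hb h₁ h₂ h₁' h₂') (.swap hK ha hb h₃ h₄ h₃' h₄'))
    (.and (.swap hK ha hb h₃ h₄ h₁' h₂') (.swap hK ha hb h₁ h₂ h₃' h₄'))) <|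
  .or (.and hc <| .and (.le (hb.add .one) h₂) (.arc hK (h₂.sub hb) h₁' h₂' h₃' h₄'))
    (.and hc <| .and (.le (h₂.add .one) hb) (.arc hK (hb.sub h₂) h₁' h₂'.neg h₃' h₄'.neg))

protected theorem downTail (hK : IsTerm prm K) (hN : IsTerm prm N) (h₁ : IsTerm prm f₁)
    (h₂ : IsTerm prm f₂) (h₃ : IsTerm prm f₃) (h₄ : IsTerm prm f₄) :
    IsDef prm B fun w => downTail (K w) (N w) (f₁ w, f₂ w) (f₃ w, f₄ w) :=
  .or (.hSeg hK hN .zero h₁ h₂ h₃ h₄) (.vSeg hN.neg .zero hN h₁ h₂ h₃ h₄)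

protected theorem rotate
    (h : IsDef prm B fun w => G (-f₁ w, -f₂ w) (-f₃ w, -f₄ w)) :
    IsDef prm B fun w => rotate G (f₁ w, f₂ w) (f₃ w, f₄ w) := h

protected theorem tail {K N : M.IntRing} {T : M.IntRing × M.IntRing → M.IntRing × M.IntRing → Prop}
    (hT : IsTail K N T) (hK : IsTerm prm fun _ : Fin k → M.Num => K)
    (hN : IsTerm prm fun _ : Fin k → M.Num => N) (h₁ : IsTerm prm f₁) (h₂ : IsTerm prm f₂)
    (h₃ : IsTerm prm f₃) (h₄ : IsTerm prm f₄) :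
    IsDef prm B fun w => T (f₁ w, f₂ w) (f₃ w, f₄ w) := by
  rcases hT with rfl | rfl
  · exact .or (.hSeg hK hN .one h₁ h₂ h₃ h₄) (.vSeg .one hN hN h₁ h₂ h₃ h₄)
  · have h := IsTerm.one.sub hN
    exact .or (.or (.hSeg h hK.neg .one h₁ h₂ h₃ h₄) (.vSeg .one hN h h₁ h₂ h₃ h₄))
      (.hSeg h hN hN h₁ h₂ h₃ h₄)

/-- Since G lies in the grid, the quantifiers over points become four number quantifiers bounded by
n. The definability of G is needed for every arity because it is used under these quantifiers. -/
theorem image_swapEdge {n : M.Num} {K a b : M.IntRing} (hbox : InBox (of _ n) G)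
    (hn : IsTerm prm fun _ : Fin k → M.Num => of _ n) (hK : IsTerm prm fun _ : Fin k → M.Num => K)
    (ha : IsTerm prm fun _ : Fin k → M.Num => a) (hb : IsTerm prm fun _ : Fin k → M.Num => b)
    (hsymm : ∀ p q, G p q → G q p) (h₁ : IsTerm prm f₁) (h₂ : IsTerm prm f₂) (h₃ : IsTerm prm f₃)
    (h₄ : IsTerm prm f₄)
    (hG : ∀ {k} {g₁ g₂ g₃ g₄ : (Fin k → M.Num) → M.IntRing}, IsTerm prm g₁ → IsTerm prm g₂ →
      IsTerm prm g₃ → IsTerm prm g₄ → IsDef prm B fun w => G (g₁ w, g₂ w) (g₃ w, g₄ w)) :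
    IsDef prm B fun w => image (swapEdge K a b) G (f₁ w, f₂ w) (f₃ w, f₄ w) := by
  refine (ex hn <| .ex hn.init <| .ex hn.init.init <| .ex hn.init.init.init <| .and
    (hG (.var (Fin.castSucc (Fin.castSucc (Fin.castSucc (Fin.last k)))))
      (.var (Fin.castSucc (Fin.castSucc (Fin.last _)))) (.var (Fin.castSucc (Fin.last _)))
      (.var (Fin.last _)))
    (.swapEdge hK.init.init.init.init ha.init.init.init.init hb.init.init.init.init
      (.var (Fin.castSucc (Fin.castSucc (Fin.castSucc (Fin.last k)))))
      (.var (Fin.castSucc (Fin.castSucc (Fin.last _)))) (.var (Fin.castSucc (Fin.last _)))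
      (.var (Fin.last _)) h₁.init.init.init.init h₂.init.init.init.init h₃.init.init.init.init
      h₄.init.init.init.init) :
    IsDef prm B fun w => ∃ c, of _ c ≤ of _ n ∧ ∃ d, of _ d ≤ of _ n ∧ ∃ e, of _ e ≤ of _ n ∧
      ∃ f, of _ f ≤ of _ n ∧ G (of _ c, of _ d) (of _ e, of _ f) ∧
        swapEdge K a b (of _ c, of _ d) (of _ e, of _ f) (f₁ w, f₂ w) (f₃ w, f₄ w)).congr
      fun w => ⟨?_, ?_⟩
  · rintro ⟨c, -, d, -, e, -, f, -, h⟩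
    exact ⟨_, _, h⟩
  · rintro ⟨⟨p1, p2⟩, ⟨q1, q2⟩, h⟩
    obtain ⟨⟨hp, hp'⟩, hp2, hp2'⟩ := hbox _ ⟨_, h.1⟩
    obtain ⟨⟨hq, hq'⟩, hq2, hq2'⟩ := hbox _ ⟨_, hsymm _ _ h.1⟩
    obtain ⟨c, rfl⟩ := exists_of_nonneg hp
    obtain ⟨d, rfl⟩ := exists_of_nonneg hp2
    obtain ⟨e, rfl⟩ := exists_of_nonneg hq
    obtain ⟨f, rfl⟩ := exists_of_nonneg hq2
    exact ⟨c, hp', d, hp2', e, hq', f, hq2', h⟩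

end IsDef

/-! ### From st-connectivity to the Jordan curve sentence -/

variable [VZeroModel M]

/-- A curve meets a path that joins the points immediately above and below a point of the curve. -/
theorem exists_supp_of_stConnectivity {v : ℕ → M.Num} {V : ℕ → M.Str}
    (hS : stConnectivitySentence.Holds M v V) {n a b : M.Num} {B R : M.Str} (hB : IsEdgeSet n B)
    (hR : IsEdgeSet n R) (hcB : IsCycle (edgeRel n B))
    (h1 : ¬ Supp (edgeRel n B) (of _ a, of _ b + 1))
    (h2 : ¬ Supp (edgeRel n B) (of _ a, of _ b - 1)) (h : DegTwo (edgeRel n B) (of _ a, of _ b))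
    (hpR : IsPath (edgeRel n R) (of _ a, of _ b + 1) (of _ a, of _ b - 1)) :
    ∃ p, Supp (edgeRel n B) p ∧ Supp (edgeRel n R) p := by
  rw [holds_stConnectivitySentence] at hS
  by_contra hcon
  push Not at hcon
  have boxB := IsEdgeSet.inBox n B
  have boxR := IsEdgeSet.inBox n R
  -- The edge of the curve at which the cycle will be opened.
  have hab := right_of_degTwo (fun _ _ => hB.adj) hcB.symm h1 h2 h
  have b1 := boxB _ h.supp
  have b2 := boxB _ ⟨_, hcB.symm _ _ hab⟩
  have b3 := boxR _ hpR.left.supp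
  have b4 := boxR _ hpR.right.supp
  dsimp at b1 b2 b3 b4
  obtain ⟨T, T', G', H', hT, hT', eG, eH, hpG, hpH, hd, adjG, adjH, boxG, boxH⟩ :=
    exists_swapped_paths (K := of _ n + 1) (N := 2 * (of _ n + 1)) rfl rfl b1.1.1 b2.1.2
      (by linarith) b3.2.2 (fun _ _ => hB.adj) (fun _ _ => hR.adj) boxB boxR hcB hab h1 h2 hpR hcon
  -- The square has half side N = 2(n + 1), so after translation by N it is the grid of side 2N =
  -- 4(n + 1).
  let prm : ℕ → M.Num := fun | 0 => 4 * (n + 1) | 1 => n | 2 => a | _ => b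
  have hN : of M.Num (prm 0) = 2 * (2 * (of _ n + 1)) := by
    simp only [prm, map_mul, map_add, map_one, map_ofNat]; ring
  have tn {k : ℕ} : IsTerm prm fun _ : Fin k → M.Num => of _ n :=
    IsTerm.param (i := 1) (by norm_num)
  have ta {k : ℕ} : IsTerm prm fun _ : Fin k → M.Num => of _ a :=
    IsTerm.param (i := 2) (by norm_num)
  have tb {k : ℕ} : IsTerm prm fun _ : Fin k → M.Num => of _ b :=
    IsTerm.param (i := 3) (by norm_num)
  have tK {k : ℕ} : IsTerm prm fun _ : Fin k → M.Num => of _ n + 1 := tn.add .one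
  have tN {k : ℕ} : IsTerm prm fun _ : Fin k → M.Num => 2 * (of _ n + 1) := tK.two_mul
  have tx (i : Fin 4) : IsTerm prm fun w : Fin 4 → M.Num => of _ (w i) - 2 * (of _ n + 1) :=
    .sub (.var i) tN
  have e1 : shift (2 * (of M.Num n + 1)) (point 0 (prm 0)) =
      (-(2 * (of _ n + 1)), 2 * (of _ n + 1)) := by
    simp only [shift, point, Equiv.coe_fn_mk, map_zero, hN]
    exact Prod.ext (by ring) (by ring)
  have e2 : shift (2 * (of M.Num n + 1)) (point (prm 0) 0) =
      (2 * (of _ n + 1), -(2 * (of _ n + 1))) := by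
    simp only [shift, point, Equiv.coe_fn_mk, map_zero, hN]
    exact Prod.ext (by ring) (by ring)
  have e3 : shift (2 * (of M.Num n + 1)) (point 0 0) =
      (-(2 * (of _ n + 1)), -(2 * (of _ n + 1))) := by
    simp only [shift, point, Equiv.coe_fn_mk, map_zero]
    exact Prod.ext (by ring) (by ring)
  have e4 : shift (2 * (of M.Num n + 1)) (point (prm 0) (prm 0)) =
      (2 * (of _ n + 1), 2 * (of _ n + 1)) := by
    simp only [shift, point, Equiv.coe_fn_mk, hN]
    exact Prod.ext (by ring) (by ring)
  have hsub : of M.Num (prm 0) - 2 * (of _ n + 1) = 2 * (of _ n + 1) := by rw [hN]; ring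
  obtain ⟨B', hB', eB⟩ := exists_edgeRel_shift (prm := prm) (B := B)
    (2 * (of M.Num n + 1)) (G := G')
    (by
      rw [eG]
      exact .or (.or (.downTail tK tN (tx 0) (tx 1) (tx 2) (tx 3))
        (.image_swapEdge (fun p hp => boxB p hp.of_erase) tn tK ta tb (hcB.isPath_erase hab).symm
          (tx 0) (tx 1) (tx 2) (tx 3) fun h₁ h₂ h₃ h₄ =>
            .erase h₁ h₂ h₃ h₄ ta tb (ta.add .one) tb
              (.edgeRel (i := 1) (by norm_num) h₁ h₂ h₃ h₄)))
        (.rotate <| .downTail tK tN (tx 0).neg (tx 1).neg (tx 2).neg (tx 3).neg))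
    hpG.symm adjG (by rwa [hsub])
  obtain ⟨R', hR', eR⟩ := exists_edgeRel_shift (prm := prm) (B := R)
    (2 * (of M.Num n + 1)) (G := H')
    (by
      rw [eH]
      exact .or (.or (.tail hT tK tN (tx 0) (tx 1) (tx 2) (tx 3))
        (.image_swapEdge (fun p hp => boxR p hp.of_erase.of_erase) tn tK ta tb
          (fun p q ⟨⟨h, h3, h4⟩, h5, h6⟩ =>
            ⟨⟨hpR.symm _ _ h, fun h => h4 h.symm, fun h => h3 h.symm⟩,
            fun h => h6 h.symm, fun h => h5 h.symm⟩)
          (tx 0) (tx 1) (tx 2) (tx 3) fun h₁ h₂ h₃ h₄ =>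
            .erasePair h₁ h₂ h₃ h₄ ta tb (.edgeRel (i := 1) (by norm_num) h₁ h₂ h₃ h₄)))
        (.rotate <| .tail hT' tK tN (tx 0).neg (tx 1).neg (tx 2).neg (tx 3).neg))
    hpH.symm adjH (by rwa [hsub])
  obtain ⟨p, hp, hp'⟩ := hS (prm 0) B' R' hB' hR'
    (eB ▸ IsPath.comap (shift (2 * (of M.Num n + 1))) (by rwa [e1, e2]))
    (eR ▸ IsPath.comap (shift (2 * (of M.Num n + 1))) (by rwa [e3, e4]))
  rw [eB] at hp
  rw [eR] at hp'
  exact hd _ ((supp_comap _).1 hp) ((supp_comap _).1 hp')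

theorem jordanCurve_of_stConnectivity (v : ℕ → M.Num) (V : ℕ → M.Str)
    (hS : stConnectivitySentence.Holds M v V) : jordanCurveSentence.Holds M v V := by
  rw [holds_jordanCurveSentence]
  intro n B R x₁ _ y₁ _ x₂ _ y₂ _ hB hR hcB ⟨hx, hy, hs1, hs2, y, hy', hdeg⟩ hpR
  simp only [point] at hx hy hs1 hs2 hy' hdeg hpR
  obtain ⟨a, -, b, -, e⟩ := exists_of_supp hdeg.supp
  simp only [Prod.mk.injEq] at e
  obtain ⟨e, rfl⟩ := e
  rw [← hx, e] at hs2 hpR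
  rw [e] at hs1 hdeg
  -- Either of the two points may be the upper one; if it is the second, the path is reversed.
  rcases hy with hy | hy
  · have e1 : of M.Num y₁ = of _ b - 1 := by linarith
    have e2 : of M.Num y₂ = of _ b + 1 := by linarith
    rw [e1] at hs1 hpR
    rw [e2] at hs2 hpR
    exact exists_supp_of_stConnectivity hS hB hR hcB hs2 hs1 hdeg hpR.reverse
  · have e1 : of M.Num y₁ = of _ b + 1 := by linarith
    have e2 : of M.Num y₂ = of _ b - 1 := by linarith
    rw [e1] at hs1 hpR
    rw [e2] at hs2 hpR
    exact exists_supp_of_stConnectivity hS hB hR hcB hs1 hs2 hdeg hpR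

end TwoSorted

theorem theoremt :
    TwoSorted.Proves TwoSorted.VZero
      (TwoSorted.jordanCurveSentence.iff TwoSorted.stConnectivitySentence) := by
  intro M hM v V
  have : TwoSorted.VZeroModel M := ⟨hM⟩
  exact TwoSorted.Formula.holds_iff.2 ⟨TwoSorted.stConnectivity_of_jordanCurve v V,
    TwoSorted.jordanCurve_of_stConnectivity v V⟩
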